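/- \textbf{Setting.} For each $N$ let $D,L,\lambda,G,P>0$ and $s$ be real numbers, with $L\ge 2D$, all of which may depend on $N$. In the plane take two horizontally aligned axis-parallel squares $C_T$ and $C_R$ of side length $D$ whose centers are at distance $L$; place $N$ nodes in each, all $2N$ nodes being independent and uniformly distributed in their squares. Let $d_{ik}$ be the Euclidean distance between node $k$ of $C_T$ and node $i$ of $C_R$, and let $H\in\mathbb{C}^{N\times N}$, $$H_{ik}=\frac{\sqrt G}{d_{ik}}\exp\Bigl(-\mathrm{j}\,\frac{2\pi}{\lambda}d_{ik}\Bigr).$$ For given node positions, consider the channel $Y=HX+W+Z$, where $X,W,Z$ are independent, $Z\sim\mathcal{CN}(0,I)$, and the interference $W$ has an arbitrary law on $\mathbb{C}^N$ with finite second moments and covariance matrix $\Sigma$. Its capacity is $C(H)=\sup I(X;Y)$ (in bits), the supremum being over all laws of $X$ on $\mathbb{C}^N$ with $\mathbb{E}|X_i|^2\le P$ for every $i$. Put $\rho_1=\frac{L^2}{NGP}\operatorname{tr}\Sigma$, $\rho_2=\frac{L^4}{N(GP)^2}\operatorname{tr}\Sigma^2$ and $$M=\max\Bigl\{1,\ \frac{D^2}{\lambda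 L}\Bigl(1+\bigl(\log\tfrac{D^2}{\lambda L}\bigr)^+\Bigr)^{-1}\Bigr\},$$ where $\log$ is to base $2$ and $x^+=\max\{x,0\}$. \textbf{Statement.} Let $\nu\ge 1$, $c_1,c_2,s_0>0$. There are constants $K_5',K_6'>0$, depending only on $\nu,c_1,c_2,s_0$ (in particular not on $D,L,N,\lambda$), such that for all $D,L,\lambda,G,P,s$ as above with $s\ge s_0$ for all large $N$ (that is, $s=\Omega(1)$), the argument of the logarithm below is positive for all large $N$, and with probability (over the node positions) tending to $1$ as $N\to\infty$ the following holds: for every interference $W$ with $$\rho_1\le c_1\,sN\quad\text{and}\quad \rho_2\le c_2\,s^{\nu}\max\{N^2,N^3M^{-1}\}$$ (that is, $\rho_1=O(sN)$ and $\rho_2=O(s^\nu\max\{N^2,N^3M^{-1}\})$), $$C(H)\ \ge\ \frac{K_5'}{s^{\nu+4}}\min\{N,M\}\,\log\left(1+K_6'\,\frac{\frac{NGP}{L^2}(1-s^{-1})}{1+\frac{NGP}{L^2}s}\right).$$ -/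

import Mathlib

open MeasureTheory ProbabilityTheory Filter Topology
open scoped ENNReal

namespace MIMO

/-! ### Node positions -/

/-- Euclidean distance between two points of the plane, given by their Cartesian coordinates. -/
noncomputable def planeDist (p q : ℝ × ℝ) : ℝ :=
  Real.sqrt ((p.1 - q.1) ^ 2 + (p.2 - q.2) ^ 2)

/-- The axis-parallel square with lower left corner `(a, b)` and side length `D`. -/
def square (a b D : ℝ) : Set (ℝ × ℝ) :=
  Set.Icc a (a + D) ×ˢ Set.Icc b (b + D)

/-- Uniform distribution on the square with lower left corner `(a, b)` and side length `D`. -/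
noncomputable def uniformSquare (a b D : ℝ) : Measure (ℝ × ℝ) :=
  ProbabilityTheory.cond volume (square a b D)

/-- A placement of the `2N` nodes: the first component holds the positions of the `N` transmitting
nodes, the second one those of the `N` receiving nodes. -/
abbrev Placement (N : ℕ) : Type := (Fin N → ℝ × ℝ) × (Fin N → ℝ × ℝ)

/-- The law of the placement: all `2N` nodes are independent, the transmitting nodes are uniform on
`C_T = [0, D] × [0, D]`, the receiving nodes are uniform on `C_R = [L, L + D] × [0, D]`. The two
squares are horizontally aligned and their centers are at distance `L`. -/
noncomputable def placementLaw (N : ℕ) (D L : ℝ) : Measure (Placement N) :=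
  (Measure.pi fun _ : Fin N => uniformSquare 0 0 D).prod
    (Measure.pi fun _ : Fin N => uniformSquare L 0 D)

/-! ### The channel -/

/-- The line-of-sight channel matrix for wavelength `wl` and gain `G`: the entry for the receiving
node `i` and the transmitting node `k` at distance `d` is `(√G / d) exp (-j (2π / wl) d)`. -/
noncomputable def channelMatrix {N : ℕ} (G wl : ℝ) (z : Placement N) :
    Matrix (Fin N) (Fin N) ℂ :=
  Matrix.of fun i k =>
    ((Real.sqrt G / planeDist (z.2 i) (z.1 k) : ℝ) : ℂ) *
      Complex.exp (-Complex.I * ((2 * Real.pi / wl * planeDist (z.2 i) (z.1 k) : ℝ) : ℂ))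

/-- The circularly symmetric complex Gaussian law `CN(0, 1)`: independent real and imaginary parts,
each with law `N(0, 1/2)`. -/
noncomputable def complexGaussian : Measure ℂ :=
  ((gaussianReal 0 (1 / 2)).prod (gaussianReal 0 (1 / 2))).map
    (fun p : ℝ × ℝ => (⟨p.1, p.2⟩ : ℂ))

/-- The law `CN(0, I)` on `ℂ^N`. -/
noncomputable def gaussianNoise (N : ℕ) : Measure (Fin N → ℂ) :=
  Measure.pi fun _ => complexGaussian

/-- The joint law of `(X, Y)` with `Y = H X + W + Z`, where `X`, `W`, `Z` are independent, `X` has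
law `μX`, `W` has law `μW` and `Z` has law `CN(0, I)`. -/
noncomputable def channelLaw {N : ℕ} (H : Matrix (Fin N) (Fin N) ℂ)
    (μW μX : Measure (Fin N → ℂ)) : Measure ((Fin N → ℂ) × (Fin N → ℂ)) :=
  (μX.prod (μW.prod (gaussianNoise N))).map
    (fun t => (t.1, H.mulVec t.1 + t.2.1 + t.2.2))

/-- The mutual information, in bits, of the two components of a pair with law `π`: the
Kullback-Leibler divergence of `π` from the product of its marginals. -/
noncomputable def mutualInfo {α β : Type*} [MeasurableSpace α] [MeasurableSpace β]
    (π : Measure (α × β)) : ℝ≥0∞ :=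
  InformationTheory.klDiv π (π.fst.prod π.snd) / ENNReal.ofReal (Real.log 2)

/-- The capacity, in bits, of the channel `Y = H X + W + Z` under the per-antenna power constraint
`E |X_i|² ≤ P`: the supremum of the mutual information `I(X; Y)` over all input laws that satisfy
the constraint. -/
noncomputable def capacity {N : ℕ} (H : Matrix (Fin N) (Fin N) ℂ)
    (μW : Measure (Fin N → ℂ)) (P : ℝ) : ℝ≥0∞ :=
  ⨆ (μX : Measure (Fin N → ℂ)) (_ : IsProbabilityMeasure μX)
    (_ : ∀ i, ∫⁻ x, ‖x i‖ₑ ^ 2 ∂μX ≤ ENNReal.ofReal P), mutualInfo (channelLaw H μW μX)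

/-! ### The interference -/

/-- The covariance matrix `E[(W - E W) (W - E W)*]` of a random vector with law `μ`. -/
noncomputable def covMatrix {N : ℕ} (μ : Measure (Fin N → ℂ)) : Matrix (Fin N) (Fin N) ℂ :=
  Matrix.of fun i j =>
    ∫ w, (w i - ∫ w', w' i ∂μ) * star (w j - ∫ w', w' j ∂μ) ∂μ

/-- `ρ₁ = L² / (N G P) · tr Σ`. -/
noncomputable def rho1 {N : ℕ} (L G P : ℝ) (S : Matrix (Fin N) (Fin N) ℂ) : ℝ :=
  L ^ 2 / (N * G * P) * S.trace.re

/-- `ρ₂ = L⁴ / (N (G P)²) · tr Σ²`. -/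
noncomputable def rho2 {N : ℕ} (L G P : ℝ) (S : Matrix (Fin N) (Fin N) ℂ) : ℝ :=
  L ^ 4 / (N * (G * P) ^ 2) * (S * S).trace.re

/-! ### The quantities in the bound -/

/-- `M = max {1, D²/(wl L) · (1 + (log₂ (D²/(wl L)))⁺)⁻¹}`. -/
noncomputable def dof (D L wl : ℝ) : ℝ :=
  max 1 (D ^ 2 / (wl * L) * (1 + max (Real.logb 2 (D ^ 2 / (wl * L))) 0)⁻¹)

/-- The argument `1 + K · x (1 - 1/s) / (1 + x s)`, `x = N G P / L²`, of the logarithm. -/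
noncomputable def logArg (K : ℝ) (N : ℕ) (L G P s : ℝ) : ℝ :=
  1 + K * ((N * G * P / L ^ 2 * (1 - s⁻¹)) / (1 + N * G * P / L ^ 2 * s))

/-! ### High probability -/

/-- The events `E N` hold with high probability as `N → ∞`: the (outer) probability of the
complement of `E N` tends to zero. -/
def WithHighProbability {Ω : ℕ → Type*} [∀ N, MeasurableSpace (Ω N)]
    (μ : ∀ N, Measure (Ω N)) (E : ∀ N, Set (Ω N)) : Prop :=
  Tendsto (fun N => μ N (E N)ᶜ) atTop (𝓝 0)

end MIMO

namespace MIMO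

open Matrix

/-! ### A variational lower bound for the Kullback-Leibler divergence -/

/-! The inputs are independent signs ±√P, and no mutual information or spectrum is computed. By
Donsker–Varadhan (`ofReal_integral_le_klDiv`), the divergence of the joint law from the product law
is at least the joint mean of any integrable f whose exponential has mean at most one under the
product law. With c(y) = t Hᴴ(y − E W), the choice f = 2 Re⟨c(y), x⟩ − 2P‖c(y)‖² qualifies whatever
the law of Y, because cosh u ≤ exp(u²/2). Only second moments then enter: `ofReal_le_capacity`
gives, in nats, 2tA − 2t²Q with A = P‖H‖² and Q = P(2P‖HᴴH‖² + 4 tr(HᴴΣH) + 4‖H‖²), in Frobenius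
norms. By Cauchy–Schwarz tr(HᴴΣH) ≤ ‖Σ‖ ‖HᴴH‖. As ‖H‖ is controlled by the geometry alone, ‖HᴴH‖ is
the only quantity that needs a probabilistic estimate, and one event of node positions serves all
interferences.

Put x = NGP/L² and m = min{N, M}. All distances are comparable to L, so A is of order xN. If
P²‖HᴴH‖² is at most of order (xN)²/m, then the condition on tr Σ² and the optimal t give A²/Q of
order at least m x/(1 + x), up to a power of s. For s ≥ 1 this dominates the claimed bound since
ln(1 + y) ≤ y; for s ≤ 1 the logarithm is nonpositive (`log_bound_le`).

It remains to bound ‖HᴴH‖², a sum over four-cycles made of two rows and two columns. Degenerate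
cycles contribute little (`frobSq_conjTranspose_mul_le`). The mean of a proper cycle is the mean
squared correlation of two random rows. Along a vertical segment the waves from heights q₁, q₂ have
a path difference whose derivative is at least of order |q₁ − q₂|/L, so integration by parts bounds
their correlation by a multiple of λL/(D|q₁ − q₂|) (`norm_integral_hyp_le`). Averaging over the
heights costs a logarithm and gives a multiple of 1/M (`integral_norm_vertCorr_le_dof`). The same
estimates, uniform in one position, control the second moment of the cycle sum
(`integral_fourSum_sq_le`): overlapping quadruples add a variance of order N⁷/m² against a squared
deviation of order N⁸/m², and Chebyshev bounds the failure probability by 48/N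
(`measure_fourSum_ge_le`). -/

/-- A form of the Donsker-Varadhan bound. -/
theorem ofReal_integral_le_klDiv {α : Type*} [MeasurableSpace α] (μ ν : Measure α)
    [IsProbabilityMeasure μ] [IsProbabilityMeasure ν] {f : α → ℝ} (hf : Measurable f)
    (hfμ : Integrable f μ) (hfν : ∫⁻ x, ENNReal.ofReal (Real.exp (f x)) ∂ν ≤ 1) :
    ENNReal.ofReal (∫ x, f x ∂μ) ≤ InformationTheory.klDiv μ ν := by
  by_cases htop : InformationTheory.klDiv μ ν = ∞
  · simp [htop]
  obtain ⟨hac, hint⟩ := InformationTheory.klDiv_ne_top_iff.1 htop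
  have hexp : Integrable (fun x => Real.exp (f x)) ν := by
    refine ⟨hf.exp.aestronglyMeasurable, ?_⟩
    rw [hasFiniteIntegral_iff_ofReal (ae_of_all _ fun x => (Real.exp_pos _).le)]
    exact hfν.trans_lt ENNReal.one_lt_top
  have hle : ∫ x, Real.exp (f x) ∂ν ≤ 1 := by
    rw [integral_eq_lintegral_of_nonneg_ae (ae_of_all _ fun x => (Real.exp_pos _).le)
      hf.exp.aestronglyMeasurable]
    exact ENNReal.toReal_le_of_le_ofReal zero_le_one (by simpa using hfν)
  have hpos : 0 < ∫ x, Real.exp (f x) ∂ν := integral_exp_pos hexp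
  have : IsProbabilityMeasure (ν.tilted f) := isProbabilityMeasure_tilted hexp
  -- Gibbs' inequality for μ against ν tilted by f. Expanding the tilted density turns it into KL(μ,
  -- ν) ≥ ∫ f dμ − log ∫ exp f dν, and the last logarithm is nonpositive.
  have h0 := InformationTheory.integral_llr_add_sub_measure_univ_nonneg
    (hac.trans (absolutelyContinuous_tilted hexp)) (integrable_llr_tilted_right hac hfμ hint hexp)
  rw [integral_llr_tilted_right hac hfμ hexp hint] at h0
  have h1 := InformationTheory.toReal_klDiv hac hint
  simp only [probReal_univ, add_sub_cancel_right] at h0 h1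
  rw [← ENNReal.ofReal_toReal htop, h1]
  have := Real.log_nonpos hpos.le hle
  exact ENNReal.ofReal_le_ofReal (by linarith)

/-! ### Second moments of vectors with independent entries -/

theorem integral_comp_measurePreserving {α β E : Type*} [MeasurableSpace α] [MeasurableSpace β]
    [NormedAddCommGroup E] [NormedSpace ℝ E] {μ : Measure α} {ν : Measure β} {T : α → β}
    (hT : MeasurePreserving T μ ν) {f : β → E} (hf : AEStronglyMeasurable f ν) :
    ∫ x, f (T x) ∂μ = ∫ y, f y ∂ν := by
  rw [← hT.map_eq, integral_map hT.measurable.aemeasurable (by rwa [hT.map_eq])]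

theorem memLp_eval_pi {N : ℕ} (μ : Measure ℂ) [IsProbabilityMeasure μ] (hμ : MemLp id 2 μ)
    (i : Fin N) : MemLp (fun x : Fin N → ℂ => x i) 2 (Measure.pi fun _ => μ) :=
  hμ.comp_measurePreserving (measurePreserving_eval _ i)

theorem integral_eval_pi {N : ℕ} (μ : Measure ℂ) [IsProbabilityMeasure μ] (hμ : MemLp id 2 μ)
    (i : Fin N) : ∫ x : Fin N → ℂ, x i ∂(Measure.pi fun _ => μ) = ∫ x, x ∂μ := by
  exact integral_comp_measurePreserving (measurePreserving_eval (fun _ : Fin N => μ) i) hμ.1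

theorem integral_sum_sq_pi {N : ℕ} (μ : Measure ℂ) [IsProbabilityMeasure μ]
    (c : Fin N → ℂ → ℝ) (hc : ∀ i, MemLp (c i) 2 μ) (h0 : ∀ i, ∫ x, c i x ∂μ = 0) :
    ∫ x : Fin N → ℂ, (∑ i, c i (x i)) ^ 2 ∂(Measure.pi fun _ => μ) = ∑ i, ∫ x, c i x ^ 2 ∂μ := by
  have h := variance_sum_pi (μ := fun _ : Fin N => μ) hc
  have hmean : ∫ x : Fin N → ℂ, (∑ i, fun ω : Fin N → ℂ => c i (ω i)) x
      ∂(Measure.pi fun _ => μ) = 0 := by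
    simp only [Finset.sum_apply]
    rw [integral_finsetSum]
    · refine Finset.sum_eq_zero fun i _ => ?_
      rw [← h0 i]
      exact integral_comp_measurePreserving (measurePreserving_eval (fun _ : Fin N => μ) i) (hc i).1
    · intro i _
      exact ((hc i).comp_measurePreserving
        (measurePreserving_eval (fun _ : Fin N => μ) i)).integrable one_le_two
  rw [variance_of_integral_eq_zero _ hmean] at h
  · simp only [Finset.sum_apply] at h
    rw [h]
    refine Finset.sum_congr rfl fun i _ => ?_
    rw [variance_of_integral_eq_zero (hc i).1.aemeasurable (h0 i)]
  · refine Finset.aemeasurable_sum _ fun i _ => ?_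
    exact ((hc i).comp_measurePreserving
      (measurePreserving_eval (fun _ : Fin N => μ) i)).1.aemeasurable

/-- Real and imaginary parts may be correlated with each other, but the squared modulus needs only
the variance of each, so the real formula `integral_sum_sq_pi` is applied to both separately. -/
theorem integral_norm_sq_sum_pi {N : ℕ} (μ : Measure ℂ) [IsProbabilityMeasure μ]
    (hμ : MemLp id 2 μ) (h0 : ∫ x, x ∂μ = 0) (b : Fin N → ℂ) :
    ∫ x : Fin N → ℂ, ‖∑ i, b i * x i‖ ^ 2 ∂(Measure.pi fun _ => μ) =
      (∫ x, ‖x‖ ^ 2 ∂μ) * ∑ i, ‖b i‖ ^ 2 := by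
  have hb : ∀ i, MemLp (fun x : ℂ => b i * x) 2 μ := fun i => hμ.const_mul (b i)
  have hmean : ∀ i, ∫ x, b i * x ∂μ = 0 := fun i => by rw [integral_const_mul, h0, mul_zero]
  have hint : ∀ i, Integrable (fun x : ℂ => b i * x) μ := fun i => (hb i).integrable one_le_two
  have hre : ∀ i, MemLp (fun x : ℂ => (b i * x).re) 2 μ := fun i => (hb i).re
  have him : ∀ i, MemLp (fun x : ℂ => (b i * x).im) 2 μ := fun i => (hb i).im
  have e1 := integral_sum_sq_pi μ (fun i x => (b i * x).re) hre fun i => by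
    have := integral_re (hint i); rw [hmean i] at this; simpa using this
  have e2 := integral_sum_sq_pi μ (fun i x => (b i * x).im) him fun i => by
    have := integral_im (hint i); rw [hmean i] at this; simpa using this
  have hsq : ∀ z : ℂ, ‖z‖ ^ 2 = z.re ^ 2 + z.im ^ 2 := fun z => by
    rw [← Complex.normSq_eq_norm_sq, Complex.normSq_apply]; ring
  have hm : ∀ i : Fin N, MeasurePreserving (Function.eval i) (Measure.pi fun _ : Fin N => μ) μ :=
    fun i => measurePreserving_eval (fun _ : Fin N => μ) i
  have i1 : Integrable (fun x : Fin N → ℂ => (∑ i, (b i * x i).re) ^ 2)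
      (Measure.pi fun _ => μ) :=
    (memLp_finsetSum _ fun i _ => (hre i).comp_measurePreserving (hm i)).integrable_sq
  have i2 : Integrable (fun x : Fin N → ℂ => (∑ i, (b i * x i).im) ^ 2)
      (Measure.pi fun _ => μ) :=
    (memLp_finsetSum _ fun i _ => (him i).comp_measurePreserving (hm i)).integrable_sq
  simp_rw [hsq (∑ i, _), Complex.re_sum, Complex.im_sum]
  rw [integral_add i1 i2, e1, e2, ← Finset.sum_add_distrib, Finset.mul_sum]
  refine Finset.sum_congr rfl fun i _ => ?_
  rw [← integral_add (hre i).integrable_sq (him i).integrable_sq]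
  simp_rw [← hsq, norm_mul, mul_pow]
  rw [integral_const_mul, mul_comm]

/-- The squared Frobenius norm. -/
noncomputable def frobSq {m n : Type*} [Fintype m] [Fintype n] (A : Matrix m n ℂ) : ℝ :=
  ∑ i, ∑ j, ‖A i j‖ ^ 2

theorem memLp_mulVec {N : ℕ} {Ω : Type*} [MeasurableSpace Ω] {μ : Measure Ω}
    {X : Ω → Fin N → ℂ} (hX : ∀ i, MemLp (fun ω => X ω i) 2 μ)
    (A : Matrix (Fin N) (Fin N) ℂ) (i : Fin N) : MemLp (fun ω => (A *ᵥ X ω) i) 2 μ :=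
  memLp_finsetSum Finset.univ fun j _ => (hX j).const_mul (A i j)

theorem integral_norm_sq_mulVec_pi {N : ℕ} (μ : Measure ℂ) [IsProbabilityMeasure μ]
    (hμ : MemLp id 2 μ) (h0 : ∫ x, x ∂μ = 0) (A : Matrix (Fin N) (Fin N) ℂ) :
    ∫ x : Fin N → ℂ, ∑ i, ‖(A *ᵥ x) i‖ ^ 2 ∂(Measure.pi fun _ => μ) =
      (∫ x, ‖x‖ ^ 2 ∂μ) * frobSq A := by
  rw [integral_finsetSum, frobSq, Finset.mul_sum]
  · exact Finset.sum_congr rfl fun i _ => integral_norm_sq_sum_pi μ hμ h0 (A i)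
  · exact fun i _ => (memLp_mulVec (memLp_eval_pi μ hμ) A i).norm.integrable_sq

/-! ### Moments of the noise -/

instance : IsProbabilityMeasure complexGaussian := by
  unfold complexGaussian
  exact Measure.isProbabilityMeasure_map
    (Complex.measurableEquivRealProd.symm.measurable.aemeasurable)

theorem measurable_complex_mk : Measurable (fun p : ℝ × ℝ => (⟨p.1, p.2⟩ : ℂ)) :=
  Complex.measurableEquivRealProd.symm.measurable

theorem memLp_complexGaussian : MemLp id 2 complexGaussian := by
  unfold complexGaussian
  rw [memLp_map_measure_iff measurable_id.aestronglyMeasurable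
    measurable_complex_mk.aemeasurable]
  have h1 : MemLp (fun p : ℝ × ℝ => ((p.1 : ℝ) : ℂ)) 2
      ((gaussianReal 0 (1 / 2)).prod (gaussianReal 0 (1 / 2))) :=
    ((memLp_id_gaussianReal' 2 (by simp)).comp_measurePreserving measurePreserving_fst).ofReal
  have h2 : MemLp (fun p : ℝ × ℝ => ((p.2 : ℝ) : ℂ)) 2
      ((gaussianReal 0 (1 / 2)).prod (gaussianReal 0 (1 / 2))) :=
    ((memLp_id_gaussianReal' 2 (by simp)).comp_measurePreserving measurePreserving_snd).ofReal
  convert h1.add (h2.const_mul Complex.I) using 1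
  ext p
  apply Complex.ext <;> simp

theorem integral_complexGaussian : ∫ x, x ∂complexGaussian = 0 := by
  have hint : Integrable (fun x : ℂ => x) complexGaussian :=
    memLp_complexGaussian.integrable one_le_two
  have hre := integral_re hint
  have him := integral_im hint
  unfold complexGaussian at hre him ⊢
  rw [integral_map measurable_complex_mk.aemeasurable (by fun_prop)] at hre him
  simp only [RCLike.re_to_complex, RCLike.im_to_complex] at hre him
  rw [integral_fun_fst (fun x : ℝ => x)] at hre
  rw [integral_fun_snd (fun x : ℝ => x)] at him
  simp only [integral_id_gaussianReal, smul_zero] at hre him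
  exact Complex.ext hre.symm him.symm

theorem integral_norm_sq_complexGaussian : ∫ x, ‖x‖ ^ 2 ∂complexGaussian = 1 := by
  have hsq : ∀ z : ℂ, ‖z‖ ^ 2 = z.re ^ 2 + z.im ^ 2 := fun z => by
    rw [← Complex.normSq_eq_norm_sq, Complex.normSq_apply]; ring
  have hv : ∫ x, x ^ 2 ∂(gaussianReal 0 (1 / 2)) = 1 / 2 := by
    have := variance_fun_id_gaussianReal (μ := 0) (v := 1 / 2)
    rw [variance_of_integral_eq_zero (by fun_prop) integral_id_gaussianReal] at this
    simpa using this
  have h1 : Integrable (fun x : ℝ => x ^ 2) (gaussianReal 0 (1 / 2)) :=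
    (memLp_id_gaussianReal' 2 (by simp)).integrable_sq
  unfold complexGaussian
  rw [integral_map measurable_complex_mk.aemeasurable (by fun_prop)]
  simp_rw [hsq]
  rw [integral_add (h1.comp_fst _) (h1.comp_snd _), integral_fun_fst (fun x : ℝ => x ^ 2),
    integral_fun_snd (fun x : ℝ => x ^ 2), hv]
  simp
  norm_num

instance {N : ℕ} : IsProbabilityMeasure (gaussianNoise N) := by
  unfold gaussianNoise; infer_instance

/-! ### Random sign inputs -/

/-- The uniform law on `{a, -a}`. -/
noncomputable def signLaw (a : ℝ) : Measure ℂ :=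
  (2⁻¹ : ℝ≥0∞) • Measure.dirac (a : ℂ) + (2⁻¹ : ℝ≥0∞) • Measure.dirac (-a : ℂ)

instance (a : ℝ) : IsProbabilityMeasure (signLaw a) :=
  ⟨by simp [signLaw, ENNReal.inv_two_add_inv_two]⟩

theorem integrable_signLaw {E : Type*} [NormedAddCommGroup E] (a : ℝ) (f : ℂ → E) :
    Integrable f (signLaw a) := by
  unfold signLaw
  exact ((integrable_dirac (by simp)).smul_measure (by simp)).add_measure
    ((integrable_dirac (by simp)).smul_measure (by simp))

theorem integral_signLaw {E : Type*} [NormedAddCommGroup E] [NormedSpace ℝ E] [CompleteSpace E]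
    (a : ℝ) (f : ℂ → E) :
    ∫ x, f x ∂signLaw a = (2⁻¹ : ℝ) • f a + (2⁻¹ : ℝ) • f (-a) := by
  unfold signLaw
  rw [integral_add_measure ((integrable_dirac (by simp)).smul_measure (by simp))
    ((integrable_dirac (by simp)).smul_measure (by simp)), integral_smul_measure,
    integral_smul_measure, integral_dirac, integral_dirac]
  simp

theorem memLp_signLaw (a : ℝ) : MemLp id 2 (signLaw a) :=
  (memLp_two_iff_integrable_sq_norm (by fun_prop)).2 (integrable_signLaw a _)

/-- The law of a vector of independent random signs times `a`. -/
noncomputable def signInput (N : ℕ) (a : ℝ) : Measure (Fin N → ℂ) :=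
  Measure.pi fun _ => signLaw a

instance {N : ℕ} (a : ℝ) : IsProbabilityMeasure (signInput N a) := by
  unfold signInput; infer_instance

/-- The coordinates factor, and averaging one sign gives cosh u with u = 2√p Re c_k. Since cosh u ≤
exp(u²/2) and u²/2 ≤ 2p‖c_k‖², the subtracted quadratic term compensates exactly. This makes the
test function admissible for each fixed output y. -/
theorem lintegral_exp_signInput_le {N : ℕ} {p : ℝ} (hp : 0 ≤ p) (c : Fin N → ℂ) :
    ∫⁻ x, ENNReal.ofReal (Real.exp (∑ k, (2 * (star (c k) * x k).re - 2 * p * ‖c k‖ ^ 2)))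
      ∂(signInput N (Real.sqrt p)) ≤ 1 := by
  set F : Fin N → ℂ → ℝ := fun k z => Real.exp (2 * (star (c k) * z).re - 2 * p * ‖c k‖ ^ 2)
    with hF
  have hint : Integrable (fun x : Fin N → ℂ => ∏ k, F k (x k))
      (Measure.pi fun _ => signLaw (Real.sqrt p)) :=
    Integrable.fintype_prod (f := F) (μ := fun _ => signLaw (Real.sqrt p))
      fun k => integrable_signLaw _ _
  simp_rw [Real.exp_sum]
  unfold signInput
  rw [← ofReal_integral_eq_lintegral_ofReal hint
    (ae_of_all _ fun x => Finset.prod_nonneg fun k _ => (Real.exp_pos _).le)]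
  rw [integral_fintype_prod_eq_prod, ← ENNReal.ofReal_one]
  refine ENNReal.ofReal_le_ofReal (Finset.prod_le_one
    (fun k _ => integral_nonneg fun _ => (Real.exp_pos _).le) fun k _ => ?_)
  simp only [hF]
  rw [integral_signLaw]
  set u : ℝ := 2 * Real.sqrt p * (c k).re with hu
  have e1 : 2 * (star (c k) * (Real.sqrt p : ℂ)).re = u := by simp [hu]; ring
  have e2 : 2 * (star (c k) * (-(Real.sqrt p) : ℂ)).re = -u := by simp [hu]; ring
  rw [e1, e2, Real.exp_sub, Real.exp_sub]
  have hc : 2⁻¹ * Real.exp u + 2⁻¹ * Real.exp (-u) ≤ Real.exp (2 * p * ‖c k‖ ^ 2) := by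
    have h := Real.cosh_le_exp_half_sq u
    rw [Real.cosh_eq] at h
    have h2 : u ^ 2 / 2 ≤ 2 * p * ‖c k‖ ^ 2 := by
      have : (c k).re ^ 2 ≤ ‖c k‖ ^ 2 := by
        rw [← Complex.normSq_eq_norm_sq, Complex.normSq_apply]; nlinarith [sq_nonneg (c k).im]
      have hs : u ^ 2 = 4 * p * (c k).re ^ 2 := by
        rw [hu, mul_pow, mul_pow, Real.sq_sqrt hp]; ring
      rw [hs]; nlinarith
    calc _ = (Real.exp u + Real.exp (-u)) / 2 := by ring
      _ ≤ _ := h.trans (Real.exp_le_exp.2 h2)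
  have hpos := Real.exp_pos (2 * p * ‖c k‖ ^ 2)
  rw [smul_eq_mul, smul_eq_mul, ← mul_div_assoc, ← mul_div_assoc, ← add_div,
    div_le_one hpos]
  exact hc

theorem integral_signLaw_id (a : ℝ) : ∫ x, x ∂signLaw a = 0 := by
  rw [integral_signLaw]; simp

theorem integral_norm_sq_signLaw (a : ℝ) : ∫ x, ‖x‖ ^ 2 ∂signLaw a = a ^ 2 := by
  rw [integral_signLaw]
  simp only [norm_neg, Complex.norm_real, Real.norm_eq_abs, sq_abs, smul_eq_mul]
  ring

theorem frobSq_conjTranspose {m n : Type*} [Fintype m] [Fintype n] (A : Matrix m n ℂ) :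
    frobSq Aᴴ = frobSq A := by
  unfold frobSq
  rw [Finset.sum_comm]
  simp [conjTranspose_apply]

/-! ### Second moments of the interference -/

/-- The mean of a random vector. -/
noncomputable def meanVec {N : ℕ} (μ : Measure (Fin N → ℂ)) : Fin N → ℂ := fun i => ∫ w, w i ∂μ

/-- This is why an arbitrary interference law enters the final bound only through its covariance. -/
theorem integral_norm_sq_mulVec_sub_mean {N : ℕ} (μ : Measure (Fin N → ℂ))
    [IsProbabilityMeasure μ] (hμ : ∀ i, MemLp (fun w : Fin N → ℂ => w i) 2 μ)
    (B : Matrix (Fin N) (Fin N) ℂ) :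
    ∫ w, ∑ i, ‖(B *ᵥ (w - meanVec μ)) i‖ ^ 2 ∂μ = (B * covMatrix μ * Bᴴ).trace.re := by
  have hv : ∀ i, MemLp (fun w : Fin N → ℂ => w i - meanVec μ i) 2 μ :=
    fun i => (hμ i).sub (memLp_const _)
  have hint : ∀ k l, Integrable (fun w : Fin N → ℂ =>
      (w k - meanVec μ k) * star (w l - meanVec μ l)) μ :=
    fun k l => (hv k).integrable_mul (hv l).star
  have hpt : ∀ w : Fin N → ℂ, ∑ i, ‖(B *ᵥ (w - meanVec μ)) i‖ ^ 2 =
      (∑ i, ∑ k, ∑ l, (B i k * star (B i l)) *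
        ((w k - meanVec μ k) * star (w l - meanVec μ l))).re := by
    intro w
    rw [Complex.re_sum]
    refine Finset.sum_congr rfl fun i _ => ?_
    have : ((‖(B *ᵥ (w - meanVec μ)) i‖ ^ 2 : ℝ) : ℂ) =
        (B *ᵥ (w - meanVec μ)) i * star ((B *ᵥ (w - meanVec μ)) i) := by
      rw [Complex.ofReal_pow]; exact (Complex.mul_conj' _).symm
    rw [← Complex.ofReal_re (‖(B *ᵥ (w - meanVec μ)) i‖ ^ 2), this]
    simp only [mulVec, dotProduct, star_sum, Finset.sum_mul_sum, Pi.sub_apply, star_mul']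
    congr 1
    refine Finset.sum_congr rfl fun k _ => Finset.sum_congr rfl fun l _ => ?_
    ring
  simp_rw [hpt]
  have hI : Integrable (fun w : Fin N → ℂ => ∑ i, ∑ k, ∑ l, (B i k * star (B i l)) *
        ((w k - meanVec μ k) * star (w l - meanVec μ l))) μ :=
    integrable_finsetSum _ fun i _ => integrable_finsetSum _ fun k _ =>
      integrable_finsetSum _ fun l _ => (hint k l).const_mul _
  have := integral_re hI
  simp only [RCLike.re_to_complex] at this
  rw [this]
  congr 1
  rw [integral_finsetSum _ fun i _ => integrable_finsetSum _ fun k _ =>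
      integrable_finsetSum _ fun l _ => (hint k l).const_mul _]
  simp only [trace, diag_apply, mul_apply, conjTranspose_apply, Finset.sum_mul]
  refine Finset.sum_congr rfl fun i _ => ?_
  rw [integral_finsetSum _ fun k _ =>
      integrable_finsetSum _ fun l _ => (hint k l).const_mul _]
  refine Eq.trans (Finset.sum_congr rfl fun k _ => ?_) Finset.sum_comm
  rw [integral_finsetSum _ fun l _ => (hint k l).const_mul _]
  refine Finset.sum_congr rfl fun l _ => ?_
  rw [integral_const_mul]
  change B i k * star (B i l) * covMatrix μ k l = _
  ring

/-! ### Divergence bound for sign inputs -/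

/-- Donsker–Varadhan with a matched-filter test function. Its linear part has joint mean 2tP‖H‖²,
since interference and noise are independent of the centred input. Its quadratic part splits into a
signal, an interference and a noise term. -/
theorem ofReal_le_klDiv_channelLaw {N : ℕ} (H : Matrix (Fin N) (Fin N) ℂ)
    (μW : Measure (Fin N → ℂ)) [IsProbabilityMeasure μW]
    (hW : ∀ i, MemLp (fun w : Fin N → ℂ => w i) 2 μW) {P : ℝ} (hP : 0 ≤ P) (t : ℝ) :
    ENNReal.ofReal (2 * t * (P * frobSq H) - 2 * P * t ^ 2 * (2 * (P * frobSq (Hᴴ * H)) +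
        4 * (Hᴴ * covMatrix μW * H).trace.re + 4 * frobSq H)) ≤
      InformationTheory.klDiv (channelLaw H μW (signInput N (Real.sqrt P)))
        ((channelLaw H μW (signInput N (Real.sqrt P))).fst.prod
          (channelLaw H μW (signInput N (Real.sqrt P))).snd) := by
  set μX := signInput N (Real.sqrt P) with hμX
  set m := meanVec μW with hm
  set Q := μX.prod (μW.prod (gaussianNoise N)) with hQdef
  have hpf : IsFiniteMeasure (μW.prod (gaussianNoise N)) := inferInstance
  have hps : SFinite (μW.prod (gaussianNoise N)) :=
    @instSFiniteOfSigmaFinite _ _ _ (IsFiniteMeasure.toSigmaFinite _)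
  have hTm : Measurable (fun t : (Fin N → ℂ) × ((Fin N → ℂ) × (Fin N → ℂ)) =>
      (t.1, H.mulVec t.1 + t.2.1 + t.2.2)) := by
    have : Measurable fun t : (Fin N → ℂ) × ((Fin N → ℂ) × (Fin N → ℂ)) => H.mulVec t.1 :=
      (Continuous.matrix_mulVec continuous_const continuous_id).measurable.comp measurable_fst
    fun_prop
  have : IsProbabilityMeasure (channelLaw H μW μX) :=
    Measure.isProbabilityMeasure_map hTm.aemeasurable
  have hfst : (channelLaw H μW μX).fst = μX := by
    unfold channelLaw
    rw [Measure.fst, Measure.map_map measurable_fst hTm]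
    exact (measurePreserving_fst (μ := μX) (ν := μW.prod (gaussianNoise N))).map_eq
  -- Matched filter, scaled by the free parameter t. Subtracting the interference mean leaves only
  -- the covariance in the quadratic term.
  set c : (Fin N → ℂ) → Fin N → ℂ := fun y => ((t : ℂ) • Hᴴ) *ᵥ (y - m) with hc
  have hcm : Measurable c :=
    (Continuous.matrix_mulVec continuous_const (by fun_prop)).measurable
  set f : (Fin N → ℂ) × (Fin N → ℂ) → ℝ := fun q =>
    ∑ k, (2 * (star (c q.2 k) * q.1 k).re - 2 * P * ‖c q.2 k‖ ^ 2) with hf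
  have hfm : Measurable f := by
    refine Finset.measurable_sum _ fun k _ => ?_
    have : Measurable fun q : (Fin N → ℂ) × (Fin N → ℂ) => c q.2 k :=
      (measurable_pi_apply k).comp (hcm.comp measurable_snd)
    have h2 : Measurable fun q : (Fin N → ℂ) × (Fin N → ℂ) => (star (c q.2 k) * q.1 k).re :=
      Complex.measurable_re.comp ((Complex.continuous_conj.measurable.comp this).mul (by fun_prop))
    fun_prop
  -- The exponential bound holds for each y separately, so nothing about the law of the output is
  -- needed.
  have hQ : ∫⁻ q, ENNReal.ofReal (Real.exp (f q))
      ∂((channelLaw H μW μX).fst.prod (channelLaw H μW μX).snd) ≤ 1 := by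
    rw [hfst, lintegral_prod_symm' _ (by fun_prop)]
    calc _ ≤ ∫⁻ _, 1 ∂(channelLaw H μW μX).snd :=
          lintegral_mono fun y => lintegral_exp_signInput_le hP (c y)
      _ = 1 := by simp
  -- integrability of the coordinates
  have hX : ∀ i, MemLp (fun q : (Fin N → ℂ) × ((Fin N → ℂ) × (Fin N → ℂ)) => q.1 i) 2 Q :=
    fun i => (memLp_eval_pi _ (memLp_signLaw _) i).comp_fst _
  have hWm : ∀ i, MemLp (fun w : Fin N → ℂ => (w - m) i) 2 μW :=
    fun i => (hW i).sub (memLp_const _)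
  have hW' : ∀ i, MemLp (fun q : (Fin N → ℂ) × ((Fin N → ℂ) × (Fin N → ℂ)) => (q.2.1 - m) i) 2 Q :=
    fun i => ((hWm i).comp_fst _).comp_snd _
  have hZ1 : ∀ i, MemLp (fun w : Fin N → ℂ => w i) 2 (gaussianNoise N) :=
    fun i => memLp_eval_pi _ memLp_complexGaussian i
  have hZ' : ∀ i, MemLp (fun q : (Fin N → ℂ) × ((Fin N → ℂ) × (Fin N → ℂ)) => q.2.2 i) 2 Q :=
    fun i => ((hZ1 i).comp_snd _).comp_snd _
  have hHX : ∀ i, MemLp (fun q : (Fin N → ℂ) × ((Fin N → ℂ) × (Fin N → ℂ)) => (H *ᵥ q.1) i) 2 Q :=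
    memLp_mulVec hX H
  have hY : ∀ i, MemLp (fun q : (Fin N → ℂ) × ((Fin N → ℂ) × (Fin N → ℂ)) =>
      (H *ᵥ q.1 + q.2.1 + q.2.2 - m) i) 2 Q := fun i =>
    (((hHX i).add (hW' i)).add (hZ' i)).ae_eq (ae_of_all _ fun q => by
      simp only [Pi.add_apply, Pi.sub_apply]; ring)
  have hC : ∀ i, MemLp (fun q : (Fin N → ℂ) × ((Fin N → ℂ) × (Fin N → ℂ)) =>
      c (H *ᵥ q.1 + q.2.1 + q.2.2) i) 2 Q := memLp_mulVec hY _
  have hfT : Integrable (fun q => f (q.1, H *ᵥ q.1 + q.2.1 + q.2.2)) Q := by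
    refine integrable_finsetSum _ fun k _ => ?_
    exact (((hC k).star.integrable_mul (hX k)).re.const_mul 2).sub
      ((hC k).norm.integrable_sq.const_mul (2 * P))
  have hfπ : Integrable f (channelLaw H μW μX) := by
    unfold channelLaw
    rw [integrable_map_measure hfm.aestronglyMeasurable hTm.aemeasurable]
    exact hfT
  refine le_trans (ENNReal.ofReal_le_ofReal ?_)
    (ofReal_integral_le_klDiv _ _ hfm hfπ hQ)
  unfold channelLaw
  rw [integral_map hTm.aemeasurable hfm.aestronglyMeasurable]
  -- the three quadratic terms and the cross term
  set v : (Fin N → ℂ) × ((Fin N → ℂ) × (Fin N → ℂ)) → Fin N → ℂ :=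
    fun q => (q.2.1 - m) + q.2.2 with hv
  have hV : ∀ i, MemLp (fun q => v q i) 2 Q := fun i => (hW' i).add (hZ' i)
  have i1 : Integrable (fun q => ∑ i, ‖(H *ᵥ q.1) i‖ ^ 2) Q :=
    integrable_finsetSum _ fun i _ => (hHX i).norm.integrable_sq
  have i2 : Integrable (fun q => (∑ i, star (v q i) * (H *ᵥ q.1) i).re) Q :=
    (integrable_finsetSum _ fun i _ => (hV i).star.integrable_mul (hHX i)).re
  have i3 : Integrable (fun q => ∑ i, ‖((Hᴴ * H) *ᵥ q.1) i‖ ^ 2) Q :=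
    integrable_finsetSum _ fun i _ => (memLp_mulVec hX _ i).norm.integrable_sq
  have i4 : Integrable (fun q => ∑ i, ‖(Hᴴ *ᵥ (q.2.1 - m)) i‖ ^ 2) Q :=
    integrable_finsetSum _ fun i _ => (memLp_mulVec hW' _ i).norm.integrable_sq
  have i5 : Integrable (fun q => ∑ i, ‖(Hᴴ *ᵥ q.2.2) i‖ ^ 2) Q :=
    integrable_finsetSum _ fun i _ => (memLp_mulVec hZ' _ i).norm.integrable_sq
  have e1 : ∫ q, ∑ i, ‖(H *ᵥ q.1) i‖ ^ 2 ∂Q = P * frobSq H := by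
    rw [hQdef, integral_fun_fst (fun x : Fin N → ℂ => ∑ i, ‖(H *ᵥ x) i‖ ^ 2), hμX]
    unfold signInput
    rw [integral_norm_sq_mulVec_pi _ (memLp_signLaw _) (integral_signLaw_id _),
      integral_norm_sq_signLaw, Real.sq_sqrt hP]
    simp
  have e3 : ∫ q, ∑ i, ‖((Hᴴ * H) *ᵥ q.1) i‖ ^ 2 ∂Q = P * frobSq (Hᴴ * H) := by
    rw [hQdef, integral_fun_fst (fun x : Fin N → ℂ => ∑ i, ‖((Hᴴ * H) *ᵥ x) i‖ ^ 2), hμX]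
    unfold signInput
    rw [integral_norm_sq_mulVec_pi _ (memLp_signLaw _) (integral_signLaw_id _),
      integral_norm_sq_signLaw, Real.sq_sqrt hP]
    simp
  have e4 : ∫ q, ∑ i, ‖(Hᴴ *ᵥ (q.2.1 - m)) i‖ ^ 2 ∂Q = (Hᴴ * covMatrix μW * H).trace.re := by
    rw [hQdef, integral_fun_snd (fun x : (Fin N → ℂ) × (Fin N → ℂ) =>
      ∑ i, ‖(Hᴴ *ᵥ (x.1 - m)) i‖ ^ 2), integral_fun_fst (fun x : Fin N → ℂ =>
      ∑ i, ‖(Hᴴ *ᵥ (x - m)) i‖ ^ 2), integral_norm_sq_mulVec_sub_mean _ hW,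
      conjTranspose_conjTranspose]
    simp
  have e5 : ∫ q, ∑ i, ‖(Hᴴ *ᵥ q.2.2) i‖ ^ 2 ∂Q = frobSq H := by
    rw [hQdef, integral_fun_snd (fun x : (Fin N → ℂ) × (Fin N → ℂ) =>
      ∑ i, ‖(Hᴴ *ᵥ x.2) i‖ ^ 2), integral_fun_snd (fun x : Fin N → ℂ =>
      ∑ i, ‖(Hᴴ *ᵥ x) i‖ ^ 2)]
    unfold gaussianNoise
    rw [integral_norm_sq_mulVec_pi _ memLp_complexGaussian integral_complexGaussian,
      integral_norm_sq_complexGaussian, frobSq_conjTranspose]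
    simp
  -- Independence factors each term, and the factor coming from the sign input has mean zero.
  have e2 : ∫ q, (∑ i, star (v q i) * (H *ᵥ q.1) i).re ∂Q = 0 := by
    have h := integral_re (integrable_finsetSum Finset.univ
      fun i _ => (hV i).star.integrable_mul (hHX i))
    simp only [RCLike.re_to_complex] at h
    refine h.trans ?_
    rw [integral_finsetSum _ fun i _ => (hV i).star.integrable_mul (hHX i)]
    rw [Finset.sum_eq_zero, Complex.zero_re]
    intro i _
    have hx0 : ∫ x, (H *ᵥ x) i ∂μX = 0 := by
      change ∫ x : Fin N → ℂ, ∑ k, H i k * x k ∂μX = 0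
      have hi : ∀ k, Integrable (fun x : Fin N → ℂ => H i k * x k) μX := fun k =>
        ((memLp_eval_pi _ (memLp_signLaw _) k).integrable one_le_two).const_mul (H i k)
      refine (integral_finsetSum _ fun k _ => hi k).trans ?_
      refine Finset.sum_eq_zero fun k _ => ?_
      rw [integral_const_mul, hμX]
      unfold signInput
      rw [integral_eval_pi _ (memLp_signLaw _), integral_signLaw_id, mul_zero]
    have := integral_prod_mul (μ := μX) (ν := μW.prod (gaussianNoise N))
      (fun x => (H *ᵥ x) i) (fun u => star ((u.1 - m + u.2) i))
    rw [hx0, zero_mul] at this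
    rw [← this, hQdef]
    exact integral_congr_ae (ae_of_all _ fun q => mul_comm _ _)
  have hg : ∫ q, (2 * t * (∑ i, ‖(H *ᵥ q.1) i‖ ^ 2)
      + 2 * t * (∑ i, star (v q i) * (H *ᵥ q.1) i).re
      - 2 * P * t ^ 2 * (2 * (∑ i, ‖((Hᴴ * H) *ᵥ q.1) i‖ ^ 2)
        + 4 * (∑ i, ‖(Hᴴ *ᵥ (q.2.1 - m)) i‖ ^ 2) + 4 * ∑ i, ‖(Hᴴ *ᵥ q.2.2) i‖ ^ 2)) ∂Q =
      2 * t * (P * frobSq H) - 2 * P * t ^ 2 * (2 * (P * frobSq (Hᴴ * H)) +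
        4 * (Hᴴ * covMatrix μW * H).trace.re + 4 * frobSq H) := by
    have j1 := (i1.const_mul (2 * t)).add (i2.const_mul (2 * t))
    have j2 := (i3.const_mul 2).add (i4.const_mul 4)
    have j3 := (j2.add (i5.const_mul 4)).const_mul (2 * P * t ^ 2)
    refine (integral_sub j1 j3).trans ?_
    have k1 := integral_add (i1.const_mul (2 * t)) (i2.const_mul (2 * t))
    have k2 := integral_add (i3.const_mul 2) (i4.const_mul 4)
    have k3 := integral_add j2 (i5.const_mul 4)
    rw [integral_const_mul, integral_const_mul, e1, e2] at k1
    rw [integral_const_mul, integral_const_mul, e3, e4] at k2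
    rw [integral_const_mul, e5] at k3
    rw [integral_const_mul]
    refine (congrArg₂ (fun a b => a - 2 * P * t ^ 2 * b) k1
      (k3.trans (congrArg (· + 4 * frobSq H) k2))).trans ?_
    ring
  rw [← hg]
  refine integral_mono (((i1.const_mul _).add (i2.const_mul _)).sub
      ((((i3.const_mul _).add (i4.const_mul _)).add (i5.const_mul _)).const_mul _)) hfT
      fun q => ?_
  have hy : H *ᵥ q.1 + q.2.1 + q.2.2 - m = H *ᵥ q.1 + v q := by simp only [hv]; abel
  have hlin : ∑ k, star (c (H *ᵥ q.1 + q.2.1 + q.2.2) k) * q.1 k =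
      (t : ℂ) * (∑ i, star ((H *ᵥ q.1) i) * (H *ᵥ q.1) i + ∑ i, star (v q i) * (H *ᵥ q.1) i) := by
    have h1 : ∑ k, star (c (H *ᵥ q.1 + q.2.1 + q.2.2) k) * q.1 k =
        star (((t : ℂ) • Hᴴ) *ᵥ (H *ᵥ q.1 + v q)) ⬝ᵥ q.1 := by
      simp only [hc, hy]; rfl
    rw [h1, star_mulVec, conjTranspose_smul, conjTranspose_conjTranspose, ← dotProduct_mulVec,
      smul_mulVec, dotProduct_smul, star_add, add_dotProduct]
    simp [dotProduct]
  have hre : (∑ i, star ((H *ᵥ q.1) i) * (H *ᵥ q.1) i).re = ∑ i, ‖(H *ᵥ q.1) i‖ ^ 2 := by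
    rw [Complex.re_sum]
    refine Finset.sum_congr rfl fun i _ => ?_
    rw [mul_comm, ← Complex.ofReal_re (‖(H *ᵥ q.1) i‖ ^ 2), Complex.ofReal_pow]
    exact congrArg _ (Complex.mul_conj' _)
  have hfq : f (q.1, H *ᵥ q.1 + q.2.1 + q.2.2) =
      2 * t * (∑ i, ‖(H *ᵥ q.1) i‖ ^ 2) + 2 * t * (∑ i, star (v q i) * (H *ᵥ q.1) i).re
      - 2 * P * ∑ k, ‖c (H *ᵥ q.1 + q.2.1 + q.2.2) k‖ ^ 2 := by
    simp only [hf, Finset.sum_sub_distrib, ← Finset.mul_sum]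
    rw [← Complex.re_sum, hlin, Complex.re_ofReal_mul, Complex.add_re, hre]
    ring
  -- The weights 2, 4, 4 come from ‖a + b‖² ≤ 2‖a‖² + 2‖b‖², used first to separate the signal and
  -- then to separate interference from noise.
  have hquad : ∑ k, ‖c (H *ᵥ q.1 + q.2.1 + q.2.2) k‖ ^ 2 ≤
      t ^ 2 * (2 * (∑ i, ‖((Hᴴ * H) *ᵥ q.1) i‖ ^ 2)
        + 4 * (∑ i, ‖(Hᴴ *ᵥ (q.2.1 - m)) i‖ ^ 2) + 4 * ∑ i, ‖(Hᴴ *ᵥ q.2.2) i‖ ^ 2) := by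
    simp only [Finset.mul_sum, ← Finset.sum_add_distrib]
    refine Finset.sum_le_sum fun k _ => ?_
    have hck : c (H *ᵥ q.1 + q.2.1 + q.2.2) k = (t : ℂ) * (((Hᴴ * H) *ᵥ q.1) k +
        ((Hᴴ *ᵥ (q.2.1 - m)) k + (Hᴴ *ᵥ q.2.2) k)) := by
      simp only [hc, hy, hv, smul_mulVec, mulVec_add, mulVec_mulVec, Pi.smul_apply, Pi.add_apply,
        smul_eq_mul]
    rw [hck, norm_mul, mul_pow, Complex.norm_real, Real.norm_eq_abs, sq_abs]
    have n1 : ∀ a b : ℂ, ‖a + b‖ ^ 2 ≤ 2 * ‖a‖ ^ 2 + 2 * ‖b‖ ^ 2 := fun a b => by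
      have := norm_add_le a b
      nlinarith [norm_nonneg (a + b), sq_nonneg (‖a‖ - ‖b‖)]
    have h1 := n1 (((Hᴴ * H) *ᵥ q.1) k) ((Hᴴ *ᵥ (q.2.1 - m)) k + (Hᴴ *ᵥ q.2.2) k)
    have h2 := n1 ((Hᴴ *ᵥ (q.2.1 - m)) k) ((Hᴴ *ᵥ q.2.2) k)
    calc _ ≤ t ^ 2 * (2 * ‖((Hᴴ * H) *ᵥ q.1) k‖ ^ 2 + 4 * ‖(Hᴴ *ᵥ (q.2.1 - m)) k‖ ^ 2
          + 4 * ‖(Hᴴ *ᵥ q.2.2) k‖ ^ 2) :=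
          mul_le_mul_of_nonneg_left (by linarith) (sq_nonneg t)
      _ = _ := by ring
  rw [hfq]
  have := mul_le_mul_of_nonneg_left hquad (mul_nonneg zero_le_two hP)
  linarith

/-- The mutual information of random signs through the channel bounds the capacity below. -/
theorem ofReal_le_capacity {N : ℕ} (H : Matrix (Fin N) (Fin N) ℂ)
    (μW : Measure (Fin N → ℂ)) [IsProbabilityMeasure μW]
    (hW : ∀ i, MemLp (fun w : Fin N → ℂ => w i) 2 μW) {P : ℝ} (hP : 0 ≤ P) (t : ℝ) :
    ENNReal.ofReal ((2 * t * (P * frobSq H) - 2 * P * t ^ 2 * (2 * (P * frobSq (Hᴴ * H)) +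
        4 * (Hᴴ * covMatrix μW * H).trace.re + 4 * frobSq H)) / Real.log 2) ≤ capacity H μW P := by
  have hpow : ∀ i, ∫⁻ x, ‖x i‖ₑ ^ 2 ∂(signInput N (Real.sqrt P)) ≤ ENNReal.ofReal P := by
    intro i
    unfold signInput
    have h := (measurePreserving_eval (fun _ : Fin N => signLaw (Real.sqrt P)) i).lintegral_comp
      (f := fun z : ℂ => ‖z‖ₑ ^ 2) (by fun_prop)
    simp only [Function.eval] at h
    rw [h]
    unfold signLaw
    rw [lintegral_add_measure, lintegral_smul_measure, lintegral_smul_measure, lintegral_dirac,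
      lintegral_dirac, enorm_neg, ← add_smul, ENNReal.inv_two_add_inv_two, one_smul]
    rw [← ofReal_norm, Complex.norm_real, ← ENNReal.ofReal_pow (norm_nonneg _),
      Real.norm_eq_abs, sq_abs, Real.sq_sqrt hP]
  unfold capacity
  refine le_trans ?_ (le_iSup_of_le (signInput N (Real.sqrt P))
    (le_iSup_of_le inferInstance (le_iSup_of_le hpow le_rfl)))
  unfold mutualInfo
  rw [ENNReal.ofReal_div_of_pos (Real.log_pos one_lt_two)]
  exact ENNReal.div_le_div_right (ofReal_le_klDiv_channelLaw H μW hW hP t) _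

/-! ### Sums over pairs of distinct indices -/

section OffDiagonal

/-- The sum of `f (x i) (x j)` over all pairs of distinct indices. -/
noncomputable def offDiagSum {α : Type*} {N : ℕ} (f : α → α → ℝ) (x : Fin N → α) : ℝ :=
  ∑ i, ∑ j, if i = j then 0 else f (x i) (x j)

theorem abs_offDiagSum_le {α : Type*} {N : ℕ} {f : α → α → ℝ} {C : ℝ} (hC : ∀ x y, |f x y| ≤ C)
    (x : Fin N → α) : |offDiagSum f x| ≤ N ^ 2 * C := by
  refine (Finset.abs_sum_le_sum_abs _ _).trans ?_
  have hC0 : ∀ i, 0 ≤ C := fun i : Fin N => (abs_nonneg _).trans (hC (x i) (x i))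
  calc _ ≤ ∑ _i : Fin N, ∑ _j : Fin N, C := by
        refine Finset.sum_le_sum fun i _ => (Finset.abs_sum_le_sum_abs _ _).trans ?_
        refine Finset.sum_le_sum fun j _ => ?_
        split_ifs
        · simpa using hC0 i
        · exact hC _ _
    _ = _ := by simp; ring

variable {α : Type*} [MeasurableSpace α]

theorem integrable_of_abs_le {μ : Measure α} [IsFiniteMeasure μ] {f : α → ℝ} (hf : Measurable f)
    {C : ℝ} (hC : ∀ x, |f x| ≤ C) : Integrable f μ :=
  Integrable.of_bound hf.aestronglyMeasurable C (ae_of_all _ hC)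

theorem measurable_apply₂ {β : Type*} [MeasurableSpace β] {f : α → α → ℝ}
    (hf : Measurable (Function.uncurry f)) {u v : β → α} (hu : Measurable u) (hv : Measurable v) :
    Measurable fun x => f (u x) (v x) :=
  hf.comp (hu.prodMk hv)

theorem measurable_offDiagSum {N : ℕ} {f : α → α → ℝ} (hf : Measurable (Function.uncurry f)) :
    Measurable (offDiagSum (N := N) f) := by
  refine Finset.measurable_sum _ fun i _ => Finset.measurable_sum _ fun j _ => ?_
  split_ifs
  · exact measurable_const
  · exact measurable_apply₂ hf (measurable_pi_apply i) (measurable_pi_apply j)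

variable {μ : Measure α} [IsProbabilityMeasure μ] {N : ℕ}

theorem iIndepFun_eval_pi (μ : Measure α) [IsProbabilityMeasure μ] (N : ℕ) :
    iIndepFun (fun (i : Fin N) (x : Fin N → α) => x i) (Measure.pi fun _ => μ) :=
  iIndepFun_pi (μ := fun _ : Fin N => μ) (X := fun _ => id) fun _ => aemeasurable_id

theorem measurePreserving_eval_pair {i j : Fin N} (hij : i ≠ j) :
    MeasurePreserving (fun x : Fin N → α => (x i, x j)) (Measure.pi fun _ => μ) (μ.prod μ) := by
  refine ⟨by fun_prop, ?_⟩
  rw [(indepFun_iff_map_prod_eq_prod_map_map (measurable_pi_apply i).aemeasurable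
    (measurable_pi_apply j).aemeasurable).1 ((iIndepFun_eval_pi μ N).indepFun hij)]
  exact congrArg₂ _ (measurePreserving_eval (fun _ : Fin N => μ) i).map_eq
    (measurePreserving_eval (fun _ : Fin N => μ) j).map_eq

theorem measurePreserving_eval_triple {i j k : Fin N} (hij : i ≠ j) (hik : i ≠ k) (hjk : j ≠ k) :
    MeasurePreserving (fun x : Fin N → α => ((x i, x j), x k)) (Measure.pi fun _ => μ)
      ((μ.prod μ).prod μ) := by
  refine ⟨by fun_prop, ?_⟩
  rw [(indepFun_iff_map_prod_eq_prod_map_map (by fun_prop) (measurable_pi_apply k).aemeasurable).1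
    ((iIndepFun_eval_pi μ N).indepFun_prodMk (fun _ => by fun_prop) i j k hik hjk)]
  exact congrArg₂ _ (measurePreserving_eval_pair hij).map_eq
    (measurePreserving_eval (fun _ : Fin N => μ) k).map_eq

theorem measurePreserving_eval_quadruple {i j k l : Fin N} (hij : i ≠ j) (hkl : k ≠ l)
    (hik : i ≠ k) (hil : i ≠ l) (hjk : j ≠ k) (hjl : j ≠ l) :
    MeasurePreserving (fun x : Fin N → α => ((x i, x j), (x k, x l))) (Measure.pi fun _ => μ)
      ((μ.prod μ).prod (μ.prod μ)) := by
  refine ⟨by fun_prop, ?_⟩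
  rw [(indepFun_iff_map_prod_eq_prod_map_map (by fun_prop) (by fun_prop)).1
    ((iIndepFun_eval_pi μ N).indepFun_prodMk_prodMk (fun _ => by fun_prop) i j k l hik hil hjk hjl)]
  exact congrArg₂ _ (measurePreserving_eval_pair hij).map_eq
    (measurePreserving_eval_pair hkl).map_eq

variable {f : α → α → ℝ} {C : ℝ}

theorem integral_pair (hf : Measurable (Function.uncurry f)) (hC : ∀ x y, |f x y| ≤ C)
    {i j : Fin N} (hij : i ≠ j) :
    ∫ x : Fin N → α, f (x i) (x j) ∂(Measure.pi fun _ => μ) = ∫ x, ∫ y, f x y ∂μ ∂μ := by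
  refine (integral_comp_measurePreserving (measurePreserving_eval_pair hij)
    (f := Function.uncurry f) hf.aestronglyMeasurable).trans ?_
  exact integral_prod _ (integrable_of_abs_le hf fun p => hC p.1 p.2)

theorem integrable_pair (hf : Measurable (Function.uncurry f)) (hC : ∀ x y, |f x y| ≤ C)
    (i j : Fin N) : Integrable (fun x : Fin N → α => f (x i) (x j)) (Measure.pi fun _ => μ) :=
  integrable_of_abs_le (measurable_apply₂ hf (measurable_pi_apply i) (measurable_pi_apply j))
    fun x => hC (x i) (x j)

theorem integral_offDiagSum (hf : Measurable (Function.uncurry f)) (hC : ∀ x y, |f x y| ≤ C) :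
    ∫ x : Fin N → α, offDiagSum f x ∂(Measure.pi fun _ => μ) =
      N * (N - 1) * ∫ x, ∫ y, f x y ∂μ ∂μ := by
  have hi : ∀ i j : Fin N, Integrable (fun x : Fin N → α => if i = j then 0 else f (x i) (x j))
      (Measure.pi fun _ => μ) := fun i j => by
    split_ifs
    · exact integrable_zero _ _ _
    · exact integrable_pair hf hC i j
  unfold offDiagSum
  rw [integral_finsetSum _ fun i _ => integrable_finsetSum _ fun j _ => hi i j]
  have : ∀ i : Fin N, ∫ x : Fin N → α, ∑ j, (if i = j then 0 else f (x i) (x j))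
      ∂(Measure.pi fun _ => μ) = (N - 1) * ∫ x, ∫ y, f x y ∂μ ∂μ := by
    intro i
    rw [integral_finsetSum _ fun j _ => hi i j]
    have h2 : ∀ j, ∫ x : Fin N → α, (if i = j then 0 else f (x i) (x j))
        ∂(Measure.pi fun _ => μ) = (1 - if i = j then 1 else 0) * ∫ x, ∫ y, f x y ∂μ ∂μ := by
      intro j
      split_ifs with h
      · simp
      · rw [integral_pair hf hC h]; ring
    simp_rw [h2]
    rw [← Finset.sum_mul, Finset.sum_sub_distrib]
    simp
  simp_rw [this]
  simp
  ring

theorem integral_mul_disjoint (hf : Measurable (Function.uncurry f))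
    (hC : ∀ x y, |f x y| ≤ C) {i j k l : Fin N} (hij : i ≠ j) (hkl : k ≠ l)
    (hik : i ≠ k) (hil : i ≠ l) (hjk : j ≠ k) (hjl : j ≠ l) :
    ∫ x : Fin N → α, f (x i) (x j) * f (x k) (x l) ∂(Measure.pi fun _ => μ) =
      (∫ x, ∫ y, f x y ∂μ ∂μ) ^ 2 := by
  refine (integral_comp_measurePreserving
    (measurePreserving_eval_quadruple hij hkl hik hil hjk hjl)
    (f := fun p => Function.uncurry f p.1 * Function.uncurry f p.2)
    ((hf.comp measurable_fst).mul (hf.comp measurable_snd)).aestronglyMeasurable).trans ?_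
  rw [integral_prod_mul, integral_prod _ (integrable_of_abs_le hf fun p => hC p.1 p.2), sq]
  rfl

/-- Given the shared coordinate, the two factors are independent and have the same conditional mean.
-/
theorem integral_mul_common (hf : Measurable (Function.uncurry f))
    (hC : ∀ x y, |f x y| ≤ C) {i j l : Fin N} (hij : i ≠ j) (hil : i ≠ l) (hjl : j ≠ l) :
    ∫ x : Fin N → α, f (x i) (x j) * f (x i) (x l) ∂(Measure.pi fun _ => μ) =
      ∫ x, (∫ y, f x y ∂μ) ^ 2 ∂μ := by
  have hm : Measurable fun p : (α × α) × α => f p.2 p.1.1 * f p.2 p.1.2 :=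
    (hf.comp (measurable_snd.prodMk (measurable_fst.comp measurable_fst))).mul
      (hf.comp (measurable_snd.prodMk (measurable_snd.comp measurable_fst)))
  rw [integral_comp_measurePreserving (measurePreserving_eval_triple hjl hij.symm hil.symm)
    (f := fun p => f p.2 p.1.1 * f p.2 p.1.2) hm.aestronglyMeasurable, integral_prod_symm]
  · refine integral_congr_ae (ae_of_all _ fun x => ?_)
    exact (integral_prod_mul (f x) (f x)).trans (sq _).symm
  · refine integrable_of_abs_le (C := C * C) hm fun p => ?_
    rw [abs_mul]
    exact mul_le_mul (hC _ _) (hC _ _) (abs_nonneg _) ((abs_nonneg _).trans (hC p.2 p.2))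

/-- In the expanded square, disjoint pairs contribute the squared mean, pairs with one common index
the mean square of the partial average, and equal unordered pairs the mean of f². The last two kinds
number at most 4N³ and 2N². The squared mean keeps its exact coefficient so that it cancels later in
the variance. -/
theorem integral_offDiagSum_sq_le (hf : Measurable (Function.uncurry f))
    (hC : ∀ x y, |f x y| ≤ C) (hs : ∀ x y, f x y = f y x) :
    ∫ x : Fin N → α, offDiagSum f x ^ 2 ∂(Measure.pi fun _ => μ) ≤
      (N * (N - 1) * ∫ x, ∫ y, f x y ∂μ ∂μ) ^ 2 + 4 * N ^ 3 * (∫ x, (∫ y, f x y ∂μ) ^ 2 ∂μ)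
        + 2 * N ^ 2 * ∫ x, ∫ y, f x y ^ 2 ∂μ ∂μ := by
  set m := ∫ x, ∫ y, f x y ∂μ ∂μ with hm
  set A := ∫ x, (∫ y, f x y ∂μ) ^ 2 ∂μ with hA
  set B := ∫ x, ∫ y, f x y ^ 2 ∂μ ∂μ with hB
  have hA0 : 0 ≤ A := integral_nonneg fun _ => sq_nonneg _
  have hB0 : 0 ≤ B := integral_nonneg fun _ => integral_nonneg fun _ => sq_nonneg _
  have hf2 : Measurable (Function.uncurry fun x y => f x y ^ 2) := hf.pow_const 2
  have hC2 : ∀ x y, |f x y ^ 2| ≤ C ^ 2 := fun x y => by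
    rw [abs_pow]; exact pow_le_pow_left₀ (abs_nonneg _) (hC x y) 2
  set d : Fin N → Fin N → ℝ := fun i j => if i = j then 1 else 0 with hd
  have hd0 : ∀ i j, 0 ≤ d i j := fun i j => by simp only [hd]; split_ifs <;> norm_num
  have hdd : ∀ i, d i i = 1 := fun i => by simp [hd]
  set F : Fin N → Fin N → (Fin N → α) → ℝ := fun i j x => if i = j then 0 else f (x i) (x j)
    with hF
  have hFi : ∀ i j k l, Integrable (fun x => F i j x * F k l x) (Measure.pi fun _ => μ) := by
    intro i j k l
    have hFm : ∀ i j, Measurable (F i j) := fun i j => by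
      simp only [hF]
      split_ifs
      · exact measurable_const
      · exact measurable_apply₂ hf (measurable_pi_apply i) (measurable_pi_apply j)
    have hFb : ∀ i j x, |F i j x| ≤ C := fun i j x => by
      simp only [hF]
      split_ifs
      · simpa using (abs_nonneg _).trans (hC (x i) (x i))
      · exact hC _ _
    refine integrable_of_abs_le (C := C * C) ((hFm i j).mul (hFm k l)) fun x => ?_
    rw [abs_mul]
    exact mul_le_mul (hFb _ _ _) (hFb _ _ _) (abs_nonneg _) ((abs_nonneg _).trans (hFb i i x))
  -- The indicators d encode the overlap pattern of the two pairs, so that summing this single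
  -- inequality over all indices performs the counting. Symmetry of f moves a shared index to the
  -- first slot.
  have hterm : ∀ i j k l, ∫ x, F i j x * F k l x ∂(Measure.pi fun _ => μ) ≤
      (1 - d i j) * (1 - d k l) * m ^ 2 + (d i k + d i l + d j k + d j l) * A
        + (d i k * d j l + d i l * d j k) * B := by
    intro i j k l
    have hm2 := sq_nonneg m
    have hab : 0 ≤ (d i k + d i l + d j k + d j l) * A + (d i k * d j l + d i l * d j k) * B := by
      have := hd0 i k; have := hd0 i l; have := hd0 j k; have := hd0 j l
      positivity
    by_cases hij : i = j
    · simp only [hF, if_pos hij, zero_mul, integral_zero]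
      have : d i j = 1 := by simp [hd, hij]
      rw [this]; linarith
    by_cases hkl : k = l
    · simp only [hF, if_pos hkl, mul_zero, integral_zero]
      have : d k l = 1 := by simp [hd, hkl]
      rw [this]; linarith
    have hsq : ∫ x : Fin N → α, f (x i) (x j) * f (x i) (x j) ∂(Measure.pi fun _ => μ) = B := by
      rw [hB, ← integral_pair hf2 hC2 hij]
      simp_rw [sq]
    have hji := Ne.symm hij
    have hlk := Ne.symm hkl
    simp only [hF, if_neg hij, if_neg hkl]
    by_cases hik : i = k
    · subst hik
      by_cases hjl : j = l
      · subst hjl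
        rw [hsq]
        simp [hd, hij, hji]
        linarith
      · rw [integral_mul_common hf hC hij hkl hjl, ← hA]
        simp [hd, hij, hji, hkl, hjl]
        linarith
    by_cases hil : i = l
    · subst hil
      have e : ∀ x : Fin N → α, f (x k) (x i) = f (x i) (x k) := fun x => hs _ _
      simp_rw [e]
      by_cases hjk : j = k
      · subst hjk
        rw [hsq]
        simp [hd, hij, hji]
        linarith
      · rw [integral_mul_common hf hC hij hik hjk, ← hA]
        simp [hd, hij, hji, hik, hkl, hjk]
        linarith
    have e : ∀ x : Fin N → α, f (x i) (x j) = f (x j) (x i) := fun x => hs _ _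
    by_cases hjk : j = k
    · subst hjk
      simp_rw [e]
      rw [integral_mul_common hf hC hji hkl hil, ← hA]
      simp [hd, hij, hil, hkl]
      linarith
    by_cases hjl : j = l
    · subst hjl
      have e' : ∀ x : Fin N → α, f (x k) (x j) = f (x j) (x k) := fun x => hs _ _
      simp_rw [e, e']
      rw [integral_mul_common hf hC hji hjk hik, ← hA]
      simp [hd, hij, hik, hjk, hkl]
      linarith
    rw [integral_mul_disjoint hf hC hij hkl hik hil hjk hjl]
    simp [hd, hij, hik, hil, hjk, hjl, hkl, hm]
  have hexp : ∀ x : Fin N → α, offDiagSum f x ^ 2 =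
      ∑ i, ∑ j, ∑ k, ∑ l, F i j x * F k l x := by
    intro x
    change (∑ i, ∑ j, F i j x) ^ 2 = _
    simp_rw [sq, Finset.sum_mul, Finset.mul_sum]
  simp_rw [hexp]
  rw [integral_finsetSum _ fun i _ => integrable_finsetSum _ fun j _ => integrable_finsetSum _
    fun k _ => integrable_finsetSum _ fun l _ => hFi i j k l]
  simp_rw [integral_finsetSum Finset.univ fun j (_ : j ∈ Finset.univ) => integrable_finsetSum
    Finset.univ fun k _ => integrable_finsetSum Finset.univ fun l _ => hFi _ j k l,
    integral_finsetSum Finset.univ fun k (_ : k ∈ Finset.univ) => integrable_finsetSum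
    Finset.univ fun l _ => hFi _ _ k l,
    integral_finsetSum Finset.univ fun l (_ : l ∈ Finset.univ) => hFi _ _ _ l]
  calc _ ≤ ∑ i, ∑ j, ∑ k, ∑ l, ((1 - d i j) * (1 - d k l) * m ^ 2
        + (d i k + d i l + d j k + d j l) * A + (d i k * d j l + d i l * d j k) * B) :=
        Finset.sum_le_sum fun i _ => Finset.sum_le_sum fun j _ => Finset.sum_le_sum fun k _ =>
          Finset.sum_le_sum fun l _ => hterm i j k l
    _ = _ := by
      have hs1 : ∀ i, ∑ j, d i j = 1 := fun i => by simp [hd]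
      simp only [Finset.sum_add_distrib, ← Finset.sum_mul, ← Finset.mul_sum,
        Finset.sum_sub_distrib, hs1, Finset.sum_const, Finset.card_univ, Fintype.card_fin,
        nsmul_eq_mul, mul_one]
      ring

end OffDiagonal

/-! ### Sums over pairs of distinct rows and pairs of distinct columns -/

section FourCycle

variable {α β : Type*} [MeasurableSpace α] [MeasurableSpace β]
  {μ : Measure α} [IsProbabilityMeasure μ] {ν : Measure β} [IsProbabilityMeasure ν] {N : ℕ}

/-- The sum of `g (x i) (x j) (y k) (y l)` over `i ≠ j` and `k ≠ l`. -/
noncomputable def fourSum {α β : Type*} {N : ℕ} (g : α → α → β → β → ℝ) (x : Fin N → α)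
    (y : Fin N → β) : ℝ :=
  offDiagSum (fun r r' => offDiagSum (g r r') y) x

theorem integral_offDiagSum_param {N : ℕ} {β : Type*} {f : α → β → β → ℝ} {C : ℝ}
    (hf : ∀ t t', Measurable fun r => f r t t')
    (hC : ∀ r t t', |f r t t'| ≤ C) (y : Fin N → β) :
    ∫ r, offDiagSum (f r) y ∂μ = offDiagSum (fun t t' => ∫ r, f r t t' ∂μ) y := by
  have hi : ∀ i j : Fin N, Integrable (fun r => if i = j then 0 else f r (y i) (y j)) μ := by
    intro i j
    split_ifs
    · exact integrable_zero _ _ _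
    · exact integrable_of_abs_le (hf _ _) fun r => hC r _ _
  unfold offDiagSum
  rw [integral_finsetSum _ fun i _ => integrable_finsetSum _ fun j _ => hi i j]
  refine Finset.sum_congr rfl fun i _ => ?_
  rw [integral_finsetSum _ fun j _ => hi i j]
  refine Finset.sum_congr rfl fun j _ => ?_
  split_ifs <;> simp

theorem abs_integral_le_of_abs_le {f : α → ℝ} {C : ℝ} (hC : ∀ x, |f x| ≤ C) :
    |∫ x, f x ∂μ| ≤ C := by
  have := norm_integral_le_of_norm_le_const (μ := μ) (f := f) (C := C) (ae_of_all _ hC)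
  simpa using this

theorem measurable_integral_right {γ : Type*} [MeasurableSpace γ] {f : γ → α → ℝ}
    (hf : Measurable (Function.uncurry f)) : Measurable fun x => ∫ y, f x y ∂μ :=
  (hf.stronglyMeasurable.integral_prod_right (ν := μ)).measurable

theorem measurable_offDiagSum_param {γ : Type*} [MeasurableSpace γ] {f : γ → β → β → ℝ}
    (hf : Measurable fun p : γ × β × β => f p.1 p.2.1 p.2.2) :
    Measurable fun p : γ × (Fin N → β) => offDiagSum (f p.1) p.2 := by
  refine Finset.measurable_sum _ fun i _ => Finset.measurable_sum _ fun j _ => ?_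
  split_ifs
  · exact measurable_const
  · have hi : Measurable fun p : γ × (Fin N → β) => p.2 i :=
      (measurable_pi_apply i).comp measurable_snd
    have hj : Measurable fun p : γ × (Fin N → β) => p.2 j :=
      (measurable_pi_apply j).comp measurable_snd
    exact hf.comp (measurable_fst.prodMk (hi.prodMk hj))

theorem integral_linear_three {μ : Measure α} {f₁ f₂ f₃ : α → ℝ}
    (h₁ : Integrable f₁ μ) (h₂ : Integrable f₂ μ)
    (h₃ : Integrable f₃ μ) (a b c : ℝ) :
    Integrable (fun x => a * f₁ x + b * f₂ x + c * f₃ x) μ ∧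
    ∫ x, a * f₁ x + b * f₂ x + c * f₃ x ∂μ =
      a * (∫ x, f₁ x ∂μ) + b * (∫ x, f₂ x ∂μ) + c * ∫ x, f₃ x ∂μ := by
  have k₁ := (h₁.const_mul a).add (h₂.const_mul b)
  refine ⟨k₁.add (h₃.const_mul c), ?_⟩
  rw [← integral_const_mul, ← integral_const_mul, ← integral_const_mul]
  refine (integral_add k₁ (h₃.const_mul c)).trans (congrArg (· + _) ?_)
  exact integral_add (h₁.const_mul a) (h₂.const_mul b)

theorem integral_offDiagSum_sq_le_of_le {f : α → α → ℝ} {C : ℝ}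
    (hf : Measurable (Function.uncurry f)) (hC : ∀ x y, |f x y| ≤ C) (hs : ∀ x y, f x y = f y x)
    {m A B : ℝ} (hm : (∫ x, ∫ y, f x y ∂μ ∂μ) ^ 2 ≤ m) (hA : ∫ x, (∫ y, f x y ∂μ) ^ 2 ∂μ ≤ A)
    (hB : ∫ x, ∫ y, f x y ^ 2 ∂μ ∂μ ≤ B) :
    ∫ x : Fin N → α, offDiagSum f x ^ 2 ∂(Measure.pi fun _ => μ) ≤
      (N * (N - 1)) ^ 2 * m + 4 * N ^ 3 * A + 2 * N ^ 2 * B := by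
  refine (integral_offDiagSum_sq_le hf hC hs).trans ?_
  rw [mul_pow]
  gcongr

variable {g : α → α → β → β → ℝ}

theorem measurable_kernel {γ : Type*} [MeasurableSpace γ]
    (hg : Measurable fun p : (α × α) × (β × β) => g p.1.1 p.1.2 p.2.1 p.2.2)
    {a b : γ → α} {c d : γ → β} (ha : Measurable a) (hb : Measurable b) (hc : Measurable c)
    (hd : Measurable d) : Measurable fun p => g (a p) (b p) (c p) (d p) :=
  hg.comp ((ha.prodMk hb).prodMk (hc.prodMk hd))

set_option maxHeartbeats 1000000 in
/-- The second moment of a `fourSum` is close to the square of its mean, if the partial means of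
`g` are small. -/
theorem integral_fourSum_sq_le
    (hg : Measurable fun p : (α × α) × (β × β) => g p.1.1 p.1.2 p.2.1 p.2.2)
    (hb : ∀ r r' t t', |g r r' t t'| ≤ 1)
    (hs₁ : ∀ r r' t t', g r r' t t' = g r' r t t')
    (hs₂ : ∀ r r' t t', g r r' t t' = g r r' t' t)
    {η : ℝ}
    (ha₁ : ∫ t, (∫ t', ∫ r, ∫ r', g r r' t t' ∂μ ∂μ ∂ν) ^ 2 ∂ν ≤ η ^ 2)
    (ha₂ : ∫ t, ∫ t', (∫ r, ∫ r', g r r' t t' ∂μ ∂μ) ^ 2 ∂ν ∂ν ≤ η)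
    (hb₀ : ∀ r, (∫ t, ∫ t', ∫ r', g r r' t t' ∂μ ∂ν ∂ν) ^ 2 ≤ η ^ 2)
    (hb₁ : ∀ r, ∫ t, (∫ t', ∫ r', g r r' t t' ∂μ ∂ν) ^ 2 ∂ν ≤ η)
    (hb₂ : ∀ r, ∫ t, ∫ t', (∫ r', g r r' t t' ∂μ) ^ 2 ∂ν ∂ν ≤ η)
    (hc₀ : ∫ p : α × α, (∫ t, ∫ t', g p.1 p.2 t t' ∂ν ∂ν) ^ 2 ∂(μ.prod μ) ≤ η)
    (hc₁ : ∫ p : α × α, ∫ t, (∫ t', g p.1 p.2 t t' ∂ν) ^ 2 ∂ν ∂(μ.prod μ) ≤ η) :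
    ∫ y, ∫ x, fourSum g x y ^ 2 ∂(Measure.pi fun _ : Fin N => μ) ∂(Measure.pi fun _ : Fin N => ν) ≤
      (N * (N - 1)) ^ 2 * ((N * (N - 1)) ^ 2 * (∫ t, ∫ t', ∫ r, ∫ r', g r r' t t' ∂μ ∂μ ∂ν ∂ν) ^ 2
        + 4 * N ^ 3 * η ^ 2 + 2 * N ^ 2 * η)
      + 4 * N ^ 3 * ((N * (N - 1)) ^ 2 * η ^ 2 + 4 * N ^ 3 * η + 2 * N ^ 2 * η)
      + 2 * N ^ 2 * ((N * (N - 1)) ^ 2 * η + 4 * N ^ 3 * η + 2 * N ^ 2) := by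
  set n : ℝ := N * (N - 1) with hn
  have hKm : Measurable fun p : (α × α) × (Fin N → β) => offDiagSum (g p.1.1 p.1.2) p.2 :=
    measurable_offDiagSum_param (f := fun (p : α × α) t t' => g p.1 p.2 t t') hg
  have hKb : ∀ r r' (y : Fin N → β), |offDiagSum (g r r') y| ≤ N ^ 2 := fun r r' y => by
    simpa using abs_offDiagSum_le (hb r r') y
  have hsqb : ∀ {a b : ℝ}, |a| ≤ b → |a ^ 2| ≤ b ^ 2 := fun {a b} h => by
    rw [abs_pow]; exact pow_le_pow_left₀ (abs_nonneg _) h 2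
  -- the partial means of the kernel
  set F₂ : α → β → β → ℝ := fun r t t' => ∫ r', g r r' t t' ∂μ with hF₂
  have hF₂m : Measurable fun p : α × β × β => F₂ p.1 p.2.1 p.2.2 :=
    measurable_integral_right (f := fun (p : α × β × β) r' => g p.1 r' p.2.1 p.2.2)
      (measurable_kernel hg (by fun_prop) (by fun_prop) (by fun_prop) (by fun_prop))
  have hF₂b : ∀ r t t', |F₂ r t t'| ≤ 1 := fun r t t' => abs_integral_le_of_abs_le fun _ => hb _ _ _ _
  set F₁ : β → β → ℝ := fun t t' => ∫ r, F₂ r t t' ∂μ with hF₁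
  have hF₁m : Measurable (Function.uncurry F₁) :=
    measurable_integral_right (f := fun (p : β × β) r => F₂ r p.1 p.2)
      (hF₂m.comp (measurable_snd.prodMk measurable_fst))
  have hF₁b : ∀ t t', |F₁ t t'| ≤ 1 := fun t t' => abs_integral_le_of_abs_le fun _ => hF₂b _ _ _
  have hF₁s : ∀ t t', F₁ t t' = F₁ t' t := fun t t' => by
    simp only [hF₁, hF₂]; simp_rw [hs₂ _ _ t t']
  have hF₂s : ∀ r t t', F₂ r t t' = F₂ r t' t := fun r t t' => by
    simp only [hF₂]; simp_rw [hs₂ _ _ t t']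
  have hmean₂ : ∀ r (y : Fin N → β), ∫ r', offDiagSum (g r r') y ∂μ = offDiagSum (F₂ r) y :=
    fun r y => integral_offDiagSum_param (fun t t' =>
      measurable_kernel hg (by fun_prop) (by fun_prop) (by fun_prop) (by fun_prop))
      (fun r' t t' => hb r r' t t') y
  have hmean₁ : ∀ y : Fin N → β, ∫ r, offDiagSum (F₂ r) y ∂μ = offDiagSum F₁ y :=
    fun y => integral_offDiagSum_param (fun t t' =>
      hF₂m.comp (measurable_id.prodMk (measurable_const.prodMk measurable_const))) hF₂b y
  have hF₂o : Measurable fun p : α × (Fin N → β) => offDiagSum (F₂ p.1) p.2 :=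
    measurable_offDiagSum_param hF₂m
  have hF₂ob : ∀ r (y : Fin N → β), |offDiagSum (F₂ r) y| ≤ N ^ 2 := fun r y => by
    simpa using abs_offDiagSum_le (hF₂b r) y
  have hF₁ob : ∀ y : Fin N → β, |offDiagSum F₁ y| ≤ N ^ 2 := fun y => by
    simpa using abs_offDiagSum_le hF₁b y
  -- averaging over the rows
  have hrow : ∀ y : Fin N → β, ∫ x, fourSum g x y ^ 2 ∂(Measure.pi fun _ : Fin N => μ) ≤
      n ^ 2 * offDiagSum F₁ y ^ 2 + 4 * N ^ 3 * (∫ r, offDiagSum (F₂ r) y ^ 2 ∂μ)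
        + 2 * N ^ 2 * ∫ p : α × α, offDiagSum (g p.1 p.2) y ^ 2 ∂(μ.prod μ) := by
    intro y
    have hm : Measurable (Function.uncurry fun r r' => offDiagSum (g r r') y) :=
      hKm.comp (measurable_id.prodMk measurable_const)
    -- For fixed y the four-index sum is a pair sum in x whose kernel is itself a pair sum in y. Its
    -- partial means over rows are again pair sums in y, so the two-index bound can be used once
    -- more for the columns.
    have h := integral_offDiagSum_sq_le (μ := μ) (N := N) hm (fun r r' => hKb r r' y)
      (fun r r' => by simp only [offDiagSum]; simp_rw [hs₁ r r'])
    rw [← integral_prod (fun p : α × α => offDiagSum (g p.1 p.2) y ^ 2)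
      (integrable_of_abs_le (hm.pow_const 2) fun p => hsqb (hKb p.1 p.2 y))] at h
    simp_rw [hmean₂, hmean₁] at h
    rw [mul_pow] at h
    exact h
  have i1 : Integrable (fun y : Fin N → β => offDiagSum F₁ y ^ 2) (Measure.pi fun _ => ν) :=
    integrable_of_abs_le ((measurable_offDiagSum hF₁m).pow_const 2) fun y => hsqb (hF₁ob y)
  have i2' : Integrable (Function.uncurry fun (y : Fin N → β) r => offDiagSum (F₂ r) y ^ 2)
      ((Measure.pi fun _ => ν).prod μ) :=
    integrable_of_abs_le ((hF₂o.comp measurable_swap).pow_const 2) fun p => hsqb (hF₂ob p.2 p.1)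
  have i3' : Integrable (Function.uncurry fun (y : Fin N → β) (p : α × α) =>
      offDiagSum (g p.1 p.2) y ^ 2) ((Measure.pi fun _ => ν).prod (μ.prod μ)) :=
    integrable_of_abs_le ((hKm.comp measurable_swap).pow_const 2) fun p => hsqb (hKb p.2.1 p.2.2 p.1)
  have i2 := i2'.integral_prod_left
  have i3 := i3'.integral_prod_left
  simp only [Function.uncurry] at i2 i3
  have hstep : ∫ y, ∫ x, fourSum g x y ^ 2 ∂(Measure.pi fun _ : Fin N => μ)
      ∂(Measure.pi fun _ : Fin N => ν) ≤
      n ^ 2 * (∫ y, offDiagSum F₁ y ^ 2 ∂(Measure.pi fun _ : Fin N => ν))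
      + 4 * N ^ 3 * (∫ r, ∫ y, offDiagSum (F₂ r) y ^ 2 ∂(Measure.pi fun _ : Fin N => ν) ∂μ)
      + 2 * N ^ 2 * ∫ p : α × α, ∫ y, offDiagSum (g p.1 p.2) y ^ 2
        ∂(Measure.pi fun _ : Fin N => ν) ∂(μ.prod μ) := by
    rw [← integral_integral_swap i2', ← integral_integral_swap i3']
    obtain ⟨k1, k2⟩ := integral_linear_three i1 i2 i3 (n ^ 2) (4 * N ^ 3) (2 * N ^ 2)
    exact (integral_mono_of_nonneg (ae_of_all _ fun y => integral_nonneg fun x => sq_nonneg _)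
      k1 (ae_of_all _ hrow)).trans_eq k2
  refine hstep.trans ?_
  -- averaging over the columns
  have hT₁ : ∫ y, offDiagSum F₁ y ^ 2 ∂(Measure.pi fun _ : Fin N => ν) ≤
      n ^ 2 * (∫ t, ∫ t', F₁ t t' ∂ν ∂ν) ^ 2 + 4 * N ^ 3 * η ^ 2 + 2 * N ^ 2 * η :=
    integral_offDiagSum_sq_le_of_le hF₁m hF₁b hF₁s le_rfl ha₁ ha₂
  have hT₂ : ∀ r, ∫ y, offDiagSum (F₂ r) y ^ 2 ∂(Measure.pi fun _ : Fin N => ν) ≤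
      n ^ 2 * η ^ 2 + 4 * N ^ 3 * η + 2 * N ^ 2 * η := fun r =>
    integral_offDiagSum_sq_le_of_le (f := F₂ r)
      (hF₂m.comp ((measurable_const (a := r)).prodMk measurable_id))
      (hF₂b r) (hF₂s r) (hb₀ r) (hb₁ r) (hb₂ r)
  -- When both row and column pairs coincide no averaging is left, and g² ≤ 1 is enough: only O(N⁴)
  -- terms are of this type.
  have hT₃ : ∀ p : α × α, ∫ y, offDiagSum (g p.1 p.2) y ^ 2 ∂(Measure.pi fun _ : Fin N => ν) ≤
      n ^ 2 * (∫ t, ∫ t', g p.1 p.2 t t' ∂ν ∂ν) ^ 2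
        + 4 * N ^ 3 * (∫ t, (∫ t', g p.1 p.2 t t' ∂ν) ^ 2 ∂ν) + 2 * N ^ 2 * 1 := by
    intro p
    refine integral_offDiagSum_sq_le_of_le (f := g p.1 p.2)
      (hg.comp ((measurable_const (a := p)).prodMk measurable_id))
      (hb p.1 p.2) (hs₂ p.1 p.2) le_rfl le_rfl ?_
    exact (le_abs_self _).trans (abs_integral_le_of_abs_le fun t => abs_integral_le_of_abs_le
      fun t' => by simpa using hsqb (hb p.1 p.2 t t'))
  have hG₁m : Measurable fun q : (α × α) × β => ∫ t', g q.1.1 q.1.2 q.2 t' ∂ν :=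
    measurable_integral_right (f := fun (q : (α × α) × β) t' => g q.1.1 q.1.2 q.2 t')
      (measurable_kernel hg (by fun_prop) (by fun_prop) (by fun_prop) (by fun_prop))
  have hG₁b : ∀ (q : (α × α) × β), |∫ t', g q.1.1 q.1.2 q.2 t' ∂ν| ≤ 1 :=
    fun q => abs_integral_le_of_abs_le fun _ => hb _ _ _ _
  have i4 : Integrable (fun p : α × α => (∫ t, ∫ t', g p.1 p.2 t t' ∂ν ∂ν) ^ 2) (μ.prod μ) :=
    integrable_of_abs_le ((measurable_integral_right
      (f := fun (p : α × α) t => ∫ t', g p.1 p.2 t t' ∂ν) hG₁m).pow_const 2)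
      fun p => hsqb (abs_integral_le_of_abs_le fun t => hG₁b (p, t))
  have i5 : Integrable (fun p : α × α => ∫ t, (∫ t', g p.1 p.2 t t' ∂ν) ^ 2 ∂ν) (μ.prod μ) :=
    integrable_of_abs_le (measurable_integral_right
      (f := fun (p : α × α) t => (∫ t', g p.1 p.2 t t' ∂ν) ^ 2) (hG₁m.pow_const 2))
      fun p => abs_integral_le_of_abs_le fun t => hsqb (hG₁b (p, t))
  have hT₂' : ∫ r, ∫ y, offDiagSum (F₂ r) y ^ 2 ∂(Measure.pi fun _ : Fin N => ν) ∂μ ≤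
      n ^ 2 * η ^ 2 + 4 * N ^ 3 * η + 2 * N ^ 2 * η := by
    refine (integral_mono_of_nonneg (ae_of_all _ fun r => integral_nonneg fun x => sq_nonneg _)
      (integrable_const _) (ae_of_all _ hT₂)).trans ?_
    simp
  have hT₃' : ∫ p : α × α, ∫ y, offDiagSum (g p.1 p.2) y ^ 2 ∂(Measure.pi fun _ : Fin N => ν)
      ∂(μ.prod μ) ≤ n ^ 2 * η + 4 * N ^ 3 * η + 2 * N ^ 2 := by
    obtain ⟨k1, k2⟩ := integral_linear_three i4 i5 (integrable_const (μ := μ.prod μ) (1 : ℝ))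
      (n ^ 2) (4 * N ^ 3) (2 * N ^ 2)
    refine (integral_mono_of_nonneg (ae_of_all _ fun r => integral_nonneg fun x => sq_nonneg _)
      k1 (ae_of_all _ hT₃)).trans (k2.le.trans ?_)
    have h1 := mul_le_mul_of_nonneg_left hc₀ (sq_nonneg n)
    have h2 := mul_le_mul_of_nonneg_left hc₁ (by positivity : (0 : ℝ) ≤ 4 * N ^ 3)
    have h3 : ∫ _ : α × α, (1 : ℝ) ∂(μ.prod μ) = 1 := by simp
    rw [h3, mul_one]
    exact add_le_add_left (add_le_add h1 h2) _
  have h1 := mul_le_mul_of_nonneg_left hT₁ (sq_nonneg n)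
  have h2 := mul_le_mul_of_nonneg_left hT₂' (by positivity : (0 : ℝ) ≤ 4 * N ^ 3)
  have h3 := mul_le_mul_of_nonneg_left hT₃' (by positivity : (0 : ℝ) ≤ 2 * N ^ 2)
  exact add_le_add (add_le_add h1 h2) h3

end FourCycle

section FourCycle

variable {α β : Type*} [MeasurableSpace α] [MeasurableSpace β]
  {μ : Measure α} [IsProbabilityMeasure μ] {ν : Measure β} [IsProbabilityMeasure ν] {N : ℕ}

/-- The mean of a `fourSum`. -/
theorem integral_fourSum {g : α → α → β → β → ℝ}
    (hg : Measurable fun p : (α × α) × (β × β) => g p.1.1 p.1.2 p.2.1 p.2.2)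
    (hb : ∀ r r' t t', |g r r' t t'| ≤ 1) :
    ∫ y, ∫ x, fourSum g x y ∂(Measure.pi fun _ : Fin N => μ) ∂(Measure.pi fun _ : Fin N => ν) =
      (N * (N - 1)) ^ 2 * ∫ t, ∫ t', ∫ r, ∫ r', g r r' t t' ∂μ ∂μ ∂ν ∂ν := by
  have hKm : Measurable fun p : (α × α) × (Fin N → β) => offDiagSum (g p.1.1 p.1.2) p.2 :=
    measurable_offDiagSum_param (f := fun (p : α × α) t t' => g p.1 p.2 t t') hg
  have hF₂m : Measurable fun p : α × β × β => ∫ r', g p.1 r' p.2.1 p.2.2 ∂μ :=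
    measurable_integral_right (f := fun (p : α × β × β) r' => g p.1 r' p.2.1 p.2.2)
      (measurable_kernel hg (by fun_prop) (by fun_prop) (by fun_prop) (by fun_prop))
  have hF₁m : Measurable fun p : β × β => ∫ r, ∫ r', g r r' p.1 p.2 ∂μ ∂μ :=
    measurable_integral_right (f := fun (p : β × β) r => ∫ r', g r r' p.1 p.2 ∂μ)
      (hF₂m.comp (measurable_snd.prodMk measurable_fst))
  have h1 : ∀ y : Fin N → β, ∫ x, fourSum g x y ∂(Measure.pi fun _ : Fin N => μ) =
      N * (N - 1) * offDiagSum (fun t t' => ∫ r, ∫ r', g r r' t t' ∂μ ∂μ) y := by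
    intro y
    have hm : Measurable (Function.uncurry fun r r' => offDiagSum (g r r') y) :=
      hKm.comp (measurable_id.prodMk measurable_const)
    refine (integral_offDiagSum hm fun r r' => abs_offDiagSum_le (hb r r') y).trans ?_
    have e2 : ∀ r, ∫ r', offDiagSum (g r r') y ∂μ =
        offDiagSum (fun t t' => ∫ r', g r r' t t' ∂μ) y := fun r =>
      integral_offDiagSum_param (fun t t' =>
        measurable_kernel hg (by fun_prop) (by fun_prop) (by fun_prop) (by fun_prop))
        (fun r' t t' => hb r r' t t') y
    simp_rw [e2]
    congr 1
    exact integral_offDiagSum_param (fun t t' =>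
      hF₂m.comp (measurable_id.prodMk (measurable_const.prodMk measurable_const)))
      (fun r t t' => abs_integral_le_of_abs_le fun _ => hb _ _ _ _) y
  simp_rw [h1]
  rw [integral_const_mul]
  have h2 := integral_offDiagSum (μ := ν) (N := N)
    (f := fun t t' => ∫ r, ∫ r', g r r' t t' ∂μ ∂μ) hF₁m
    (fun t t' => abs_integral_le_of_abs_le fun _ => abs_integral_le_of_abs_le fun _ => hb _ _ _ _)
  rw [h2]
  ring

/-- Chebyshev's inequality for a random variable `S` on a product space. -/
theorem measure_ge_le_of_integral_sq {Ω : Type*} [MeasurableSpace Ω] {π : Measure Ω}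
    [IsProbabilityMeasure π] {S : Ω → ℝ} (hS : Measurable S) {C : ℝ} (hC : ∀ ω, |S ω| ≤ C)
    {m V c : ℝ} (hm : ∫ ω, S ω ∂π = m) (hV : ∫ ω, S ω ^ 2 ∂π ≤ m ^ 2 + V) (hc : 0 < c) :
    π {ω | m + c ≤ S ω} ≤ ENNReal.ofReal (V / c ^ 2) := by
  have hL : MemLp S 2 π := (memLp_two_iff_integrable_sq hS.aestronglyMeasurable).2
    (integrable_of_abs_le (hS.pow_const 2) fun ω => by
      rw [abs_pow]; exact pow_le_pow_left₀ (abs_nonneg _) (hC ω) 2)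
  have h := meas_ge_le_variance_div_sq hL hc
  have hvar : Var[S; π] ≤ V := by
    have := variance_eq_sub hL
    rw [this, hm]
    have e : π[S ^ 2] = ∫ ω, S ω ^ 2 ∂π := rfl
    rw [e]; linarith
  refine (measure_mono fun ω hω => ?_).trans (h.trans (ENNReal.ofReal_le_ofReal (by gcongr)))
  simp only [Set.mem_ofPred_eq, hm] at hω ⊢
  exact le_trans (by linarith) (le_abs_self _)

/-! ### Four-cycles of a random matrix and correlations of its rows -/

variable {h : α → β → ℂ}

/-- The kernel of the sum over the four-cycles of a random matrix. -/
noncomputable def cycleKernel (h : α → β → ℂ) (r r' : α) (t t' : β) : ℝ :=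
  ((h r t * star (h r' t)) * star (h r t' * star (h r' t'))).re

theorem sq_re_le_norm_sq (z : ℂ) : z.re ^ 2 ≤ ‖z‖ ^ 2 := by
  rw [← Complex.normSq_eq_norm_sq, Complex.normSq_apply]; nlinarith [sq_nonneg z.im]

theorem integrable_of_norm_le_one {γ : Type*} [MeasurableSpace γ] {μ : Measure γ}
    [IsFiniteMeasure μ] {f : γ → ℂ} (hf : Measurable f) (hb : ∀ x, ‖f x‖ ≤ 1) :
    Integrable f μ :=
  Integrable.of_bound hf.aestronglyMeasurable 1 (ae_of_all _ hb)

theorem integral_re_mul {γ : Type*} [MeasurableSpace γ] {μ : Measure γ}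
    [IsFiniteMeasure μ] {f : γ → ℂ} (hf : Measurable f) (hb : ∀ x, ‖f x‖ ≤ 1) (c : ℂ) :
    ∫ x, (c * f x).re ∂μ = (c * ∫ x, f x ∂μ).re := by
  rw [← integral_const_mul]
  exact integral_re ((integrable_of_norm_le_one hf hb).const_mul c)

theorem integral_star {γ : Type*} [MeasurableSpace γ] {μ : Measure γ} (f : γ → ℂ) :
    ∫ x, star (f x) ∂μ = star (∫ x, f x ∂μ) := integral_conj

theorem sq_integral_le {γ : Type*} [MeasurableSpace γ] {μ : Measure γ} [IsProbabilityMeasure μ]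
    {f : γ → ℝ} (hf : Measurable f) {C : ℝ} (hC : ∀ x, |f x| ≤ C) :
    (∫ x, f x ∂μ) ^ 2 ≤ ∫ x, f x ^ 2 ∂μ := by
  have hL : MemLp f 2 μ := (memLp_two_iff_integrable_sq hf.aestronglyMeasurable).2
    (integrable_of_abs_le (hf.pow_const 2) fun ω => by
      rw [abs_pow]; exact pow_le_pow_left₀ (abs_nonneg _) (hC ω) 2)
  have h1 := variance_nonneg f μ
  rw [variance_eq_sub hL] at h1
  have e : μ[f ^ 2] = ∫ ω, f ω ^ 2 ∂μ := rfl
  rw [e] at h1; linarith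

end FourCycle

section FourCycle

variable {α β : Type*}

/-- Invariance under transposition: every estimate that averages over columns yields its counterpart
for rows. -/
theorem cycleKernel_swap (h : α → β → ℂ) (r r' : α) (t t' : β) :
    cycleKernel (fun t r => h r t) t t' r r' = cycleKernel h r r' t t' := by
  unfold cycleKernel
  congr 1
  simp only [star_mul', star_star]
  ring

theorem norm_mul_star_le {h : α → β → ℂ} (hb : ∀ r t, ‖h r t‖ ≤ 1) (r r' : α) (t t' : β) :
    ‖h r t * star (h r' t')‖ ≤ 1 := by
  rw [norm_mul, norm_star]
  exact mul_le_one₀ (hb _ _) (norm_nonneg _) (hb _ _)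

theorem abs_cycleKernel_le {h : α → β → ℂ} (hb : ∀ r t, ‖h r t‖ ≤ 1) (r r' : α) (t t' : β) :
    |cycleKernel h r r' t t'| ≤ 1 := by
  refine (Complex.abs_re_le_norm _).trans ?_
  rw [norm_mul, norm_star]
  exact mul_le_one₀ (norm_mul_star_le hb _ _ _ _) (norm_nonneg _) (norm_mul_star_le hb _ _ _ _)

theorem cycleKernel_symm_left (h : α → β → ℂ) (r r' : α) (t t' : β) :
    cycleKernel h r r' t t' = cycleKernel h r' r t t' := by
  unfold cycleKernel
  rw [← Complex.conj_re]
  congr 1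
  change star _ = _
  simp only [star_mul', star_star]
  ring

theorem cycleKernel_symm_right (h : α → β → ℂ) (r r' : α) (t t' : β) :
    cycleKernel h r r' t t' = cycleKernel h r r' t' t := by
  rw [← cycleKernel_swap, cycleKernel_symm_left, cycleKernel_swap]

variable [MeasurableSpace α] [MeasurableSpace β]

/-- The correlation of two rows of a random matrix, given their positions. -/
noncomputable def rowCorr (ν : Measure β) (h : α → β → ℂ) (r r' : α) : ℂ :=
  ∫ t, h r t * star (h r' t) ∂ν

theorem measurable_star_complex : Measurable (star : ℂ → ℂ) := continuous_star.measurable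

theorem measurable_cycleKernel {h : α → β → ℂ} (hm : Measurable (Function.uncurry h)) :
    Measurable fun p : (α × α) × (β × β) => cycleKernel h p.1.1 p.1.2 p.2.1 p.2.2 := by
  have e : ∀ {u : (α × α) × (β × β) → α} {v : (α × α) × (β × β) → β}, Measurable u → Measurable v →
      Measurable fun p => h (u p) (v p) := fun hu hv => hm.comp (hu.prodMk hv)
  have h1 := e (measurable_fst.comp measurable_fst) (measurable_fst.comp measurable_snd)
  have h2 := e (measurable_snd.comp measurable_fst) (measurable_fst.comp measurable_snd)
  have h3 := e (measurable_fst.comp measurable_fst) (measurable_snd.comp measurable_snd)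
  have h4 := e (measurable_snd.comp measurable_fst) (measurable_snd.comp measurable_snd)
  exact Complex.measurable_re.comp ((h1.mul (measurable_star_complex.comp h2)).mul
    (measurable_star_complex.comp (h3.mul (measurable_star_complex.comp h4))))

variable {μ : Measure α} [IsProbabilityMeasure μ] {ν : Measure β} [IsProbabilityMeasure ν] {N : ℕ}
  {h : α → β → ℂ}

theorem measurable_mul_star (hm : Measurable (Function.uncurry h)) (r r' : α) :
    Measurable fun t => h r t * star (h r' t) :=
  (hm.comp (measurable_const.prodMk measurable_id)).mul
    (measurable_star_complex.comp (hm.comp (measurable_const.prodMk measurable_id)))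

theorem norm_rowCorr_le {α : Type*} {h : α → β → ℂ} (hb : ∀ r t, ‖h r t‖ ≤ 1) (r r' : α) :
    ‖rowCorr ν h r r'‖ ≤ 1 := by
  have := norm_integral_le_of_norm_le_const (μ := ν) (C := 1)
    (ae_of_all _ fun t => norm_mul_star_le hb r r' t t)
  simpa [rowCorr] using this

theorem measurable_rowCorr (hm : Measurable (Function.uncurry h)) :
    Measurable fun p : α × α => rowCorr ν h p.1 p.2 := by
  have h1 : Measurable fun q : (α × α) × β => h q.1.1 q.2 :=
    hm.comp ((measurable_fst.comp measurable_fst).prodMk measurable_snd)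
  have h2 : Measurable fun q : (α × α) × β => h q.1.2 q.2 :=
    hm.comp ((measurable_snd.comp measurable_fst).prodMk measurable_snd)
  exact ((h1.mul (measurable_star_complex.comp h2)).stronglyMeasurable.integral_prod_right
    (ν := ν)).measurable

theorem integral_cycleKernel (hm : Measurable (Function.uncurry h)) (hb : ∀ r t, ‖h r t‖ ≤ 1)
    (r r' : α) (t : β) : ∫ t', cycleKernel h r r' t t' ∂ν =
      (h r t * star (h r' t) * star (rowCorr ν h r r')).re := by
  unfold cycleKernel rowCorr
  rw [integral_re_mul (f := fun t' => star (h r t' * star (h r' t')))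
    (measurable_star_complex.comp (measurable_mul_star hm r r')) fun t =>
      (norm_star _).trans_le (norm_mul_star_le hb r r' t t), integral_star]

/-- Given two rows, the two column positions are independent, so the mean of z(t) · conj z(t')
factors into a product of conjugate correlations. -/
theorem integral_integral_cycleKernel (hm : Measurable (Function.uncurry h))
    (hb : ∀ r t, ‖h r t‖ ≤ 1) (r r' : α) :
    ∫ t, ∫ t', cycleKernel h r r' t t' ∂ν ∂ν = ‖rowCorr ν h r r'‖ ^ 2 := by
  simp_rw [integral_cycleKernel hm hb, mul_comm _ (star (rowCorr ν h r r'))]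
  rw [integral_re_mul (measurable_mul_star hm r r') fun t => norm_mul_star_le hb r r' t t]
  change (star (rowCorr ν h r r') * rowCorr ν h r r').re = _
  rw [← Complex.ofReal_re (‖rowCorr ν h r r'‖ ^ 2), Complex.ofReal_pow, mul_comm]
  exact congrArg _ (Complex.mul_conj' _)

/-- Averaging a single column already produces the whole correlation; the remaining factor has
modulus at most one. This handles the overlap patterns in which only one index is free. -/
theorem sq_integral_cycleKernel_le (hm : Measurable (Function.uncurry h))
    (hb : ∀ r t, ‖h r t‖ ≤ 1) (r r' : α) (t : β) :
    (∫ t', cycleKernel h r r' t t' ∂ν) ^ 2 ≤ ‖rowCorr ν h r r'‖ ^ 2 := by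
  rw [integral_cycleKernel hm hb]
  refine (sq_re_le_norm_sq _).trans ?_
  rw [norm_mul, norm_star]
  exact pow_le_pow_left₀ (by positivity)
    (mul_le_of_le_one_left (norm_nonneg _) (norm_mul_star_le hb r r' t t)) 2

theorem integrable_rowCorr_sq (hm : Measurable (Function.uncurry h)) (hb : ∀ r t, ‖h r t‖ ≤ 1) :
    Integrable (fun p : α × α => ‖rowCorr ν h p.1 p.2‖ ^ 2) (μ.prod μ) :=
  integrable_of_abs_le (C := 1) ((measurable_rowCorr hm).norm.pow_const 2) fun p => by
    rw [abs_of_nonneg (sq_nonneg _)]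
    exact pow_le_one₀ (norm_nonneg _) (norm_rowCorr_le hb _ _)

theorem integrable_rowCorr_sq_right (hm : Measurable (Function.uncurry h))
    (hb : ∀ r t, ‖h r t‖ ≤ 1) (r : α) :
    Integrable (fun r' => ‖rowCorr ν h r r'‖ ^ 2) μ :=
  integrable_of_abs_le (C := 1)
    (((measurable_rowCorr hm).comp measurable_prodMk_left).norm.pow_const 2) fun p => by
    rw [abs_of_nonneg (sq_nonneg _)]
    exact pow_le_one₀ (norm_nonneg _) (norm_rowCorr_le hb _ _)

theorem integral_rowCorr_sq_le (hm : Measurable (Function.uncurry h)) (hb : ∀ r t, ‖h r t‖ ≤ 1)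
    {η : ℝ} (hη : ∀ r, ∫ r', ‖rowCorr ν h r r'‖ ^ 2 ∂μ ≤ η) :
    ∫ p : α × α, ‖rowCorr ν h p.1 p.2‖ ^ 2 ∂(μ.prod μ) ≤ η := by
  rw [integral_prod _ (integrable_rowCorr_sq hm hb)]
  refine (integral_mono_of_nonneg (ae_of_all _ fun r => integral_nonneg fun _ => sq_nonneg _)
    (integrable_const η) (ae_of_all _ hη)).trans ?_
  simp

theorem integral_sq_integral_rowCorr_sq_le {ν : Measure β} {η : ℝ}
    (hη : ∀ r, ∫ r', ‖rowCorr ν h r r'‖ ^ 2 ∂μ ≤ η) :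
    ∫ r, (∫ r', ‖rowCorr ν h r r'‖ ^ 2 ∂μ) ^ 2 ∂μ ≤ η ^ 2 := by
  refine (integral_mono_of_nonneg (ae_of_all _ fun r => sq_nonneg _)
    (integrable_const (η ^ 2)) (ae_of_all _ fun r => ?_)).trans ?_
  · exact pow_le_pow_left₀ (integral_nonneg fun _ => sq_nonneg _) (hη r) 2
  · simp

theorem sq_sq_norm_rowCorr_le {α : Type*} {h : α → β → ℂ} (hb : ∀ r t, ‖h r t‖ ≤ 1) (r r' : α) :
    (‖rowCorr ν h r r'‖ ^ 2) ^ 2 ≤ ‖rowCorr ν h r r'‖ ^ 2 := by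
  have h1 := pow_le_one₀ (n := 2) (norm_nonneg _) (norm_rowCorr_le (ν := ν) hb r r')
  nlinarith [sq_nonneg ‖rowCorr ν h r r'‖]

theorem integral_integral_integral_rotate {f : β → β → α → ℝ} {C : ℝ}
    (hf : Measurable fun q : (β × β) × α => f q.1.1 q.1.2 q.2) (hC : ∀ t t' r, |f t t' r| ≤ C) :
    ∫ t, ∫ t', ∫ r, f t t' r ∂μ ∂ν ∂ν = ∫ r, ∫ t, ∫ t', f t t' r ∂ν ∂ν ∂μ := by
  have i1 : Integrable (fun p : β × β => ∫ r, f p.1 p.2 r ∂μ) (ν.prod ν) :=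
    integrable_of_abs_le (measurable_integral_right (f := fun (p : β × β) r => f p.1 p.2 r) hf)
      fun p => abs_integral_le_of_abs_le fun r => hC _ _ r
  have i2 : Integrable (Function.uncurry fun (p : β × β) r => f p.1 p.2 r) ((ν.prod ν).prod μ) :=
    integrable_of_abs_le hf fun p => hC _ _ _
  rw [← integral_prod _ i1, integral_integral_swap i2]
  refine integral_congr_ae (ae_of_all _ fun r => ?_)
  have i3 : Integrable (fun p : β × β => f p.1 p.2 r) (ν.prod ν) :=
    integrable_of_abs_le (hf.comp (measurable_id.prodMk measurable_const)) fun p => hC _ _ _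
  exact integral_prod _ i3

theorem measurable_fourSum {g : α → α → β → β → ℝ}
    (hg : Measurable fun p : (α × α) × (β × β) => g p.1.1 p.1.2 p.2.1 p.2.2) :
    Measurable fun z : (Fin N → β) × (Fin N → α) => fourSum g z.2 z.1 := by
  unfold fourSum offDiagSum
  refine Finset.measurable_sum _ fun i _ => Finset.measurable_sum _ fun j _ => ?_
  split_ifs
  · exact measurable_const
  refine Finset.measurable_sum _ fun k _ => Finset.measurable_sum _ fun l _ => ?_
  split_ifs
  · exact measurable_const
  · exact measurable_kernel hg ((measurable_pi_apply i).comp measurable_snd)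
      ((measurable_pi_apply j).comp measurable_snd) ((measurable_pi_apply k).comp measurable_fst)
      ((measurable_pi_apply l).comp measurable_fst)

/-- The term (n²θ)² is kept intact because it is the squared mean. In each other term a missing
factor κ is bought with a factor N through 1 ≤ Nκ. This is why κ, of order 1/min(N, M), is used in
place of η, which may be far below 1/N. -/
theorem cycle_moment_bound {N n η κ θ : ℝ} (hN1 : 1 ≤ N) (hn0 : 0 ≤ n) (hn2 : n ≤ N ^ 2)
    (hη0 : 0 ≤ η) (hηκ : η ≤ κ) (hN : 1 ≤ N * κ) :
    n ^ 2 * (n ^ 2 * θ ^ 2 + 4 * N ^ 3 * η ^ 2 + 2 * N ^ 2 * η)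
      + 4 * N ^ 3 * (n ^ 2 * η ^ 2 + 4 * N ^ 3 * η + 2 * N ^ 2 * η)
      + 2 * N ^ 2 * (n ^ 2 * η + 4 * N ^ 3 * η + 2 * N ^ 2) ≤
    (n ^ 2 * θ) ^ 2 + 48 * N ^ 7 * κ ^ 2 := by
  have hκ : 0 < κ := by nlinarith
  have hn4 : n ^ 2 ≤ N ^ 4 := by
    calc n ^ 2 ≤ (N ^ 2) ^ 2 := pow_le_pow_left₀ hn0 hn2 2
      _ = _ := by ring
  have a1 : η ^ 2 ≤ κ ^ 2 := pow_le_pow_left₀ hη0 hηκ 2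
  have a2 : η ≤ N * κ ^ 2 := by nlinarith
  have a3 : 1 ≤ N ^ 2 * κ ^ 2 := by nlinarith
  have a4 : N * η ^ 2 ≤ N * κ ^ 2 := by nlinarith
  calc n ^ 2 * (n ^ 2 * θ ^ 2 + 4 * N ^ 3 * η ^ 2 + 2 * N ^ 2 * η)
        + 4 * N ^ 3 * (n ^ 2 * η ^ 2 + 4 * N ^ 3 * η + 2 * N ^ 2 * η)
        + 2 * N ^ 2 * (n ^ 2 * η + 4 * N ^ 3 * η + 2 * N ^ 2)
      ≤ (n ^ 2 * θ) ^ 2 + (N ^ 4 * (4 * N ^ 3 * η ^ 2 + 2 * N ^ 2 * η)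
        + 4 * N ^ 3 * (N ^ 4 * η ^ 2 + 4 * N ^ 3 * η + 2 * N ^ 3 * η)
        + 2 * N ^ 2 * (N ^ 4 * η + 4 * N ^ 4 * η + 2 * (N ^ 3 * 1))) := by
        have b1 : n ^ 2 * (4 * N ^ 3 * η ^ 2 + 2 * N ^ 2 * η) ≤
          N ^ 4 * (4 * N ^ 3 * η ^ 2 + 2 * N ^ 2 * η) := by gcongr
        have b2 : 4 * N ^ 3 * (n ^ 2 * η ^ 2 + 4 * N ^ 3 * η + 2 * N ^ 2 * η) ≤
          4 * N ^ 3 * (N ^ 4 * η ^ 2 + 4 * N ^ 3 * η + 2 * N ^ 3 * η) := by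
          have : N ^ 2 ≤ N ^ 3 := pow_le_pow_right₀ hN1 (by norm_num)
          gcongr
        have b3 : 2 * (N : ℝ) ^ 2 * (n ^ 2 * η + 4 * N ^ 3 * η + 2 * N ^ 2) ≤
          2 * N ^ 2 * (N ^ 4 * η + 4 * N ^ 4 * η + 2 * (N ^ 3 * 1)) := by
          have e1 : (N : ℝ) ^ 3 ≤ N ^ 4 := pow_le_pow_right₀ hN1 (by norm_num)
          have e2 : (N : ℝ) ^ 2 ≤ N ^ 3 * 1 := by
            rw [mul_one]; exact pow_le_pow_right₀ hN1 (by norm_num)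
          gcongr
        nlinarith
    _ ≤ (n ^ 2 * θ) ^ 2 + (N ^ 4 * (4 * N ^ 3 * κ ^ 2 + 2 * N ^ 2 * (N * κ ^ 2))
        + 4 * N ^ 3 * (N ^ 4 * κ ^ 2 + 4 * N ^ 3 * (N * κ ^ 2) + 2 * N ^ 3 * (N * κ ^ 2))
        + 2 * N ^ 2 * (N ^ 4 * (N * κ ^ 2) + 4 * N ^ 4 * (N * κ ^ 2)
          + 2 * (N ^ 3 * (N ^ 2 * κ ^ 2)))) := by gcongr
    _ = (n ^ 2 * θ) ^ 2 + 48 * N ^ 7 * κ ^ 2 := by ring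

/-- If rows and columns of a random matrix are weakly correlated, then the sum over its proper
four-cycles is rarely much larger than its mean. -/
theorem measure_fourSum_ge_le (hm : Measurable (Function.uncurry h)) (hb : ∀ r t, ‖h r t‖ ≤ 1)
    {η κ : ℝ} (hφ : ∀ r, ∫ r', ‖rowCorr ν h r r'‖ ^ 2 ∂μ ≤ η)
    (hψ : ∀ t, ∫ t', ‖rowCorr μ (fun t r => h r t) t t'‖ ^ 2 ∂ν ≤ η)
    (hηκ : η ≤ κ) (hN : 1 ≤ N * κ) :
    ((Measure.pi fun _ : Fin N => ν).prod (Measure.pi fun _ : Fin N => μ))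
      {z | 2 * N ^ 4 * κ ≤ fourSum (cycleKernel h) z.2 z.1} ≤ ENNReal.ofReal (48 / N) := by
  set g := cycleKernel h with hg
  set h' : β → α → ℂ := fun t r => h r t with hh'
  have hm' : Measurable (Function.uncurry h') := hm.comp measurable_swap
  have hb' : ∀ t r, ‖h' t r‖ ≤ 1 := fun t r => hb r t
  have hgm := measurable_cycleKernel hm
  have hgb := abs_cycleKernel_le hb
  have hsw : ∀ r r' t t', g r r' t t' = cycleKernel h' t t' r r' := fun r r' t t' =>
    (cycleKernel_swap h r r' t t').symm
  have hF1 : ∀ t t', ∫ r, ∫ r', g r r' t t' ∂μ ∂μ = ‖rowCorr μ h' t t'‖ ^ 2 := fun t t' => by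
    simp_rw [hsw]; exact integral_integral_cycleKernel hm' hb' t t'
  have hF2 : ∀ r t t', (∫ r', g r r' t t' ∂μ) ^ 2 ≤ ‖rowCorr μ h' t t'‖ ^ 2 := fun r t t' => by
    simp_rw [hsw]; exact sq_integral_cycleKernel_le hm' hb' t t' r
  have hI : ∫ p : α × α, ‖rowCorr ν h p.1 p.2‖ ^ 2 ∂(μ.prod μ) ≤ η := integral_rowCorr_sq_le hm hb hφ
  have hJ : ∫ p : β × β, ‖rowCorr μ h' p.1 p.2‖ ^ 2 ∂(ν.prod ν) ≤ η :=
    integral_rowCorr_sq_le hm' hb' hψ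
  have hJ2 : ∫ t, ∫ t', ‖rowCorr μ h' t t'‖ ^ 2 ∂ν ∂ν ≤ η := by
    rwa [integral_prod _ (integrable_rowCorr_sq hm' hb')] at hJ
  have hJ0 : 0 ≤ ∫ t, ∫ t', ‖rowCorr μ h' t t'‖ ^ 2 ∂ν ∂ν :=
    integral_nonneg fun _ => integral_nonneg fun _ => sq_nonneg _
  have hJi : ∀ t, Integrable (fun t' => ‖rowCorr μ h' t t'‖ ^ 2) ν :=
    integrable_rowCorr_sq_right hm' hb'
  have hJi2 : Integrable (fun t => ∫ t', ‖rowCorr μ h' t t'‖ ^ 2 ∂ν) ν :=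
    (integrable_rowCorr_sq hm' hb').integral_prod_left
  have hF₂m : ∀ r, Measurable fun p : β × β => ∫ r', g r r' p.1 p.2 ∂μ := fun r =>
    measurable_integral_right (f := fun (p : β × β) r' => g r r' p.1 p.2)
      (measurable_kernel hgm (by fun_prop) (by fun_prop) (by fun_prop) (by fun_prop))
  have ha₁ : ∫ t, (∫ t', ∫ r, ∫ r', g r r' t t' ∂μ ∂μ ∂ν) ^ 2 ∂ν ≤ η ^ 2 := by
    simp_rw [hF1]; exact integral_sq_integral_rowCorr_sq_le hψ
  have ha₂ : ∫ t, ∫ t', (∫ r, ∫ r', g r r' t t' ∂μ ∂μ) ^ 2 ∂ν ∂ν ≤ η := by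
    simp_rw [hF1]
    refine le_trans ?_ hJ2
    refine integral_mono_of_nonneg (ae_of_all _ fun r => integral_nonneg fun _ => sq_nonneg _)
      hJi2 (ae_of_all _ fun t => ?_)
    exact integral_mono_of_nonneg (ae_of_all _ fun r => sq_nonneg _) (hJi t)
      (ae_of_all _ fun t' => sq_sq_norm_rowCorr_le hb' t t')
  have hb₂ : ∀ r, ∫ t, ∫ t', (∫ r', g r r' t t' ∂μ) ^ 2 ∂ν ∂ν ≤ η := by
    intro r
    refine le_trans ?_ hJ2
    refine integral_mono_of_nonneg (ae_of_all _ fun r => integral_nonneg fun _ => sq_nonneg _)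
      hJi2 (ae_of_all _ fun t => ?_)
    exact integral_mono_of_nonneg (ae_of_all _ fun r => sq_nonneg _) (hJi t)
      (ae_of_all _ fun t' => hF2 r t t')
  have hb₁ : ∀ r, ∫ t, (∫ t', ∫ r', g r r' t t' ∂μ ∂ν) ^ 2 ∂ν ≤ η := by
    intro r
    refine le_trans (integral_mono_of_nonneg (ae_of_all _ fun r => sq_nonneg _) hJi2
      (ae_of_all _ fun t => ?_)) hJ2
    refine (sq_integral_le ((hF₂m r).comp measurable_prodMk_left)
      (fun t' => abs_integral_le_of_abs_le fun r' => hgb r r' t t')).trans ?_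
    exact integral_mono_of_nonneg (ae_of_all _ fun r => sq_nonneg _) (hJi t)
      (ae_of_all _ fun t' => hF2 r t t')
  -- Integrating both columns first gives the squared correlation of the fixed row r with r'. The
  -- hypothesis is uniform in r, which gives the full power η² that the terms with the largest count
  -- require.
  have hb₀ : ∀ r, (∫ t, ∫ t', ∫ r', g r r' t t' ∂μ ∂ν ∂ν) ^ 2 ≤ η ^ 2 := by
    intro r
    have e : ∫ t, ∫ t', ∫ r', g r r' t t' ∂μ ∂ν ∂ν = ∫ r', ‖rowCorr ν h r r'‖ ^ 2 ∂μ := by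
      refine (integral_integral_integral_rotate (f := fun t t' r' => g r r' t t')
        (measurable_kernel hgm (by fun_prop) (by fun_prop) (by fun_prop) (by fun_prop))
        fun t t' r' => hgb r r' t t').trans ?_
      exact integral_congr_ae (ae_of_all _ fun r' => integral_integral_cycleKernel hm hb r r')
    rw [e]
    exact pow_le_pow_left₀ (integral_nonneg fun _ => sq_nonneg _) (hφ r) 2
  have hc₀ : ∫ p : α × α, (∫ t, ∫ t', g p.1 p.2 t t' ∂ν ∂ν) ^ 2 ∂(μ.prod μ) ≤ η := by
    simp_rw [hg, integral_integral_cycleKernel hm hb]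
    exact (integral_mono_of_nonneg (ae_of_all _ fun r => sq_nonneg _) (integrable_rowCorr_sq hm hb)
      (ae_of_all _ fun p => sq_sq_norm_rowCorr_le hb _ _)).trans hI
  have hc₁ : ∫ p : α × α, ∫ t, (∫ t', g p.1 p.2 t t' ∂ν) ^ 2 ∂ν ∂(μ.prod μ) ≤ η := by
    refine (integral_mono_of_nonneg (ae_of_all _ fun r => integral_nonneg fun _ => sq_nonneg _)
      (integrable_rowCorr_sq hm hb) (ae_of_all _ fun p => ?_)).trans hI
    refine (integral_mono_of_nonneg (ae_of_all _ fun r => sq_nonneg _)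
      (integrable_const (‖rowCorr ν h p.1 p.2‖ ^ 2))
      (ae_of_all _ fun t => sq_integral_cycleKernel_le hm hb p.1 p.2 t)).trans ?_
    simp
  have hsq := integral_fourSum_sq_le (N := N) hgm hgb (cycleKernel_symm_left h)
    (cycleKernel_symm_right h) ha₁ ha₂ hb₀ hb₁ hb₂ hc₀ hc₁
  have hmean := integral_fourSum (μ := μ) (ν := ν) (N := N) hgm hgb
  rw [← hg] at hsq hmean
  simp_rw [hF1] at hsq hmean
  set θ := ∫ t, ∫ t', ‖rowCorr μ h' t t'‖ ^ 2 ∂ν ∂ν with hθ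
  -- pass to the product measure
  have hSm : Measurable fun z : (Fin N → β) × (Fin N → α) => fourSum g z.2 z.1 :=
    measurable_fourSum hgm
  have hSb : ∀ z : (Fin N → β) × (Fin N → α), |fourSum g z.2 z.1| ≤ N ^ 2 * (N ^ 2 * 1) := fun z =>
    abs_offDiagSum_le (fun r r' => abs_offDiagSum_le (hgb r r') z.1) z.2
  rw [← integral_prod (fun z : (Fin N → β) × (Fin N → α) => fourSum g z.2 z.1)
    (integrable_of_abs_le hSm hSb)] at hmean
  rw [← integral_prod (fun z : (Fin N → β) × (Fin N → α) => fourSum g z.2 z.1 ^ 2)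
    (integrable_of_abs_le (C := (N ^ 2 * (N ^ 2 * 1)) ^ 2) (hSm.pow_const 2) fun z => by
      rw [abs_pow]; exact pow_le_pow_left₀ (abs_nonneg _) (hSb z) 2)] at hsq
  have hη0 : 0 ≤ η := hJ0.trans hJ2
  have hN0 : (0 : ℝ) < N := by
    rcases Nat.eq_zero_or_pos N with h0 | h0
    · rw [h0] at hN; norm_num at hN
    · exact_mod_cast h0
  have hN1 : (1 : ℝ) ≤ N := by exact_mod_cast hN0
  have hκ : 0 < κ := by
    by_contra hc
    nlinarith
  set n : ℝ := N * (N - 1) with hn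
  have hn0 : 0 ≤ n := mul_nonneg hN0.le (by linarith)
  have hn2 : n ≤ N ^ 2 := by rw [hn]; nlinarith
  have hn4 : n ^ 2 ≤ N ^ 4 := by
    calc n ^ 2 ≤ (N ^ 2) ^ 2 := pow_le_pow_left₀ hn0 hn2 2
      _ = _ := by ring
  have hV : ∫ z : (Fin N → β) × (Fin N → α), fourSum g z.2 z.1 ^ 2
      ∂((Measure.pi fun _ : Fin N => ν).prod (Measure.pi fun _ : Fin N => μ)) ≤
      (n ^ 2 * θ) ^ 2 + 48 * N ^ 7 * κ ^ 2 := by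
    refine hsq.trans ?_
    exact cycle_moment_bound hN1 hn0 hn2 hη0 hηκ hN
  -- The mean is at most N⁴κ, so half of the threshold 2N⁴κ is available as the deviation in
  -- Chebyshev's inequality.
  have hc : (0 : ℝ) < N ^ 4 * κ := by positivity
  have hfin := measure_ge_le_of_integral_sq hSm hSb hmean hV hc
  have e : 48 * (N : ℝ) ^ 7 * κ ^ 2 / (N ^ 4 * κ) ^ 2 = 48 / N := by
    field_simp
  rw [e] at hfin
  refine (measure_mono fun z hz => ?_).trans hfin
  simp only [Set.mem_ofPred_eq] at hz ⊢
  refine le_trans ?_ hz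
  have : n ^ 2 * θ ≤ N ^ 4 * κ := by
    have := hJ2.trans hηκ
    gcongr
  linarith

end FourCycle

/-! ### An oscillatory integral -/

/-- The first derivative test for an oscillatory integral with amplitude `w` and phase `F`. -/
theorem norm_integral_exp_le {F F' F'' w w' : ℝ → ℝ} {D Λ m W W' K : ℝ}
    (hF : ∀ y, HasDerivAt F (F' y) y) (hF' : ∀ y, HasDerivAt F' (F'' y) y)
    (hw : ∀ y, HasDerivAt w (w' y) y) (hF''c : Continuous F'') (hw'c : Continuous w')
    (hD : 0 ≤ D) (hΛ : 0 < Λ) (hm : 0 < m)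
    (hbm : ∀ y ∈ Set.Icc 0 D, m ≤ |F' y|) (hbW : ∀ y ∈ Set.Icc 0 D, |w y| ≤ W)
    (hbW' : ∀ y ∈ Set.Icc 0 D, |w' y| ≤ W') (hbK : ∀ y ∈ Set.Icc 0 D, |F'' y| ≤ K) :
    ‖∫ y in (0 : ℝ)..D, (w y : ℂ) * Complex.exp (-Complex.I * ((Λ * F y : ℝ) : ℂ))‖ ≤
      (2 * (W / m) + D * (W' / m + W * K / m ^ 2)) / Λ := by
  have hIcc : Set.uIcc 0 D = Set.Icc 0 D := Set.uIcc_of_le hD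
  have hne : ∀ y ∈ Set.Icc 0 D, F' y ≠ 0 := fun y hy h0 => by
    have := hbm y hy; rw [h0, abs_zero] at this; linarith
  -- Integration by parts: the integrand equals u v' divided by −iΛ, and dividing by F' is
  -- legitimate because |F'| ≥ m on the segment.
  set u : ℝ → ℂ := fun y => ((w y / F' y : ℝ) : ℂ) with hu
  set u' : ℝ → ℂ := fun y => (((w' y * F' y - w y * F'' y) / F' y ^ 2 : ℝ) : ℂ) with hu'
  set v : ℝ → ℂ := fun y => Complex.exp (-Complex.I * ((Λ * F y : ℝ) : ℂ)) with hv
  set v' : ℝ → ℂ := fun y => v y * (-Complex.I * ((Λ * F' y : ℝ) : ℂ)) with hv'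
  have hFc : Continuous F := continuous_iff_continuousAt.2 fun y => (hF y).continuousAt
  have hF'c : Continuous F' := continuous_iff_continuousAt.2 fun y => (hF' y).continuousAt
  have hwc : Continuous w := continuous_iff_continuousAt.2 fun y => (hw y).continuousAt
  have hud : ∀ y ∈ Set.uIcc 0 D, HasDerivAt u (u' y) y := fun y hy =>
    ((hw y).div (hF' y) (hne y (hIcc ▸ hy))).ofReal_comp
  have hvd : ∀ y ∈ Set.uIcc 0 D, HasDerivAt v (v' y) y := fun y _ =>
    ((((hF y).const_mul Λ).ofReal_comp).const_mul (-Complex.I)).cexp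
  have hvc : Continuous v := by fun_prop
  have hv'c : Continuous v' := by fun_prop
  have hu'c : ContinuousOn u' (Set.uIcc 0 D) := by
    refine Complex.continuous_ofReal.comp_continuousOn (ContinuousOn.div (by fun_prop)
      (by fun_prop) fun y hy => pow_ne_zero 2 (hne y (hIcc ▸ hy)))
  have hparts := intervalIntegral.integral_mul_deriv_eq_deriv_mul hud hvd
    hu'c.intervalIntegrable hv'c.continuousOn.intervalIntegrable
  have hvn : ∀ y, ‖v y‖ = 1 := fun y => by
    have : -Complex.I * ((Λ * F y : ℝ) : ℂ) = ((-(Λ * F y) : ℝ) : ℂ) * Complex.I := by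
      push_cast; ring
    simp only [hv, this, Complex.norm_exp_ofReal_mul_I]
  have hun : ∀ y ∈ Set.Icc 0 D, ‖u y‖ ≤ W / m := fun y hy => by
    rw [hu, Complex.norm_real, Real.norm_eq_abs, abs_div]
    exact div_le_div₀ ((abs_nonneg _).trans (hbW y hy)) (hbW y hy) hm (hbm y hy)
  have hun' : ∀ y ∈ Set.Icc 0 D, ‖u' y‖ ≤ W' / m + W * K / m ^ 2 := fun y hy => by
    have e : (w' y * F' y - w y * F'' y) / F' y ^ 2 = w' y / F' y - w y * F'' y / F' y ^ 2 := by
      have := hne y hy; field_simp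
    rw [hu', Complex.norm_real, Real.norm_eq_abs, e]
    refine (abs_sub _ _).trans ?_
    rw [abs_div, abs_div, abs_mul, abs_pow]
    have h1 := hbm y hy
    have h2 := hbW y hy
    have h3 := hbK y hy
    have h4 := hbW' y hy
    have h5 := (abs_nonneg _).trans h2
    have h6 := (abs_nonneg _).trans h4
    have h7 := (abs_nonneg _).trans h3
    gcongr
  have hI : ∫ y in (0 : ℝ)..D, u y * v' y = (-Complex.I * (Λ : ℂ)) *
      ∫ y in (0 : ℝ)..D, (w y : ℂ) * v y := by
    rw [← intervalIntegral.integral_const_mul]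
    refine intervalIntegral.integral_congr fun y hy => ?_
    have h0 : (F' y : ℂ) ≠ 0 := Complex.ofReal_ne_zero.2 (hne y (hIcc ▸ hy))
    simp only [hu, hv']
    push_cast
    field_simp
  have hrhs : ‖u D * v D - u 0 * v 0 - ∫ y in (0 : ℝ)..D, u' y * v y‖ ≤
      2 * (W / m) + D * (W' / m + W * K / m ^ 2) := by
    have h1 : ‖u D * v D‖ ≤ W / m := by
      rw [norm_mul, hvn, mul_one]; exact hun D ⟨hD, le_rfl⟩
    have h2 : ‖u 0 * v 0‖ ≤ W / m := by
      rw [norm_mul, hvn, mul_one]; exact hun 0 ⟨le_rfl, hD⟩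
    have h3 : ‖∫ y in (0 : ℝ)..D, u' y * v y‖ ≤ (W' / m + W * K / m ^ 2) * |D - 0| := by
      refine intervalIntegral.norm_integral_le_of_norm_le_const fun y hy => ?_
      rw [norm_mul, hvn, mul_one]
      rw [Set.uIoc_of_le hD] at hy
      exact hun' y ⟨hy.1.le, hy.2⟩
    rw [sub_zero, abs_of_nonneg hD] at h3
    calc _ ≤ ‖u D * v D‖ + ‖u 0 * v 0‖ + ‖∫ y in (0 : ℝ)..D, u' y * v y‖ :=
          (norm_sub_le _ _).trans (add_le_add_left (norm_sub_le _ _) _)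
      _ ≤ _ := by linarith
  rw [← hparts, hI, norm_mul, norm_mul, norm_neg, Complex.norm_I, one_mul, Complex.norm_real,
    Real.norm_eq_abs, abs_of_pos hΛ] at hrhs
  rw [le_div_iff₀ hΛ, mul_comm]
  exact hrhs

/-! ### The phase difference of two paths to the same point -/

/-- The distance at horizontal offset `a` and vertical offset `z`. -/
noncomputable def hyp (a z : ℝ) : ℝ := Real.sqrt (a ^ 2 + z ^ 2)

section Hyp

variable {a L : ℝ}

theorem hyp_sq (a z : ℝ) : hyp a z ^ 2 = a ^ 2 + z ^ 2 := Real.sq_sqrt (by positivity)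

theorem hyp_pos (ha : 0 < a) (z : ℝ) : 0 < hyp a z := Real.sqrt_pos.2 (by positivity)

theorem le_hyp (a z : ℝ) : a ≤ hyp a z :=
  Real.le_sqrt_of_sq_le (by nlinarith [sq_nonneg z])

theorem hyp_le (ha0 : 0 ≤ a) (hL : 0 < L) (haL : a ≤ 3 * L / 2) {z : ℝ} (hz : |z| ≤ L / 2) :
    hyp a z ≤ 2 * L := by
  refine Real.sqrt_le_iff.2 ⟨by linarith, ?_⟩
  have h1 : z ^ 2 ≤ (L / 2) ^ 2 := sq_le_sq' (abs_le.1 hz).1 (abs_le.1 hz).2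
  nlinarith

theorem abs_le_hyp (a z : ℝ) : |z| ≤ hyp a z := by
  refine Real.le_sqrt_of_sq_le ?_
  rw [sq_abs]; nlinarith [sq_nonneg a]

theorem hasDerivAt_hyp (ha : 0 < a) (q y : ℝ) :
    HasDerivAt (fun y => hyp a (y - q)) ((y - q) / hyp a (y - q)) y := by
  have h1 : HasDerivAt (fun y => a ^ 2 + (y - q) ^ 2) (2 * (y - q)) y := by
    have := (((hasDerivAt_id y).sub_const q).pow 2).const_add (a ^ 2)
    simpa using this
  have h2 := h1.sqrt (by positivity)
  refine h2.congr_deriv ?_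
  unfold hyp
  rw [mul_div_mul_left _ _ two_ne_zero]

theorem hasDerivAt_slope (ha : 0 < a) (q y : ℝ) :
    HasDerivAt (fun y => (y - q) / hyp a (y - q)) (a ^ 2 / hyp a (y - q) ^ 3) y := by
  have h := ((hasDerivAt_id y).sub_const q).div (hasDerivAt_hyp ha q y) (hyp_pos ha _).ne'
  refine h.congr_deriv ?_
  have h0 := (hyp_pos ha (y - q)).ne'
  have h2 := hyp_sq a (y - q)
  simp only [id]
  field_simp
  linear_combination h2

theorem hasDerivAt_curvature (ha : 0 < a) (z : ℝ) :
    HasDerivAt (fun z => a ^ 2 / hyp a z ^ 3) (-3 * a ^ 2 * z / hyp a z ^ 5) z := by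
  have h0 := hasDerivAt_hyp ha 0 z
  simp only [sub_zero] at h0
  have h := (hasDerivAt_const z (a ^ 2)).div (h0.pow 3) (pow_ne_zero 3 (hyp_pos ha _).ne')
  refine h.congr_deriv ?_
  have h0 := (hyp_pos ha z).ne'
  simp only [Pi.pow_apply]
  field_simp
  ring

theorem hasDerivAt_inv_hyp (ha : 0 < a) (q y : ℝ) :
    HasDerivAt (fun y => (hyp a (y - q))⁻¹) (-((y - q) / hyp a (y - q) ^ 3)) y := by
  have h := (hasDerivAt_hyp ha q y).inv (hyp_pos ha _).ne'
  refine h.congr_deriv ?_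
  have h0 := (hyp_pos ha (y - q)).ne'
  field_simp

theorem continuous_hyp (a q : ℝ) : Continuous fun y => hyp a (y - q) := by
  unfold hyp; fun_prop

theorem hasDerivAt_slope_zero (ha : 0 < a) (z : ℝ) :
    HasDerivAt (fun z => z / hyp a z) (a ^ 2 / hyp a z ^ 3) z := by
  simpa using hasDerivAt_slope ha 0 z

/-- Mean value theorem: the slope z/√(a² + z²) has derivative a²/hyp³ ≥ (L/2)²/(2L)³ = 1/(32L).
Hence the path difference of two sources has no stationary point. -/
theorem slope_sub_ge (hL : 0 < L) (h1 : L / 2 ≤ a) (h2 : a ≤ 3 * L / 2) {z₁ z₂ : ℝ}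
    (hz₁ : |z₁| ≤ L / 2) (hz₂ : |z₂| ≤ L / 2) :
    |z₁ - z₂| / (32 * L) ≤ |z₁ / hyp a z₁ - z₂ / hyp a z₂| := by
  have ha : 0 < a := by linarith
  wlog h : z₂ < z₁ generalizing z₁ z₂
  · rcases eq_or_lt_of_le (not_lt.1 h) with h | h
    · simp [h]
    · rw [abs_sub_comm, abs_sub_comm (z₁ / _)]
      exact this hz₂ hz₁ h
  obtain ⟨c, hc, hc'⟩ := exists_hasDerivAt_eq_slope (fun z => z / hyp a z) _ h
    (HasDerivAt.continuousOn fun z _ => hasDerivAt_slope_zero ha z)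
    (fun z _ => hasDerivAt_slope_zero ha z)
  have hcz : |c| ≤ L / 2 := abs_le.2 ⟨by linarith [hc.1, (abs_le.1 hz₂).1],
    by linarith [hc.2, (abs_le.1 hz₁).2]⟩
  have hcl : 1 / (32 * L) ≤ a ^ 2 / hyp a c ^ 3 := by
    have hp := hyp_pos ha c
    have hb := hyp_le ha.le hL h2 hcz
    rw [div_le_div_iff₀ (by positivity) (by positivity)]
    have e1 : hyp a c ^ 3 ≤ (2 * L) ^ 3 := pow_le_pow_left₀ hp.le hb 3
    have e2 : (L / 2) ^ 2 ≤ a ^ 2 := pow_le_pow_left₀ (by linarith) h1 2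
    nlinarith
  have hpos : 0 < z₁ - z₂ := sub_pos.2 h
  rw [abs_of_pos hpos]
  refine le_trans ?_ (le_abs_self _)
  rw [hc', le_div_iff₀ hpos] at hcl
  calc (z₁ - z₂) / (32 * L) = 1 / (32 * L) * (z₁ - z₂) := by ring
    _ ≤ _ := hcl

/-- A curvature bound without the factor |z₁ − z₂| would not suffice: the first derivative test
divides by the square of a slope proportional to it, and the decay has to stay of first order. -/
theorem curvature_sub_le (hL : 0 < L) (h1 : L / 2 ≤ a) (z₁ z₂ : ℝ)  :
    |a ^ 2 / hyp a z₁ ^ 3 - a ^ 2 / hyp a z₂ ^ 3| ≤ 12 * |z₁ - z₂| / L ^ 2 := by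
  have ha : 0 < a := by linarith
  have hbd : ∀ z, |-3 * a ^ 2 * z / hyp a z ^ 5| ≤ 12 / L ^ 2 := by
    intro z
    have hp := hyp_pos ha z
    have e1 : L / 2 ≤ hyp a z := h1.trans (le_hyp a z)
    have e2 : a ^ 2 ≤ hyp a z ^ 2 := by rw [hyp_sq]; nlinarith [sq_nonneg z]
    have e3 : |z| ≤ hyp a z := abs_le_hyp a z
    have e4 : (L / 2) ^ 2 ≤ hyp a z ^ 2 := pow_le_pow_left₀ (by linarith) e1 2
    rw [abs_div, abs_mul, abs_mul, abs_of_pos (pow_pos hp 5), abs_of_nonneg (sq_nonneg a),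
      div_le_div_iff₀ (by positivity) (by positivity)]
    norm_num
    calc 3 * a ^ 2 * |z| * L ^ 2 = 12 * (a ^ 2 * |z| * (L / 2) ^ 2) := by ring
      _ ≤ 12 * (hyp a z ^ 2 * hyp a z * hyp a z ^ 2) := by gcongr
      _ = 12 * hyp a z ^ 5 := by ring
  have := Convex.norm_image_sub_le_of_norm_hasDerivWithin_le (s := Set.univ)
    (f := fun z => a ^ 2 / hyp a z ^ 3) (C := 12 / L ^ 2)
    (fun z _ => (hasDerivAt_curvature ha z).hasDerivWithinAt)
    (fun z _ => hbd z) convex_univ (Set.mem_univ z₂) (Set.mem_univ z₁)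
  simp only [Real.norm_eq_abs] at this
  exact this.trans_eq (by ring)

/-- The correlation of two waves along a vertical segment decays like the inverse of the
distance of their sources. -/
theorem norm_integral_hyp_le {D Λ : ℝ} (hL : 0 < L) (hD : 0 ≤ D) (hDL : D ≤ L / 2) (hΛ : 0 < Λ)
    (h1 : L / 2 ≤ a) (h2 : a ≤ 3 * L / 2) {q₁ q₂ : ℝ} (hq₁ : q₁ ∈ Set.Icc 0 D)
    (hq₂ : q₂ ∈ Set.Icc 0 D) (hq : q₁ ≠ q₂) :
    ‖∫ y in (0 : ℝ)..D, (((hyp a (y - q₁))⁻¹ * (hyp a (y - q₂))⁻¹ : ℝ) : ℂ) *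
      Complex.exp (-Complex.I * ((Λ * (hyp a (y - q₁) - hyp a (y - q₂)) : ℝ) : ℂ))‖ ≤
      25088 / (L * |q₁ - q₂|) / Λ := by
  have ha : 0 < a := by linarith
  set Δ := |q₁ - q₂| with hΔ
  have hΔ0 : 0 < Δ := abs_pos.2 (sub_ne_zero.2 hq)
  have hmem : ∀ {q y : ℝ}, q ∈ Set.Icc 0 D → y ∈ Set.Icc 0 D → |y - q| ≤ L / 2 := fun hq hy =>
    abs_le.2 ⟨by linarith [hq.2, hy.1], by linarith [hq.1, hy.2]⟩
  have hinv : ∀ z, (hyp a z)⁻¹ ≤ 2 / L := fun z => by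
    rw [inv_le_comm₀ (hyp_pos ha z) (by positivity), inv_div]
    exact h1.trans (le_hyp a z)
  have hinv0 : ∀ z, 0 ≤ (hyp a z)⁻¹ := fun z => (inv_pos.2 (hyp_pos ha z)).le
  have hdinv : ∀ z, |z / hyp a z ^ 3| ≤ 4 / L ^ 2 := fun z => by
    have hp := hyp_pos ha z
    have e : |z / hyp a z ^ 3| = |z| * (hyp a z)⁻¹ * ((hyp a z)⁻¹ * (hyp a z)⁻¹) := by
      rw [abs_div, abs_of_pos (pow_pos hp 3)]; field_simp
    have e1 : |z| * (hyp a z)⁻¹ ≤ 1 := by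
      rw [← div_eq_mul_inv, div_le_one hp]; exact abs_le_hyp a z
    rw [e]
    calc _ ≤ 1 * (2 / L * (2 / L)) :=
          mul_le_mul e1 (mul_le_mul (hinv z) (hinv z) (hinv0 z) (by positivity))
            (mul_nonneg (hinv0 z) (hinv0 z)) zero_le_one
      _ = _ := by ring
  -- W and W' come from hyp ≥ L/2; m and K come from `slope_sub_ge` and `curvature_sub_le`. With D ≤
  -- L/2 the contributions are 256 + 256 + 24576 = 25088.
  have key := norm_integral_exp_le (D := D) (Λ := Λ) (m := Δ / (32 * L)) (W := 4 / L ^ 2)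
    (W' := 16 / L ^ 3) (K := 12 * Δ / L ^ 2)
    (F := fun y => hyp a (y - q₁) - hyp a (y - q₂))
    (w := fun y => (hyp a (y - q₁))⁻¹ * (hyp a (y - q₂))⁻¹)
    (fun y => (hasDerivAt_hyp ha q₁ y).sub (hasDerivAt_hyp ha q₂ y))
    (fun y => (hasDerivAt_slope ha q₁ y).sub (hasDerivAt_slope ha q₂ y))
    (fun y => (hasDerivAt_inv_hyp ha q₁ y).mul (hasDerivAt_inv_hyp ha q₂ y))
    (by
      have := continuous_hyp a q₁
      have := continuous_hyp a q₂
      exact (continuous_const.div (by fun_prop) fun y => pow_ne_zero 3 (hyp_pos ha _).ne').sub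
        (continuous_const.div (by fun_prop) fun y => pow_ne_zero 3 (hyp_pos ha _).ne'))
    (by
      have c1 := continuous_hyp a q₁
      have c2 := continuous_hyp a q₂
      have i1 := c1.inv₀ fun y => (hyp_pos ha _).ne'
      have i2 := c2.inv₀ fun y => (hyp_pos ha _).ne'
      have j1 : Continuous fun y => (y - q₁) / hyp a (y - q₁) ^ 3 :=
        (by fun_prop : Continuous fun y => y - q₁).div (by fun_prop)
          fun y => pow_ne_zero 3 (hyp_pos ha _).ne'
      have j2 : Continuous fun y => (y - q₂) / hyp a (y - q₂) ^ 3 :=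
        (by fun_prop : Continuous fun y => y - q₂).div (by fun_prop)
          fun y => pow_ne_zero 3 (hyp_pos ha _).ne'
      exact (j1.neg.mul i2).add (i1.mul j2.neg))
    hD hΛ (by positivity)
    (fun y hy => by
      have := slope_sub_ge hL h1 h2 (hmem hq₁ hy) (hmem hq₂ hy)
      rwa [sub_sub_sub_cancel_left, abs_sub_comm q₂ q₁] at this)
    (fun y hy => by
      rw [abs_mul, abs_of_nonneg (hinv0 _), abs_of_nonneg (hinv0 _)]
      calc _ ≤ 2 / L * (2 / L) := mul_le_mul (hinv _) (hinv _) (hinv0 _) (by positivity)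
        _ = _ := by ring)
    (fun y hy => by
      refine (abs_add_le _ _).trans ?_
      rw [abs_mul, abs_mul, abs_neg, abs_neg, abs_of_nonneg (hinv0 _), abs_of_nonneg (hinv0 _)]
      calc _ ≤ 4 / L ^ 2 * (2 / L) + 2 / L * (4 / L ^ 2) :=
            add_le_add (mul_le_mul (hdinv _) (hinv _) (hinv0 _) (by positivity))
              (mul_le_mul (hinv _) (hdinv _) (abs_nonneg _) (by positivity))
        _ = _ := by ring)
    (fun y hy => by
      have := curvature_sub_le hL h1 (y - q₁) (y - q₂)
      rwa [sub_sub_sub_cancel_left, abs_sub_comm q₂ q₁] at this)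
  refine key.trans (div_le_div_of_nonneg_right ?_ hΛ.le)
  calc 2 * (4 / L ^ 2 / (Δ / (32 * L))) + D * (16 / L ^ 3 / (Δ / (32 * L)) +
        4 / L ^ 2 * (12 * Δ / L ^ 2) / (Δ / (32 * L)) ^ 2)
      ≤ 2 * (4 / L ^ 2 / (Δ / (32 * L))) + L / 2 * (16 / L ^ 3 / (Δ / (32 * L)) +
        4 / L ^ 2 * (12 * Δ / L ^ 2) / (Δ / (32 * L)) ^ 2) := by gcongr
    _ = 25088 / (L * Δ) := by
      field_simp
      norm_num

end Hyp

/-! ### Correlations on product spaces -/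

section Product

variable {γ δ : Type*} [MeasurableSpace γ] [MeasurableSpace δ]

theorem sq_norm_integral_le {μ : Measure γ} [IsProbabilityMeasure μ] {f : γ → ℂ}
    (hf : Measurable f) (hb : ∀ x, ‖f x‖ ≤ 1) : ‖∫ x, f x ∂μ‖ ^ 2 ≤ ∫ x, ‖f x‖ ^ 2 ∂μ :=
  (pow_le_pow_left₀ (norm_nonneg _) (norm_integral_le_integral_norm f) 2).trans
    (sq_integral_le hf.norm fun x => by rw [abs_norm]; exact hb x)

/-- Expanding the square and exchanging the order of integration. -/
theorem integral_sq_norm_integral_le {Q : Measure γ} [IsProbabilityMeasure Q] {V : Measure δ}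
    [IsProbabilityMeasure V] {f : γ → ℂ} {k : δ → γ → ℂ} (hf : Measurable f)
    (hk : Measurable (Function.uncurry k)) (hfb : ∀ q, ‖f q‖ ≤ 1) (hkb : ∀ y q, ‖k y q‖ ≤ 1) :
    ∫ y, ‖∫ q, f q * star (k y q) ∂Q‖ ^ 2 ∂V ≤
      ∫ q₁, ∫ q₂, ‖∫ y, k y q₁ * star (k y q₂) ∂V‖ ∂Q ∂Q := by
  set Z : δ → γ × γ → ℂ := fun y p => (f p.1 * star (k y p.1)) * star (f p.2 * star (k y p.2))
    with hZ
  have hgm : Measurable fun z : δ × γ => f z.2 * star (k z.1 z.2) :=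
    (hf.comp measurable_snd).mul (measurable_star_complex.comp hk)
  have hgb : ∀ y q, ‖f q * star (k y q)‖ ≤ 1 := fun y q => by
    rw [norm_mul, norm_star]; exact mul_le_one₀ (hfb q) (norm_nonneg _) (hkb y q)
  have hZm : Measurable (Function.uncurry Z) := by
    have m1 : Measurable fun z : δ × γ × γ => (z.1, z.2.1) := by fun_prop
    have m2 : Measurable fun z : δ × γ × γ => (z.1, z.2.2) := by fun_prop
    exact (hgm.comp m1).mul (measurable_star_complex.comp (hgm.comp m2))
  have hZb : ∀ y p, ‖Z y p‖ ≤ 1 := fun y p => by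
    rw [hZ, norm_mul, norm_star]; exact mul_le_one₀ (hgb _ _) (norm_nonneg _) (hgb _ _)
  have hZi : Integrable (Function.uncurry Z) (V.prod (Q.prod Q)) :=
    integrable_of_norm_le_one hZm fun z => hZb _ _
  have e1 : ∀ y, ‖∫ q, f q * star (k y q) ∂Q‖ ^ 2 = (∫ p, Z y p ∂(Q.prod Q)).re := fun y => by
    have h1 := integral_prod_mul (μ := Q) (ν := Q) (fun q => f q * star (k y q))
      (fun q => star (f q * star (k y q)))
    rw [integral_star (fun q => f q * star (k y q))] at h1
    refine Eq.trans ?_ (congrArg Complex.re h1.symm)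
    rw [← Complex.ofReal_re (‖∫ q, f q * star (k y q) ∂Q‖ ^ 2), Complex.ofReal_pow]
    exact congrArg _ (Complex.mul_conj' _).symm
  -- The weight f does not depend on y, so averaging over y first leaves it as a prefactor of
  -- modulus at most one, whatever its phase.
  have hkk : ∀ p : γ × γ, ∫ y, Z y p ∂V =
      (f p.1 * star (f p.2)) * star (∫ y, k y p.1 * star (k y p.2) ∂V) := fun p => by
    rw [← integral_star, ← integral_const_mul]
    refine integral_congr_ae (ae_of_all _ fun y => ?_)
    simp only [hZ, star_mul', star_star]
    ring
  have hKm : Measurable fun p : γ × γ => ∫ y, k y p.1 * star (k y p.2) ∂V := by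
    have m1 : Measurable fun z : (γ × γ) × δ => (z.2, z.1.1) := by fun_prop
    have m2 : Measurable fun z : (γ × γ) × δ => (z.2, z.1.2) := by fun_prop
    exact (((hk.comp m1).mul (measurable_star_complex.comp
      (hk.comp m2))).stronglyMeasurable.integral_prod_right (ν := V)).measurable
  have hKb : ∀ p : γ × γ, ‖∫ y, k y p.1 * star (k y p.2) ∂V‖ ≤ 1 := fun p => by
    have := norm_integral_le_of_norm_le_const (μ := V) (C := 1)
      (ae_of_all _ fun y => norm_mul_star_le (h := fun q y => k y q) (fun q y => hkb y q) p.1 p.2 y y)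
    simpa using this
  have hKi : Integrable (fun p : γ × γ => ‖∫ y, k y p.1 * star (k y p.2) ∂V‖) (Q.prod Q) :=
    (integrable_of_norm_le_one hKm hKb).norm
  simp_rw [e1]
  have e2 : ∫ y, (∫ p, Z y p ∂(Q.prod Q)).re ∂V = (∫ y, ∫ p, Z y p ∂(Q.prod Q) ∂V).re :=
    integral_re hZi.integral_prod_left
  rw [e2, integral_integral_swap hZi]
  refine (Complex.re_le_norm _).trans ((norm_integral_le_integral_norm _).trans ?_)
  rw [← integral_prod _ hKi]
  refine integral_mono_of_nonneg (ae_of_all _ fun p => norm_nonneg _) hKi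
    (ae_of_all _ fun p => ?_)
  simp only [hkk]
  rw [norm_mul, norm_star, norm_mul, norm_star]
  exact mul_le_of_le_one_left (norm_nonneg _) (mul_le_one₀ (hfb _) (norm_nonneg _) (hfb _))

variable {X Y : Type*} [MeasurableSpace X] [MeasurableSpace Y]

/-- Reduction to one dimension. For a fixed horizontal position u, Cauchy–Schwarz pulls the
horizontal average over p out of the square; the square over heights q is then expanded and y
averaged. The fixed position r drops out because its gains have modulus at most one. -/
theorem integral_rowCorr_sq_le_of_vertical {U : Measure γ} [IsProbabilityMeasure U]
    {V : Measure δ} [IsProbabilityMeasure V] {P : Measure X} [IsProbabilityMeasure P]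
    {Q : Measure Y} [IsProbabilityMeasure Q] {h : γ × δ → X × Y → ℂ}
    (hm : Measurable (Function.uncurry h)) (hb : ∀ r t, ‖h r t‖ ≤ 1) {η : ℝ}
    (hη : ∀ u p, ∫ q₁, ∫ q₂, ‖∫ y, h (u, y) (p, q₁) * star (h (u, y) (p, q₂)) ∂V‖ ∂Q ∂Q ≤ η)
    (r : γ × δ) :
    ∫ r', ‖rowCorr (P.prod Q) h r r'‖ ^ 2 ∂(U.prod V) ≤ η := by
  rw [integral_prod _ (integrable_rowCorr_sq_right hm hb r)]
  have hu : ∀ u, ∫ y, ‖rowCorr (P.prod Q) h r (u, y)‖ ^ 2 ∂V ≤ η := by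
    intro u
    set z : δ → X → ℂ := fun y p => ∫ q, h r (p, q) * star (h (u, y) (p, q)) ∂Q with hz
    have hm1 : Measurable fun w : (δ × X) × Y => h r (w.1.2, w.2) :=
      hm.comp (by fun_prop : Measurable fun w : (δ × X) × Y => (r, (w.1.2, w.2)))
    have hm2 : Measurable fun w : (δ × X) × Y => h (u, w.1.1) (w.1.2, w.2) :=
      hm.comp (by fun_prop : Measurable fun w : (δ × X) × Y => ((u, w.1.1), (w.1.2, w.2)))
    have hzm : Measurable (Function.uncurry z) :=
      ((hm1.mul (measurable_star_complex.comp hm2)).stronglyMeasurable.integral_prod_right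
        (ν := Q)).measurable
    have hzb : ∀ y p, ‖z y p‖ ≤ 1 := fun y p => by
      have := norm_integral_le_of_norm_le_const (μ := Q) (C := 1)
        (ae_of_all _ fun q => norm_mul_star_le hb r (u, y) (p, q) (p, q))
      simpa [hz] using this
    have hzi : Integrable (Function.uncurry fun y p => ‖z y p‖ ^ 2) (V.prod P) :=
      integrable_of_abs_le (C := 1) (hzm.norm.pow_const 2) fun w => by
        rw [abs_of_nonneg (sq_nonneg _)]; exact pow_le_one₀ (norm_nonneg _) (hzb _ _)
    have hrow : ∀ y, rowCorr (P.prod Q) h r (u, y) = ∫ p, z y p ∂P := fun y =>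
      integral_prod _ (integrable_of_norm_le_one (measurable_mul_star hm r (u, y))
        fun t => norm_mul_star_le hb r (u, y) t t)
    calc ∫ y, ‖rowCorr (P.prod Q) h r (u, y)‖ ^ 2 ∂V
        ≤ ∫ y, ∫ p, ‖z y p‖ ^ 2 ∂P ∂V := by
          refine integral_mono_of_nonneg (ae_of_all _ fun y => sq_nonneg _)
            hzi.integral_prod_left (ae_of_all _ fun y => ?_)
          simp only [hrow]
          exact sq_norm_integral_le (hzm.comp measurable_prodMk_left) (hzb y)
      _ = ∫ p, ∫ y, ‖z y p‖ ^ 2 ∂V ∂P := integral_integral_swap hzi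
      _ ≤ ∫ _, η ∂P := by
          refine integral_mono_of_nonneg (ae_of_all _ fun p => integral_nonneg fun y => sq_nonneg _)
            (integrable_const η) (ae_of_all _ fun p => ?_)
          refine (integral_sq_norm_integral_le (f := fun q => h r (p, q))
            (k := fun y q => h (u, y) (p, q)) ?_ ?_ (fun q => hb _ _) fun y q => hb _ _).trans
            (hη u p)
          · exact hm.comp (by fun_prop : Measurable fun q : Y => (r, (p, q)))
          · exact hm.comp (by fun_prop : Measurable fun w : δ × Y => ((u, w.1), (p, w.2)))
      _ = η := by simp
  refine (integral_mono_of_nonneg (ae_of_all _ fun u => integral_nonneg fun _ => sq_nonneg _)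
    (integrable_const η) (ae_of_all _ hu)).trans ?_
  simp

end Product

/-! ### The uniform law on a segment -/

/-- The uniform law on `[a, a + D]`. -/
noncomputable def unif (a D : ℝ) : Measure ℝ := ProbabilityTheory.cond volume (Set.Icc a (a + D))

theorem isProbabilityMeasure_unif (a : ℝ) {D : ℝ} (hD : 0 < D) :
    IsProbabilityMeasure (unif a D) :=
  cond_isProbabilityMeasure_of_finite (by simp [hD]) (by simp)

theorem ae_unif_mem (a D : ℝ) : ∀ᵐ x ∂(unif a D), x ∈ Set.Icc a (a + D) :=
  ae_cond_mem measurableSet_Icc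

theorem integral_unif {E : Type*} [NormedAddCommGroup E] [NormedSpace ℝ E] {D : ℝ} (hD : 0 < D)
    (f : ℝ → E) : ∫ x, f x ∂(unif 0 D) = D⁻¹ • ∫ x in (0 : ℝ)..D, f x := by
  unfold unif ProbabilityTheory.cond
  rw [integral_smul_measure, zero_add, Real.volume_Icc, sub_zero, ENNReal.toReal_inv,
    ENNReal.toReal_ofReal hD.le, intervalIntegral.integral_of_le hD.le, integral_Icc_eq_integral_Ioc]

theorem uniformSquare_eq_prod (a b D : ℝ) :
    uniformSquare a b D = (unif a D).prod (unif b D) := by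
  unfold uniformSquare square unif ProbabilityTheory.cond
  rw [Measure.prod_smul_left, Measure.prod_smul_right, Measure.prod_restrict, smul_smul,
    Measure.volume_eq_prod, Measure.prod_prod,
    ENNReal.mul_inv (Or.inr (by simp)) (Or.inl (by simp))]

/-- Origin of the logarithm in M: the correlation decays only like the inverse distance, whose
integral on either side of q is logarithmic. -/
theorem integral_inv_add_abs_le {ρ D q : ℝ} (hρ : 0 < ρ) (hq : q ∈ Set.Icc 0 D) :
    ∫ x in (0 : ℝ)..D, 2 * ρ / (ρ + |q - x|) ≤ 4 * ρ * Real.log (1 + D / ρ) := by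
  have hD : 0 ≤ D := hq.1.trans hq.2
  have hc : Continuous fun x => 2 * ρ / (ρ + |q - x|) :=
    continuous_const.div (by fun_prop) fun x => by have := abs_nonneg (q - x); positivity
  rw [← intervalIntegral.integral_add_adjacent_intervals (hc.intervalIntegrable 0 q)
    (hc.intervalIntegrable q D)]
  have hlog : ∀ {u : ℝ}, 0 ≤ u → u ≤ D → Real.log (ρ + u) - Real.log ρ ≤ Real.log (1 + D / ρ) := by
    intro u hu huD
    rw [← Real.log_div (by positivity) hρ.ne']
    refine Real.log_le_log (by positivity) ?_
    rw [add_div, div_self hρ.ne']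
    gcongr
  have e1 : ∫ x in (0 : ℝ)..q, 2 * ρ / (ρ + |q - x|) = 2 * ρ * (Real.log (ρ + q) - Real.log ρ) := by
    have hd : ∀ x ∈ Set.uIcc 0 q, HasDerivAt (fun x => -(2 * ρ * Real.log (ρ + (q - x))))
        (2 * ρ / (ρ + |q - x|)) x := by
      intro x hx
      rw [Set.uIcc_of_le hq.1] at hx
      have hx' : 0 ≤ q - x := sub_nonneg.2 hx.2
      rw [abs_of_nonneg hx']
      have h := ((((hasDerivAt_id x).const_sub q).const_add ρ).log
        (by simp only [id]; positivity)).const_mul (2 * ρ) |>.neg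
      refine h.congr_deriv ?_
      simp only [id]
      ring
    rw [intervalIntegral.integral_eq_sub_of_hasDerivAt hd (hc.intervalIntegrable 0 q)]
    simp
    ring
  have e2 : ∫ x in q..D, 2 * ρ / (ρ + |q - x|) = 2 * ρ * (Real.log (ρ + (D - q)) - Real.log ρ) := by
    have hd : ∀ x ∈ Set.uIcc q D, HasDerivAt (fun x => 2 * ρ * Real.log (ρ + (x - q)))
        (2 * ρ / (ρ + |q - x|)) x := by
      intro x hx
      rw [Set.uIcc_of_le hq.2] at hx
      have hx' : 0 ≤ x - q := sub_nonneg.2 hx.1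
      rw [abs_sub_comm, abs_of_nonneg hx']
      have h := ((((hasDerivAt_id x).sub_const q).const_add ρ).log
        (by simp only [id]; positivity)).const_mul (2 * ρ)
      refine h.congr_deriv ?_
      simp only [id]
      ring
    rw [intervalIntegral.integral_eq_sub_of_hasDerivAt hd (hc.intervalIntegrable q D)]
    simp
    ring
  rw [e1, e2]
  have h1 := hlog hq.1 hq.2
  have h2 := hlog (sub_nonneg.2 hq.2) (by linarith [hq.1])
  nlinarith

/-! ### The normalized channel kernel -/

/-- The channel gain at horizontal offset `a` between the heights `y` and `q`, normalized to
modulus at most one, and set to zero outside the relevant offsets. -/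
noncomputable def vertKernel (L Λ a y q : ℝ) : ℂ :=
  if L / 2 ≤ a ∧ a ≤ 3 * L / 2 then
    ((L / 2 * (hyp a (y - q))⁻¹ : ℝ) : ℂ) * Complex.exp (-Complex.I * ((Λ * hyp a (y - q) : ℝ) : ℂ))
  else 0

theorem vertKernel_symm (L Λ a y q : ℝ) : vertKernel L Λ a y q = vertKernel L Λ a q y := by
  unfold vertKernel hyp
  rw [← neg_sub q y, neg_sq]

theorem norm_exp_neg_I_mul (x : ℝ) : ‖Complex.exp (-Complex.I * (x : ℂ))‖ = 1 := by
  have : -Complex.I * (x : ℂ) = ((-x : ℝ) : ℂ) * Complex.I := by push_cast; ring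
  rw [this, Complex.norm_exp_ofReal_mul_I]

/-- Thanks to the cutoff the bound holds everywhere, so the general estimates can assume it
pointwise. -/
theorem norm_vertKernel_le {L : ℝ} (hL : 0 < L) (Λ a y q : ℝ) : ‖vertKernel L Λ a y q‖ ≤ 1 := by
  unfold vertKernel
  split_ifs with h
  · have ha : 0 < a := by linarith [h.1]
    have hp := hyp_pos ha (y - q)
    rw [norm_mul, norm_exp_neg_I_mul, mul_one, Complex.norm_real, Real.norm_eq_abs,
      abs_of_nonneg (by positivity), ← div_eq_mul_inv, div_le_one hp]
    exact h.1.trans (le_hyp a _)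
  · simp

theorem measurable_vertKernel (L Λ : ℝ) :
    Measurable fun p : ℝ × ℝ × ℝ => vertKernel L Λ p.1 p.2.1 p.2.2 := by
  unfold vertKernel
  refine Measurable.ite ?_ ?_ measurable_const
  · exact (measurableSet_le measurable_const measurable_fst).inter
      (measurableSet_le measurable_fst measurable_const)
  · have h : Measurable fun p : ℝ × ℝ × ℝ => hyp p.1 (p.2.1 - p.2.2) := by
      unfold hyp; fun_prop
    fun_prop

/-- The correlation of the gains from two heights. -/
noncomputable def vertCorr (L Λ D a q₁ q₂ : ℝ) : ℂ :=
  ∫ y, vertKernel L Λ a y q₁ * star (vertKernel L Λ a y q₂) ∂(unif 0 D)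

section

variable {L Λ D : ℝ}

theorem norm_vertCorr_le_one (hL : 0 < L) (hD : 0 < D) (a q₁ q₂ : ℝ) :
    ‖vertCorr L Λ D a q₁ q₂‖ ≤ 1 := by
  have := isProbabilityMeasure_unif 0 hD
  have h := norm_integral_le_of_norm_le_const (μ := unif 0 D) (C := 1)
    (ae_of_all _ fun y => norm_mul_star_le (h := fun q y => vertKernel L Λ a y q)
      (fun q y => norm_vertKernel_le hL Λ a y q) q₁ q₂ y y)
  simpa [vertCorr] using h

/-- One continuous majorant for two regimes: the trivial bound 1 when the heights are within ρ, and
the oscillatory decay ρ/|q₁ − q₂| beyond. The normalization contributes L²/4, whence 6272 = 25088/4.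
-/
theorem norm_vertCorr_le (hL : 0 < L) (hD : 0 < D) (hDL : 2 * D ≤ L) (hΛ : 0 < Λ) {ρ : ℝ}
    (hρ : 6272 * L / (Λ * D) ≤ ρ) (a : ℝ) {q₁ q₂ : ℝ} (hq₁ : q₁ ∈ Set.Icc 0 D)
    (hq₂ : q₂ ∈ Set.Icc 0 D) : ‖vertCorr L Λ D a q₁ q₂‖ ≤ 2 * ρ / (ρ + |q₁ - q₂|) := by
  have hρ0 : 0 < ρ := lt_of_lt_of_le (by positivity) hρ
  have hΔ0 := abs_nonneg (q₁ - q₂)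
  have hone := norm_vertCorr_le_one (Λ := Λ) hL hD a q₁ q₂
  rcases le_total (|q₁ - q₂|) ρ with hle | hge
  · refine hone.trans ?_
    rw [le_div_iff₀ (by positivity)]; linarith
  have hΔ : 0 < |q₁ - q₂| := hρ0.trans_le hge
  suffices h : ‖vertCorr L Λ D a q₁ q₂‖ ≤ ρ / |q₁ - q₂| by
    refine h.trans ?_
    rw [div_le_div_iff₀ hΔ (by positivity)]
    nlinarith
  unfold vertCorr
  rw [integral_unif hD]
  by_cases h : L / 2 ≤ a ∧ a ≤ 3 * L / 2
  swap
  · simp only [vertKernel, if_neg h, zero_mul, intervalIntegral.integral_zero, smul_zero, norm_zero]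
    positivity
  have e : ∀ y, vertKernel L Λ a y q₁ * star (vertKernel L Λ a y q₂) =
      ((L ^ 2 / 4 : ℝ) : ℂ) * ((((hyp a (y - q₁))⁻¹ * (hyp a (y - q₂))⁻¹ : ℝ) : ℂ) *
      Complex.exp (-Complex.I * ((Λ * (hyp a (y - q₁) - hyp a (y - q₂)) : ℝ) : ℂ))) := by
    intro y
    have es : star (Complex.exp (-Complex.I * ((Λ * hyp a (y - q₂) : ℝ) : ℂ))) =
        Complex.exp (Complex.I * ((Λ * hyp a (y - q₂) : ℝ) : ℂ)) := by
      change (starRingEnd ℂ) _ = _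
      rw [← Complex.exp_conj]
      congr 1
      rw [map_mul, map_neg, Complex.conj_I, neg_neg, Complex.conj_ofReal]
    have er : ∀ x : ℝ, star (x : ℂ) = x := fun x => Complex.conj_ofReal x
    have ee : Complex.exp (-Complex.I * ((Λ * (hyp a (y - q₁) - hyp a (y - q₂)) : ℝ) : ℂ)) =
        Complex.exp (-Complex.I * ((Λ * hyp a (y - q₁) : ℝ) : ℂ)) *
        Complex.exp (Complex.I * ((Λ * hyp a (y - q₂) : ℝ) : ℂ)) := by
      rw [← Complex.exp_add]; congr 1; push_cast; ring
    simp only [vertKernel, if_pos h]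
    rw [star_mul', es, er, ee]
    push_cast
    ring
  simp_rw [e]
  rw [intervalIntegral.integral_const_mul, norm_smul, norm_mul, Complex.norm_real,
    Real.norm_eq_abs, Real.norm_eq_abs, abs_of_pos (inv_pos.2 hD), abs_of_pos (by positivity)]
  have key := norm_integral_hyp_le hL hD.le (by linarith) hΛ h.1 h.2 hq₁ hq₂
    (fun hq => by rw [hq, sub_self, abs_zero] at hΔ; exact lt_irrefl _ hΔ)
  calc _ ≤ D⁻¹ * (L ^ 2 / 4 * (25088 / (L * |q₁ - q₂|) / Λ)) := by gcongr
    _ = 6272 * L / (Λ * D) / |q₁ - q₂| := by field_simp; norm_num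
    _ ≤ _ := by gcongr

theorem integral_norm_vertCorr_le (hL : 0 < L) (hD : 0 < D) (hDL : 2 * D ≤ L) (hΛ : 0 < Λ) {ρ : ℝ}
    (hρ : 6272 * L / (Λ * D) ≤ ρ) (a : ℝ) :
    ∫ q₁, ∫ q₂, ‖vertCorr L Λ D a q₁ q₂‖ ∂(unif 0 D) ∂(unif 0 D) ≤
      4 * (ρ / D) * Real.log (1 + D / ρ) := by
  have := isProbabilityMeasure_unif 0 hD
  have hρ0 : 0 < ρ := lt_of_lt_of_le (by positivity) hρ
  have hmem : ∀ᵐ q ∂(unif 0 D), q ∈ Set.Icc 0 D := by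
    filter_upwards [ae_unif_mem 0 D] with q hq; rwa [zero_add] at hq
  have hinner : ∀ᵐ q₁ ∂(unif 0 D), ∫ q₂, ‖vertCorr L Λ D a q₁ q₂‖ ∂(unif 0 D) ≤
      4 * (ρ / D) * Real.log (1 + D / ρ) := by
    filter_upwards [hmem] with q₁ hq₁
    have hc : Continuous fun x => 2 * ρ / (ρ + |q₁ - x|) :=
      continuous_const.div (by fun_prop) fun x => by have := abs_nonneg (q₁ - x); positivity
    have hi : Integrable (fun x => 2 * ρ / (ρ + |q₁ - x|)) (unif 0 D) :=
      integrable_of_abs_le (C := 2) hc.measurable fun x => by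
        have := abs_nonneg (q₁ - x)
        rw [abs_of_nonneg (by positivity), div_le_iff₀ (by positivity)]
        linarith
    calc _ ≤ ∫ x, 2 * ρ / (ρ + |q₁ - x|) ∂(unif 0 D) := by
          refine integral_mono_of_nonneg (ae_of_all _ fun _ => norm_nonneg _) hi ?_
          filter_upwards [hmem] with q₂ hq₂
          exact norm_vertCorr_le hL hD hDL hΛ hρ a hq₁ hq₂
      _ ≤ D⁻¹ * (4 * ρ * Real.log (1 + D / ρ)) := by
          rw [integral_unif hD, smul_eq_mul]
          exact mul_le_mul_of_nonneg_left (integral_inv_add_abs_le hρ0 hq₁) (inv_pos.2 hD).le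
      _ = _ := by ring
  refine (integral_mono_of_nonneg (ae_of_all _ fun u => integral_nonneg fun _ => norm_nonneg _)
    (integrable_const _) hinner).trans ?_
  simp

/-- With β = D²/(λL), heights decorrelate at a scale of order λL/D = D/β, so the average correlation
is of order (log β)/β, which is what M was defined to match. If M = 1 the trivial bound suffices. -/
theorem integral_norm_vertCorr_le_dof {wl : ℝ} (hL : 0 < L) (hD : 0 < D) (hDL : 2 * D ≤ L)
    (hwl : 0 < wl) (a : ℝ) :
    ∫ q₁, ∫ q₂, ‖vertCorr L (2 * Real.pi / wl) D a q₁ q₂‖ ∂(unif 0 D) ∂(unif 0 D) ≤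
      4000 / dof D L wl := by
  have := isProbabilityMeasure_unif 0 hD
  have hΛ : 0 < 2 * Real.pi / wl := by positivity
  set β := D ^ 2 / (wl * L) with hβ
  have hβ0 : 0 < β := by positivity
  have hdof : dof D L wl = max 1 (β * (1 + max (Real.logb 2 β) 0)⁻¹) := rfl
  rcases le_or_gt (β * (1 + max (Real.logb 2 β) 0)⁻¹) 1 with hle | hgt
  · rw [hdof, max_eq_left hle]
    have h1 : ∫ q₁, ∫ q₂, ‖vertCorr L (2 * Real.pi / wl) D a q₁ q₂‖ ∂(unif 0 D) ∂(unif 0 D) ≤ 1 :=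
      (le_abs_self _).trans (abs_integral_le_of_abs_le fun _ => abs_integral_le_of_abs_le fun _ => by
        rw [abs_norm]; exact norm_vertCorr_le_one hL hD _ _ _)
    linarith
  rw [hdof, max_eq_right hgt.le]
  have hmx : 0 ≤ max (Real.logb 2 β) 0 := le_max_right _ _
  have hβ1 : 1 < β := by
    refine hgt.trans_le (mul_le_of_le_one_right hβ0.le (inv_le_one_of_one_le₀ (by linarith)))
  -- The constant 1000 works because 6272/(2π) = 3136/π < 1000.
  have hρ : 6272 * L / (2 * Real.pi / wl * D) ≤ 1000 * D / β := by
    have hpi := Real.pi_gt_d2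
    have e1 : 6272 * L / (2 * Real.pi / wl * D) = 3136 / Real.pi * (wl * L / D) := by
      field_simp; ring
    have e2 : 1000 * D / β = 1000 * (wl * L / D) := by rw [hβ]; field_simp
    rw [e1, e2]
    refine mul_le_mul_of_nonneg_right ?_ (by positivity)
    rw [div_le_iff₀ Real.pi_pos]; linarith
  refine (integral_norm_vertCorr_le hL hD hDL hΛ hρ a).trans ?_
  have e3 : D / (1000 * D / β) = β / 1000 := by field_simp
  have e4 : 4 * (1000 * D / β / D) = 4000 / β := by field_simp; norm_num
  rw [e3, e4]
  have hlog : Real.log (1 + β / 1000) ≤ 1 + max (Real.logb 2 β) 0 := by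
    have hl2 : Real.log 2 ≤ 1 := by linarith [Real.log_two_lt_d9]
    have hlβ : 0 ≤ Real.log β := Real.log_nonneg hβ1.le
    calc Real.log (1 + β / 1000) ≤ Real.log (2 * β) :=
          Real.log_le_log (by positivity) (by linarith)
      _ = Real.log 2 + Real.log β := Real.log_mul two_ne_zero hβ0.ne'
      _ ≤ 1 + Real.logb 2 β := by
          refine add_le_add hl2 ?_
          rw [Real.logb, le_div_iff₀ (Real.log_pos one_lt_two)]
          exact mul_le_of_le_one_right hlβ hl2
      _ ≤ _ := by gcongr; exact le_max_left _ _
  calc 4000 / β * Real.log (1 + β / 1000) ≤ 4000 / β * (1 + max (Real.logb 2 β) 0) := by gcongr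
    _ = _ := by
      have : 1 + max (Real.logb 2 β) 0 ≠ 0 := by positivity
      field_simp

end

/-! ### The normalized channel matrix -/

/-- The normalized gain from the position `t` to the position `r`. -/
noncomputable def gain (L Λ : ℝ) (r t : ℝ × ℝ) : ℂ := vertKernel L Λ (r.1 - t.1) r.2 t.2

theorem measurable_gain (L Λ : ℝ) : Measurable (Function.uncurry (gain L Λ)) :=
  (measurable_vertKernel L Λ).comp
    (by fun_prop : Measurable fun p : (ℝ × ℝ) × (ℝ × ℝ) => (p.1.1 - p.2.1, (p.1.2, p.2.2)))

theorem norm_gain_le {L : ℝ} (hL : 0 < L) (Λ : ℝ) (r t : ℝ × ℝ) : ‖gain L Λ r t‖ ≤ 1 :=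
  norm_vertKernel_le hL _ _ _ _

theorem integral_rowCorr_gain_le {L D wl : ℝ} (hL : 0 < L) (hD : 0 < D) (hDL : 2 * D ≤ L)
    (hwl : 0 < wl) (r : ℝ × ℝ) :
    ∫ r', ‖rowCorr (uniformSquare 0 0 D) (gain L (2 * Real.pi / wl)) r r'‖ ^ 2
      ∂(uniformSquare L 0 D) ≤ 4000 / dof D L wl := by
  have := isProbabilityMeasure_unif 0 hD
  have := isProbabilityMeasure_unif L hD
  rw [uniformSquare_eq_prod, uniformSquare_eq_prod]
  exact integral_rowCorr_sq_le_of_vertical (measurable_gain L (2 * Real.pi / wl))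
    (norm_gain_le hL _) (fun u p => integral_norm_vertCorr_le_dof hL hD hDL hwl (u - p)) r

/-- The kernel is symmetric in the two heights and both squares span the same heights, so columns
lead to the same vertical integral as rows. -/
theorem integral_colCorr_gain_le {L D wl : ℝ} (hL : 0 < L) (hD : 0 < D) (hDL : 2 * D ≤ L)
    (hwl : 0 < wl) (t : ℝ × ℝ) :
    ∫ t', ‖rowCorr (uniformSquare L 0 D) (fun t r => gain L (2 * Real.pi / wl) r t) t t'‖ ^ 2
      ∂(uniformSquare 0 0 D) ≤ 4000 / dof D L wl := by
  have := isProbabilityMeasure_unif 0 hD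
  have := isProbabilityMeasure_unif L hD
  rw [uniformSquare_eq_prod, uniformSquare_eq_prod]
  have hm : Measurable (Function.uncurry fun t r => gain L (2 * Real.pi / wl) r t) :=
    (measurable_gain L (2 * Real.pi / wl)).comp measurable_swap
  refine integral_rowCorr_sq_le_of_vertical hm (fun t r => norm_gain_le hL _ r t)
    (fun p u => ?_) t
  have h := integral_norm_vertCorr_le_dof hL hD hDL hwl (u - p)
  have e : ∀ q₁ q₂, vertCorr L (2 * Real.pi / wl) D (u - p) q₁ q₂ =
      ∫ y, vertKernel L (2 * Real.pi / wl) (u - p) q₁ y *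
        star (vertKernel L (2 * Real.pi / wl) (u - p) q₂ y) ∂(unif 0 D) := fun q₁ q₂ =>
    integral_congr_ae (ae_of_all _ fun y => by
      simp only
      rw [vertKernel_symm _ _ _ q₁ y, vertKernel_symm _ _ _ q₂ y])
  simp_rw [e] at h
  exact h

/-! ### Frobenius norms, traces and four-cycles -/

theorem frobSq_eq_trace {m n : Type*} [Fintype m] [Fintype n] (A : Matrix m n ℂ) :
    ((frobSq A : ℝ) : ℂ) = (Aᴴ * A).trace := by
  simp only [frobSq, Matrix.trace, Matrix.diag, Matrix.mul_apply, Matrix.conjTranspose_apply]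
  rw [Finset.sum_comm]
  push_cast
  refine Finset.sum_congr rfl fun j _ => Finset.sum_congr rfl fun i _ => ?_
  exact (Complex.conj_mul' (A i j)).symm

theorem frobSq_mul_conjTranspose {m n : Type*} [Fintype m] [Fintype n] (A : Matrix m n ℂ) :
    frobSq (A * Aᴴ) = frobSq (Aᴴ * A) := by
  have h : ((frobSq (A * Aᴴ) : ℝ) : ℂ) = frobSq (Aᴴ * A) := by
    rw [frobSq_eq_trace, frobSq_eq_trace]
    simp only [Matrix.conjTranspose_mul, Matrix.conjTranspose_conjTranspose]
    rw [Matrix.mul_assoc, Matrix.trace_mul_comm]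
    simp only [Matrix.mul_assoc]
  exact_mod_cast h

theorem frobSq_smul {m n : Type*} [Fintype m] [Fintype n] (c : ℂ) (A : Matrix m n ℂ) :
    frobSq (c • A) = ‖c‖ ^ 2 * frobSq A := by
  simp only [frobSq, Matrix.smul_apply, smul_eq_mul, norm_mul, mul_pow, Finset.mul_sum]

theorem re_trace_mul_le {m n : Type*} [Fintype m] [Fintype n] (A : Matrix m n ℂ)
    (B : Matrix n m ℂ) : (A * B).trace.re ≤ Real.sqrt (frobSq A) * Real.sqrt (frobSq B) := by
  have h1 : ‖(A * B).trace‖ ≤ ∑ p : m × n, ‖A p.1 p.2‖ * ‖B p.2 p.1‖ := by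
    rw [Fintype.sum_prod_type]
    simp only [Matrix.trace, Matrix.diag, Matrix.mul_apply]
    refine (norm_sum_le _ _).trans (Finset.sum_le_sum fun i _ => (norm_sum_le _ _).trans ?_)
    exact Finset.sum_le_sum fun j _ => (norm_mul _ _).le
  refine (Complex.re_le_norm _).trans (h1.trans ((Real.sum_mul_le_sqrt_mul_sqrt _ _ _).trans ?_))
  rw [Fintype.sum_prod_type, Fintype.sum_prod_type_right]
  rfl

/-- Cyclicity of the trace followed by Cauchy–Schwarz. It separates the interference from the random
channel, which makes the high-probability event uniform over all interference laws. -/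
theorem re_trace_conj_mul_le {n : Type*} [Fintype n] (H S : Matrix n n ℂ) (hS : S.IsHermitian) :
    (Hᴴ * S * H).trace.re ≤ Real.sqrt (S * S).trace.re * Real.sqrt (frobSq (Hᴴ * H)) := by
  have h1 : frobSq S = (S * S).trace.re := by
    have := frobSq_eq_trace S
    rw [hS.eq] at this
    rw [← this, Complex.ofReal_re]
  rw [← h1, ← frobSq_mul_conjTranspose, Matrix.mul_assoc, Matrix.trace_mul_comm, Matrix.mul_assoc]
  exact re_trace_mul_le _ _

theorem isHermitian_covMatrix {N : ℕ} (μ : Measure (Fin N → ℂ)) : (covMatrix μ).IsHermitian := by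
  ext i j
  simp only [covMatrix, Matrix.conjTranspose_apply, Matrix.of_apply, ← integral_star, star_mul',
    star_star]
  exact integral_congr_ae (ae_of_all _ fun w => mul_comm _ _)

/-- The squared Frobenius norm of `A * Aᴴ` as a sum over four-cycles. -/
theorem frobSq_mul_conjTranspose_eq_sum {α β : Type*} {N : ℕ} (h : α → β → ℂ) (x : Fin N → α)
    (y : Fin N → β) {A : Matrix (Fin N) (Fin N) ℂ} (hA : ∀ i k, A i k = h (x i) (y k)) :
    frobSq (A * Aᴴ) =
      ∑ i, ∑ j, ∑ k, ∑ l, cycleKernel h (x i) (x j) (y k) (y l) := by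
  unfold frobSq
  refine Finset.sum_congr rfl fun i _ => Finset.sum_congr rfl fun j _ => ?_
  have : ((‖(A * Aᴴ) i j‖ ^ 2 : ℝ) : ℂ) = ∑ k, ∑ l,
      (h (x i) (y k) * star (h (x j) (y k))) * star (h (x i) (y l) * star (h (x j) (y l))) := by
    push_cast
    rw [← Complex.mul_conj', ← Finset.sum_mul_sum]
    simp only [Matrix.mul_apply, Matrix.conjTranspose_apply, hA]
    rw [map_sum]
    rfl
  rw [← Complex.ofReal_re (‖(A * Aᴴ) i j‖ ^ 2), this]
  simp only [Complex.re_sum, cycleKernel]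

/-- The quadruples with i = j or k = l number at most 2N³, and each contributes at most one. -/
theorem frobSq_conjTranspose_mul_le {α β : Type*} {N : ℕ} {h : α → β → ℂ}
    (hb : ∀ r t, ‖h r t‖ ≤ 1) (x : Fin N → α) (y : Fin N → β) {A : Matrix (Fin N) (Fin N) ℂ}
    (hA : ∀ i k, A i k = h (x i) (y k)) :
    frobSq (Aᴴ * A) ≤ fourSum (cycleKernel h) x y + 2 * (N : ℝ) ^ 3 := by
  rw [← frobSq_mul_conjTranspose, frobSq_mul_conjTranspose_eq_sum h x y hA]
  have h1 : ∀ i j k l : Fin N, cycleKernel h (x i) (x j) (y k) (y l) ≤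
      ((if i = j then 0 else if k = l then 0 else cycleKernel h (x i) (x j) (y k) (y l)) +
        (if i = j then 1 else 0)) + (if k = l then 1 else 0) := by
    intro i j k l
    have := (le_abs_self _).trans (abs_cycleKernel_le hb (x i) (x j) (y k) (y l))
    split_ifs <;> linarith
  refine (Finset.sum_le_sum fun i _ => Finset.sum_le_sum fun j _ => Finset.sum_le_sum fun k _ =>
    Finset.sum_le_sum fun l _ => h1 i j k l).trans (le_of_eq ?_)
  simp only [Finset.sum_add_distrib]
  have h2 : ∀ i j k : Fin N, ∑ l, (if i = j then (0:ℝ) else if k = l then 0 else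
      cycleKernel h (x i) (x j) (y k) (y l)) = if i = j then 0 else ∑ l, if k = l then 0 else
      cycleKernel h (x i) (x j) (y k) (y l) := by
    intro i j k; split_ifs <;> simp
  have h3 : ∀ i j : Fin N, ∑ k, (if i = j then (0:ℝ) else ∑ l, if k = l then 0 else
      cycleKernel h (x i) (x j) (y k) (y l)) = if i = j then 0 else ∑ k, ∑ l, if k = l then 0 else
      cycleKernel h (x i) (x j) (y k) (y l) := by
    intro i j; split_ifs <;> simp
  simp only [h2, h3, fourSum, offDiagSum]
  simp
  ring

/-! ### From matrix bounds to a capacity bound -/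

/-- Optimization over t of a linear minus a quadratic term. Signal and interference contribute order
x²N²κ to the quadratic coefficient, the noise order xN, which 1 ≤ Nκ allows to be absorbed. -/
theorem ofReal_le_capacity_of_bounds {N : ℕ} (H : Matrix (Fin N) (Fin N) ℂ)
    (μW : Measure (Fin N → ℂ)) [IsProbabilityMeasure μW]
    (hW : ∀ i, MemLp (fun w => w i) 2 μW) {P x κ b : ℝ} (hP : 0 < P) (hx : 0 < x) (hb : 0 ≤ b)
    (hN : 0 < (N : ℝ)) (hκ : 1 ≤ N * κ) (hl : x * N / 4 ≤ P * frobSq H)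
    (hu : P * frobSq H ≤ 4 * x * N)
    (h2 : P ^ 2 * frobSq (Hᴴ * H) ≤ 256000 * (x * N) ^ 2 * κ)
    (hS : (covMatrix μW * covMatrix μW).trace.re ≤ b ^ 2 * (x * N) ^ 2 * κ) :
    ENNReal.ofReal (x / (32 * κ * ((512000 + 2032 * b) * x + 16)) / Real.log 2) ≤
      capacity H μW P := by
  have hκ0 : 0 < κ := by
    by_contra hc
    nlinarith
  set A := P * frobSq H with hA
  set Q := P * (2 * (P * frobSq (Hᴴ * H)) + 4 * (Hᴴ * covMatrix μW * H).trace.re +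
    4 * frobSq H) with hQ
  set q := x * N ^ 2 * κ * ((512000 + 2032 * b) * x + 16) with hq
  have hB : 0 < (512000 + 2032 * b) * x + 16 := by positivity
  have hq0 : 0 < q := by positivity
  have hτ : P * (Hᴴ * covMatrix μW * H).trace.re ≤ 508 * b * (x * N) ^ 2 * κ := by
    have e1 : Real.sqrt (covMatrix μW * covMatrix μW).trace.re ≤ b * (x * N) * Real.sqrt κ := by
      rw [Real.sqrt_le_left (by positivity), mul_pow, mul_pow, Real.sq_sqrt hκ0.le]
      exact hS
    -- 508² = 258064 exceeds 256000.
    have e2 : P * Real.sqrt (frobSq (Hᴴ * H)) ≤ 508 * (x * N) * Real.sqrt κ := by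
      rw [← abs_of_pos hP, ← Real.sqrt_sq_eq_abs, ← Real.sqrt_mul (sq_nonneg P),
        Real.sqrt_le_left (by positivity), mul_pow, mul_pow, Real.sq_sqrt hκ0.le]
      refine h2.trans ?_
      have : 0 < (x * N) ^ 2 * κ := by positivity
      linarith
    calc P * (Hᴴ * covMatrix μW * H).trace.re
        ≤ P * (Real.sqrt (covMatrix μW * covMatrix μW).trace.re *
            Real.sqrt (frobSq (Hᴴ * H))) :=
          mul_le_mul_of_nonneg_left (re_trace_conj_mul_le H _ (isHermitian_covMatrix μW)) hP.le
      _ = Real.sqrt (covMatrix μW * covMatrix μW).trace.re *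
            (P * Real.sqrt (frobSq (Hᴴ * H))) := by ring
      _ ≤ (b * (x * N) * Real.sqrt κ) * (508 * (x * N) * Real.sqrt κ) :=
          mul_le_mul e1 e2 (by positivity) (by positivity)
      _ = 508 * b * (x * N) ^ 2 * (Real.sqrt κ * Real.sqrt κ) := by ring
      _ = _ := by rw [Real.mul_self_sqrt hκ0.le]
  have hQq : Q ≤ q := by
    have e : x * N ≤ x * N * (N * κ) := le_mul_of_one_le_right (by positivity) hκ
    calc Q = 2 * (P ^ 2 * frobSq (Hᴴ * H)) + 4 * (P * (Hᴴ * covMatrix μW * H).trace.re) +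
          4 * A := by rw [hQ, hA]; ring
      _ ≤ 2 * (256000 * (x * N) ^ 2 * κ) + 4 * (508 * b * (x * N) ^ 2 * κ) +
          4 * (4 * (x * N * (N * κ))) := by linarith
      _ = q := by rw [hq]; ring
  -- Maximizer of 2tA₀ − 2t²q for A₀ = xN/4; the maximum is A₀²/(2q).
  set t := x * N / 4 / (2 * q) with ht
  have ht0 : 0 ≤ t := by positivity
  refine le_trans (ENNReal.ofReal_le_ofReal ?_) (ofReal_le_capacity H μW hW hP.le t)
  refine div_le_div_of_nonneg_right ?_ (Real.log_nonneg one_le_two)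
  calc x / (32 * κ * ((512000 + 2032 * b) * x + 16))
      = 2 * t * (x * N / 4) - 2 * t ^ 2 * q := by
        rw [ht, hq]
        field_simp
        ring
    _ ≤ 2 * t * A - 2 * t ^ 2 * Q :=
        sub_le_sub (mul_le_mul_of_nonneg_left hl (by positivity))
          (mul_le_mul_of_nonneg_left hQq (by positivity))
    _ = _ := by rw [hQ]; ring

/-! ### Geometry of the two squares -/

section Geometry

variable {L D : ℝ} {r t : ℝ × ℝ}

theorem horizontal_bounds (hDL : 2 * D ≤ L) (hr : r ∈ square L 0 D) (ht : t ∈ square 0 0 D) :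
    L / 2 ≤ r.1 - t.1 ∧ r.1 - t.1 ≤ 3 * L / 2 := by
  obtain ⟨⟨h1, h2⟩, -⟩ := hr
  obtain ⟨⟨h3, h4⟩, -⟩ := ht
  constructor <;> linarith

theorem gain_eq (hDL : 2 * D ≤ L) (hr : r ∈ square L 0 D) (ht : t ∈ square 0 0 D) (Λ : ℝ) :
    gain L Λ r t = ((L / 2 * (planeDist r t)⁻¹ : ℝ) : ℂ) *
      Complex.exp (-Complex.I * ((Λ * planeDist r t : ℝ) : ℂ)) := by
  unfold gain vertKernel
  rw [if_pos (horizontal_bounds hDL hr ht)]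
  rfl

theorem channelMatrix_apply_eq {N : ℕ} (hL : 0 < L) (hDL : 2 * D ≤ L) {z : Placement N}
    (h1 : ∀ k, z.1 k ∈ square 0 0 D) (h2 : ∀ i, z.2 i ∈ square L 0 D) (G wl : ℝ) (i k : Fin N) :
    channelMatrix G wl z i k =
      ((2 * Real.sqrt G / L : ℝ) : ℂ) * gain L (2 * Real.pi / wl) (z.2 i) (z.1 k) := by
  rw [gain_eq hDL (h2 i) (h1 k), ← mul_assoc, ← Complex.ofReal_mul]
  simp only [channelMatrix, Matrix.of_apply]
  congr 3
  field_simp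

theorem le_norm_gain (hL : 0 < L) (hDL : 2 * D ≤ L) (hr : r ∈ square L 0 D)
    (ht : t ∈ square 0 0 D) (Λ : ℝ) : 1 / 4 ≤ ‖gain L Λ r t‖ := by
  obtain ⟨h1, h2⟩ := horizontal_bounds hDL hr ht
  have h0 : 0 < r.1 - t.1 := by linarith
  have hz : |r.2 - t.2| ≤ L / 2 := by
    obtain ⟨-, h3, h4⟩ := hr
    obtain ⟨-, h5, h6⟩ := ht
    rw [abs_le]
    constructor <;> linarith
  have h3 : planeDist r t ≤ 2 * L := hyp_le h0.le hL h2 hz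
  have h4 : 0 < planeDist r t := hyp_pos h0 _
  rw [gain_eq hDL hr ht, norm_mul, norm_exp_neg_I_mul, mul_one, Complex.norm_real,
    Real.norm_of_nonneg (by positivity), ← div_eq_mul_inv, le_div_iff₀ h4]
  linarith

theorem isProbabilityMeasure_uniformSquare (a b : ℝ) (hD : 0 < D) :
    IsProbabilityMeasure (uniformSquare a b D) := by
  have := isProbabilityMeasure_unif a hD
  have := isProbabilityMeasure_unif b hD
  rw [uniformSquare_eq_prod]
  infer_instance

theorem ae_placementLaw_mem (N : ℕ) (hD : 0 < D) (L : ℝ) :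
    ∀ᵐ z ∂placementLaw N D L, (∀ k, z.1 k ∈ square 0 0 D) ∧ ∀ i, z.2 i ∈ square L 0 D := by
  have := isProbabilityMeasure_uniformSquare 0 0 hD
  have := isProbabilityMeasure_uniformSquare L 0 hD
  have hs : ∀ a b : ℝ, ∀ᵐ p ∂uniformSquare a b D, p ∈ square a b D := fun a b =>
    ae_cond_mem (measurableSet_Icc.prod measurableSet_Icc)
  have h1 : ∀ᵐ x ∂Measure.pi fun _ : Fin N => uniformSquare 0 0 D, ∀ k, x k ∈ square 0 0 D :=
    ae_all_iff.2 fun k => (Measure.quasiMeasurePreserving_eval _ k).ae (hs 0 0)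
  have h2 : ∀ᵐ x ∂Measure.pi fun _ : Fin N => uniformSquare L 0 D, ∀ k, x k ∈ square L 0 D :=
    ae_all_iff.2 fun k => (Measure.quasiMeasurePreserving_eval _ k).ae (hs L 0)
  exact (Measure.quasiMeasurePreserving_fst.ae h1).and (Measure.quasiMeasurePreserving_snd.ae h2)

end Geometry

/-- Bounds on the channel matrix for a placement without an excess of four-cycles. -/
theorem frobSq_channelMatrix_bounds {N : ℕ} {D L G wl κ : ℝ} (hL : 0 < L) (hDL : 2 * D ≤ L)
    (hG : 0 < G) {z : Placement N} (h1 : ∀ k, z.1 k ∈ square 0 0 D)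
    (h2 : ∀ i, z.2 i ∈ square L 0 D) (hκ : 1 ≤ N * κ)
    (hz : fourSum (cycleKernel (gain L (2 * Real.pi / wl))) z.2 z.1 ≤ 2 * N ^ 4 * κ) :
    G / L ^ 2 * N ^ 2 / 4 ≤ frobSq (channelMatrix G wl z) ∧
      frobSq (channelMatrix G wl z) ≤ 4 * (G / L ^ 2) * N ^ 2 ∧
      frobSq ((channelMatrix G wl z)ᴴ * channelMatrix G wl z) ≤
        64 * (G / L ^ 2) ^ 2 * N ^ 4 * κ := by
  set h := gain L (2 * Real.pi / wl)
  set A : Matrix (Fin N) (Fin N) ℂ := Matrix.of fun i k => h (z.2 i) (z.1 k) with hA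
  have hH : channelMatrix G wl z = ((2 * Real.sqrt G / L : ℝ) : ℂ) • A := by
    ext i k
    exact channelMatrix_apply_eq hL hDL h1 h2 G wl i k
  have hc : ‖((2 * Real.sqrt G / L : ℝ) : ℂ)‖ ^ 2 = 4 * (G / L ^ 2) := by
    rw [Complex.norm_real, Real.norm_eq_abs, sq_abs, div_pow, mul_pow, Real.sq_sqrt hG.le]
    ring
  have hHH : (channelMatrix G wl z)ᴴ * channelMatrix G wl z =
      (star ((2 * Real.sqrt G / L : ℝ) : ℂ) * ((2 * Real.sqrt G / L : ℝ) : ℂ)) • (Aᴴ * A) := by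
    rw [hH, Matrix.conjTranspose_smul, Matrix.smul_mul, Matrix.mul_smul, smul_smul]
  have hg : 0 < G / L ^ 2 := by positivity
  have hAl : (N : ℝ) ^ 2 / 16 ≤ frobSq A := by
    have : ∑ _i : Fin N, ∑ _k : Fin N, ((1 : ℝ) / 4) ^ 2 ≤ frobSq A :=
      Finset.sum_le_sum fun i _ => Finset.sum_le_sum fun k _ =>
        pow_le_pow_left₀ (by norm_num) (le_norm_gain hL hDL (h2 i) (h1 k) _) 2
    refine le_trans (le_of_eq ?_) this
    simp
    ring
  have hAu : frobSq A ≤ (N : ℝ) ^ 2 := by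
    have : frobSq A ≤ ∑ _i : Fin N, ∑ _k : Fin N, (1 : ℝ) :=
      Finset.sum_le_sum fun i _ => Finset.sum_le_sum fun k _ =>
        pow_le_one₀ (norm_nonneg _) (norm_gain_le hL _ _ _)
    refine this.trans (le_of_eq ?_)
    simp
    ring
  have hAA : frobSq (Aᴴ * A) ≤ 4 * N ^ 4 * κ := by
    have := frobSq_conjTranspose_mul_le (norm_gain_le hL (2 * Real.pi / wl)) z.2 z.1 (A := A)
      fun i k => rfl
    have e : (N : ℝ) ^ 3 ≤ N ^ 3 * (N * κ) := le_mul_of_one_le_right (by positivity) hκ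
    calc frobSq (Aᴴ * A) ≤ 2 * N ^ 4 * κ + 2 * (N ^ 3 * (N * κ)) := by linarith
      _ = _ := by ring
  refine ⟨?_, ?_, ?_⟩
  · rw [hH, frobSq_smul, hc]
    nlinarith
  · rw [hH, frobSq_smul, hc]
    exact mul_le_mul_of_nonneg_left hAu (by positivity)
  · rw [hHH, frobSq_smul, norm_mul, norm_star, mul_pow, hc]
    calc _ ≤ 4 * (G / L ^ 2) * (4 * (G / L ^ 2)) * (4 * N ^ 4 * κ) :=
          mul_le_mul_of_nonneg_left hAA (by positivity)
      _ = _ := by ring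

theorem measure_fourSum_gain_ge_le {N : ℕ} {D L wl κ : ℝ} (hD : 0 < D) (hDL : 2 * D ≤ L)
    (hwl : 0 < wl) (hκ : 4000 / dof D L wl ≤ κ) (hN : 1 ≤ N * κ) :
    placementLaw N D L
      {z | 2 * N ^ 4 * κ ≤ fourSum (cycleKernel (gain L (2 * Real.pi / wl))) z.2 z.1} ≤
      ENNReal.ofReal (48 / N) := by
  have hL : 0 < L := by linarith
  have := isProbabilityMeasure_uniformSquare 0 0 hD
  have := isProbabilityMeasure_uniformSquare L 0 hD
  exact measure_fourSum_ge_le (measurable_gain L _) (norm_gain_le hL _)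
    (integral_rowCorr_gain_le hL hD hDL hwl) (integral_colCorr_gain_le hL hD hDL hwl) hκ hN

/-! ### The logarithm and its comparison with a rational function -/

/-- For s < 1 the fraction can be negative, but it stays above −1/s². The factor s₀²/2 ≤ s²/2 keeps
the product above −1/2, and the cap at 1 serves the case s ≥ 1 of `log_bound_le`. -/
theorem logArg_pos {N : ℕ} {L G P s s₀ : ℝ} (hs₀ : 0 < s₀) (hs : s₀ ≤ s)
    (hx : 0 ≤ N * G * P / L ^ 2) : 0 < logArg (min 1 (s₀ ^ 2 / 2)) N L G P s := by
  unfold logArg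
  set x := N * G * P / L ^ 2
  set K := min 1 (s₀ ^ 2 / 2)
  have hs' : 0 < s := hs₀.trans_le hs
  have hK : 0 < K := lt_min one_pos (by positivity)
  have hd : 0 < 1 + x * s := by positivity
  have hKs : K ≤ s ^ 2 / 2 := (min_le_right _ _).trans (by gcongr)
  have h1 : -(s ^ 2)⁻¹ ≤ x * (1 - s⁻¹) / (1 + x * s) := by
    rw [le_div_iff₀ hd]
    have e : -(s ^ 2)⁻¹ * (1 + x * s) = -(s ^ 2)⁻¹ - x * s⁻¹ := by field_simp; ring
    have : 0 < (s ^ 2)⁻¹ := by positivity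
    rw [e]
    linarith
  have h2 : K * (s ^ 2)⁻¹ ≤ 1 / 2 := by
    rw [← div_eq_mul_inv, div_le_iff₀ (by positivity)]
    linarith
  nlinarith [mul_le_mul_of_nonneg_left h1 hK.le]

/-- The elementary comparison of the logarithmic bound with the rational one. -/
theorem log_bound_le {N : ℕ} {L G P s s₀ ν c κ m : ℝ} (hν : 1 ≤ ν) (hs₀ : 0 < s₀) (hs : s₀ ≤ s)
    (hc : 0 < c) (hκ : 0 < κ) (hm : 0 ≤ m) (hmκ : m ≤ κ⁻¹) (hx : 0 < N * G * P / L ^ 2) :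
    1 / (32 * (512000 + 2032 * Real.sqrt c)) / s ^ (ν + 4) * m *
        Real.logb 2 (logArg (min 1 (s₀ ^ 2 / 2)) N L G P s) ≤
      N * G * P / L ^ 2 / (32 * κ * ((512000 + 2032 * Real.sqrt (c * s ^ ν)) *
        (N * G * P / L ^ 2) + 16)) / Real.log 2 := by
  have hlp := logArg_pos hs₀ hs hx.le
  have hlog : 0 < Real.log 2 := Real.log_pos one_lt_two
  have hs' : 0 < s := hs₀.trans_le hs
  unfold logArg at hlp ⊢
  set x := N * G * P / L ^ 2
  set K := min 1 (s₀ ^ 2 / 2)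
  have hK : 0 < K := lt_min one_pos (by positivity)
  have hd : 0 < 1 + x * s := by positivity
  rcases le_total s 1 with h1 | h1
  · have hneg : x * (1 - s⁻¹) / (1 + x * s) ≤ 0 := by
      refine div_nonpos_of_nonpos_of_nonneg (mul_nonpos_of_nonneg_of_nonpos hx.le ?_) hd.le
      have := (one_le_inv₀ hs').2 h1
      linarith
    refine le_trans (mul_nonpos_of_nonneg_of_nonpos (by positivity) ?_) (by positivity)
    exact Real.logb_nonpos one_lt_two hlp.le (by nlinarith)
  -- For s ≥ 1 all dependence on s inside the logarithm can be dropped. The powers of s in the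
  -- denominator of the claim only have to absorb √(s^ν).
  · have hy : K * (x * (1 - s⁻¹) / (1 + x * s)) ≤ x / (1 + x) := by
      have e1 : x * (1 - s⁻¹) ≤ x := mul_le_of_le_one_right hx.le (by
        have := inv_pos.2 hs'; linarith)
      have e0 : 0 ≤ x * (1 - s⁻¹) / (1 + x * s) := by
        have := inv_le_one_of_one_le₀ h1
        have : 0 ≤ 1 - s⁻¹ := by linarith
        positivity
      refine (mul_le_of_le_one_left e0 (min_le_left _ _)).trans ?_
      exact div_le_div₀ hx.le e1 (by positivity) (by nlinarith)
    have hl : Real.logb 2 (1 + K * (x * (1 - s⁻¹) / (1 + x * s))) ≤ x / (1 + x) / Real.log 2 := by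
      refine div_le_div_of_nonneg_right ?_ hlog.le
      have := Real.log_le_sub_one_of_pos hlp
      linarith
    have hp1 : 1 ≤ s ^ (ν + 4) := Real.one_le_rpow h1 (by linarith)
    have hpv : Real.sqrt (s ^ ν) ≤ s ^ (ν + 4) := by
      have e1 : 1 ≤ s ^ ν := Real.one_le_rpow h1 (by linarith)
      refine (Real.sqrt_le_iff.2 ⟨by positivity, by nlinarith⟩ : Real.sqrt (s ^ ν) ≤ s ^ ν).trans ?_
      exact Real.rpow_le_rpow_of_exponent_le h1 (by linarith)
    set S := s ^ (ν + 4)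
    set B := 512000 + 2032 * Real.sqrt c
    have hB : 0 < B := by positivity
    have hden : (512000 + 2032 * Real.sqrt (c * s ^ ν)) * x + 16 ≤ B * S * (1 + x) := by
      rw [Real.sqrt_mul hc.le]
      have e2 : Real.sqrt c * Real.sqrt (s ^ ν) ≤ Real.sqrt c * S :=
        mul_le_mul_of_nonneg_left hpv (Real.sqrt_nonneg c)
      have e3 : 512000 + 2032 * (Real.sqrt c * Real.sqrt (s ^ ν)) ≤ B * S := by
        simp only [B]; nlinarith
      have e4 : 16 ≤ B * S := by
        have : 0 ≤ Real.sqrt c * Real.sqrt (s ^ ν) := by positivity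
        linarith
      nlinarith [mul_le_mul_of_nonneg_right e3 hx.le]
    calc _ ≤ 1 / (32 * B) / S * m * (x / (1 + x) / Real.log 2) :=
          mul_le_mul_of_nonneg_left hl (by positivity)
      _ ≤ 1 / (32 * B) / S * κ⁻¹ * (x / (1 + x) / Real.log 2) := by gcongr
      _ = x / (32 * κ * (B * S * (1 + x))) / Real.log 2 := by field_simp
      _ ≤ _ := by gcongr

/-- For a placement without an excess of four-cycles, the capacity bound holds for every
interference that satisfies the second moment condition. -/
theorem capacity_ge_of_fourSum_le {N : ℕ} {D L wl G P s s₀ ν c : ℝ} (hν : 1 ≤ ν) (hs₀ : 0 < s₀)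
    (hs : s₀ ≤ s) (hc : 0 < c) (hN : 0 < (N : ℝ)) (hL : 0 < L) (hDL : 2 * D ≤ L) (hG : 0 < G)
    (hP : 0 < P) {z : Placement N} (h1 : ∀ k, z.1 k ∈ square 0 0 D)
    (h2 : ∀ i, z.2 i ∈ square L 0 D)
    (hz : fourSum (cycleKernel (gain L (2 * Real.pi / wl))) z.2 z.1 ≤
      2 * N ^ 4 * (4000 * (min (N : ℝ) (dof D L wl))⁻¹))
    (μW : Measure (Fin N → ℂ)) [IsProbabilityMeasure μW] (hW : ∀ i, MemLp (fun w => w i) 2 μW)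
    (hρ : rho2 L G P (covMatrix μW) ≤
      c * (s ^ ν * max ((N : ℝ) ^ 2) ((N : ℝ) ^ 3 * (dof D L wl)⁻¹))) :
    ENNReal.ofReal (1 / (32 * (512000 + 2032 * Real.sqrt c)) / s ^ (ν + 4) *
        min (N : ℝ) (dof D L wl) * Real.logb 2 (logArg (min 1 (s₀ ^ 2 / 2)) N L G P s)) ≤
      capacity (channelMatrix G wl z) μW P := by
  have hM : 0 < dof D L wl := one_pos.trans_le (le_max_left _ _)
  set m := min (N : ℝ) (dof D L wl) with hm
  have hm0 : 0 < m := lt_min hN hM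
  have hmN : m ≤ N := min_le_left _ _
  have hmM : m ≤ dof D L wl := min_le_right _ _
  have hs' : 0 < s := hs₀.trans_le hs
  have hκ0 : 0 < m⁻¹ := inv_pos.2 hm0
  have hκ : 1 ≤ N * m⁻¹ := by
    rw [← div_eq_mul_inv, one_le_div hm0]
    exact hmN
  have hx : 0 < N * G * P / L ^ 2 := by positivity
  have hκ' : 1 ≤ N * (4000 * m⁻¹) := by linarith
  obtain ⟨b1, b2, b3⟩ := frobSq_channelMatrix_bounds hL hDL hG h1 h2 hκ' hz
  -- The two cases of the maximum are those of m = min(N, M). The hypothesis thus becomes tr Σ² ≤ c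
  -- s^ν (xN)²/m, the same scale as the bound for P²‖HᴴH‖².
  have hmax : max ((N : ℝ) ^ 2) ((N : ℝ) ^ 3 * (dof D L wl)⁻¹) ≤ N ^ 3 * m⁻¹ := by
    refine max_le ?_ (by gcongr)
    calc (N : ℝ) ^ 2 ≤ N ^ 2 * (N * m⁻¹) := le_mul_of_one_le_right (by positivity) hκ
      _ = _ := by ring
  have hsv : 0 < s ^ ν := Real.rpow_pos_of_pos hs' ν
  have hS : (covMatrix μW * covMatrix μW).trace.re ≤
      Real.sqrt (c * s ^ ν) ^ 2 * (N * G * P / L ^ 2 * N) ^ 2 * m⁻¹ := by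
    rw [Real.sq_sqrt (by positivity)]
    calc (covMatrix μW * covMatrix μW).trace.re
        = rho2 L G P (covMatrix μW) * (N * (G * P) ^ 2 / L ^ 4) := by
          unfold rho2
          field_simp
      _ ≤ c * (s ^ ν * (N ^ 3 * m⁻¹)) * (N * (G * P) ^ 2 / L ^ 4) := by
          gcongr
          exact hρ.trans (by gcongr)
      _ = _ := by field_simp
  refine le_trans (ENNReal.ofReal_le_ofReal
    (log_bound_le hν hs₀ hs hc hκ0 hm0.le (inv_inv m).ge hx)) ?_
  refine ofReal_le_capacity_of_bounds _ μW hW hP hx (Real.sqrt_nonneg _) hN hκ ?_ ?_ ?_ hS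
  · calc _ = P * (G / L ^ 2 * N ^ 2 / 4) := by ring
      _ ≤ _ := mul_le_mul_of_nonneg_left b1 hP.le
  · calc _ ≤ P * (4 * (G / L ^ 2) * N ^ 2) := mul_le_mul_of_nonneg_left b2 hP.le
      _ = _ := by ring
  · calc _ ≤ P ^ 2 * (64 * (G / L ^ 2) ^ 2 * N ^ 4 * (4000 * m⁻¹)) :=
          mul_le_mul_of_nonneg_left b3 (by positivity)
      _ = _ := by ring

end MIMO

/-! ### Assembly -/

theorem corollary2 (ν c₁ c₂ s₀ : ℝ) (hν : 1 ≤ ν) (hc₁ : 0 < c₁) (hc₂ : 0 < c₂) (hs₀ : 0 < s₀) :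
    ∃ K₅ K₆ : ℝ, 0 < K₅ ∧ 0 < K₆ ∧
      ∀ D L wl G P s : ℕ → ℝ,
        (∀ N, 0 < D N) → (∀ N, 2 * D N ≤ L N) → (∀ N, 0 < wl N) →
        (∀ N, 0 < G N) → (∀ N, 0 < P N) → (∀ᶠ N in atTop, s₀ ≤ s N) →
        (∀ᶠ N in atTop, 0 < MIMO.logArg K₆ N (L N) (G N) (P N) (s N)) ∧
        MIMO.WithHighProbability (fun N => MIMO.placementLaw N (D N) (L N)) (fun N =>
          {z : MIMO.Placement N |
            ∀ μW : Measure (Fin N → ℂ), IsProbabilityMeasure μW →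
              (∀ i, MemLp (fun w : Fin N → ℂ => w i) 2 μW) →
              MIMO.rho1 (L N) (G N) (P N) (MIMO.covMatrix μW) ≤ c₁ * (s N * (N : ℝ)) →
              MIMO.rho2 (L N) (G N) (P N) (MIMO.covMatrix μW) ≤
                c₂ * (s N ^ ν * max ((N : ℝ) ^ 2)
                  ((N : ℝ) ^ 3 * (MIMO.dof (D N) (L N) (wl N))⁻¹)) →
              ENNReal.ofReal
                  (K₅ / s N ^ (ν + 4) * min (N : ℝ) (MIMO.dof (D N) (L N) (wl N)) *
                    Real.logb 2 (MIMO.logArg K₆ N (L N) (G N) (P N) (s N))) ≤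
                MIMO.capacity (MIMO.channelMatrix (G N) (wl N) z) μW (P N)}) := by
  refine ⟨1 / (32 * (512000 + 2032 * Real.sqrt c₂)), min 1 (s₀ ^ 2 / 2), by positivity,
    lt_min one_pos (by positivity), ?_⟩
  intro D L wl G P s hD hDL hwl hG hP hs
  have hL : ∀ N, 0 < L N := fun N => by linarith [hD N, hDL N]
  refine ⟨?_, ?_⟩
  · filter_upwards [hs] with N hsN
    have := hL N
    have := hG N
    have := hP N
    exact MIMO.logArg_pos hs₀ hsN (by positivity)
  · have hlim : Tendsto (fun N : ℕ => ENNReal.ofReal (48 / (N : ℝ))) atTop (𝓝 0) := by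
      rw [← ENNReal.ofReal_zero]
      exact (ENNReal.continuous_ofReal.tendsto 0).comp (tendsto_const_div_atTop_nhds_zero_nat 48)
    refine tendsto_of_tendsto_of_tendsto_of_le_of_le' tendsto_const_nhds hlim
      (Eventually.of_forall fun _ => zero_le) ?_
    filter_upwards [hs, eventually_ge_atTop 1] with N hsN hN1
    have hN : 0 < (N : ℝ) := by exact_mod_cast hN1
    have hM : 0 < MIMO.dof (D N) (L N) (wl N) := one_pos.trans_le (le_max_left _ _)
    have hm : 0 < min (N : ℝ) (MIMO.dof (D N) (L N) (wl N)) := lt_min hN hM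
    refine le_trans ?_ (MIMO.measure_fourSum_gain_ge_le (N := N)
      (κ := 4000 * (min (N : ℝ) (MIMO.dof (D N) (L N) (wl N)))⁻¹) (hD N) (hDL N) (hwl N) ?_ ?_)
    -- Almost every failing placement has an excess of four-cycles, an event that does not involve
    -- the interference. Monotonicity of the outer measure suffices, so the failure set need not be
    -- measurable.
    · refine measure_mono_ae ?_
      filter_upwards [MIMO.ae_placementLaw_mem N (hD N) (L N)] with z hz hzE
      by_contra hlt
      refine hzE fun μW hμW hW _ hρ => ?_
      exact MIMO.capacity_ge_of_fourSum_le hν hs₀ hsN hc₂ hN (hL N) (hDL N) (hG N) (hP N)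
        hz.1 hz.2 (not_le.1 hlt).le μW hW hρ
    · rw [div_eq_mul_inv]
      have := min_le_right (N : ℝ) (MIMO.dof (D N) (L N) (wl N))
      gcongr
    · have : 1 ≤ N * (min (N : ℝ) (MIMO.dof (D N) (L N) (wl N)))⁻¹ := by
        rw [← div_eq_mul_inv, one_le_div hm]
        exact min_le_left _ _
      linarith
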